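/- **Conventions.** All graded objects are sequences indexed by $\mathbb{Z}$; only homogeneous elements occur and $|\cdot|$ denotes their degree. A graded manifold $\mathcal{M}=(M,\mathcal{C}^\infty_{\mathcal M})$ is a second countable Hausdorff space $M$ with a sheaf of graded commutative associative unital real algebras that is locally isomorphic to a graded domain of a fixed finite graded dimension (functions of degree $k$ on a graded domain are formal power series, homogeneous of degree $k$, in finitely many graded commuting variables of nonzero degrees with coefficients smooth functions on an open subset of $\mathbb{R}^{n_0}$). A graded vector bundle $\mathcal{E}$ over $\mathcal{M}$ is a sheaf $\Gamma_{\mathcal E}$ of graded $\mathcal{C}^\infty_{\mathcal M}$-modules that is locally free and finitely generated of constant graded rank. Its dual $\mathcal{E}^*$ has as sections of degree $k$ the $\mathbb{R}$-linear maps $\alpha:\Gamma_{\mathcal E}\to\mathcal{C}^\infty_{\mathcal M}$ of degree $k$ with $\alpha(f\psi)=(-1)^{k|f|}f\alpha(\psi)$. A vector bundle map $F:\mathcal{E}\to\mathcal{E}'$ of degree $d$ is an $\mathbb R$-linear map of global sections of degree $d$ with $F(f\psi)=(-1)^{|f|d}fF(\psi)$. The tangent bundle $T\mathcal{M}$ has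 as sections the graded derivations of $\mathcal{C}^\infty_{\mathcal M}$, with $[X,Y]=XY-(-1)^{|X||Y|}YX$; $T^*\mathcal{M}$ is its dual. A shift $\mathcal{E}[\ell]$ has $\Gamma_{\mathcal E[\ell]}(U)_j=\Gamma_{\mathcal E}(U)_{j+\ell}$ with the action $f\triangleright\psi=(-1)^{|f|\ell}f\psi$. A $p$-form $\omega$ of degree $|\omega|$ is a $p$-linear map on global vector fields with values in functions such that $|\omega(X_1,\dots,X_p)|=|\omega|+\sum_i|X_i|$, $\omega(fX_1,\dots)=(-1)^{|f||\omega|}f\,\omega(X_1,\dots)$ and $\omega(\dots,X_i,X_{i+1},\dots)=-(-1)^{|X_i||X_{i+1}|}\omega(\dots,X_{i+1},X_i,\dots)$. Moreover $$(\mathrm d\omega)(X_1,\dots,X_{p+1})=\sum_{r}(-1)^{r+1+(|X_r|-1)|\omega|+|X_r|(|X_1|+\dots+|X_{r-1}|)}X_r\big(\omega(\dots,\hat X_r,\dots)\big)+\sum_{i<j}(-1)^{|\omega|+i+j}\sigma_{ij}\,\omega([X_i,X_j],\dots,\hat X_i,\dots,\hat X_j,\dots),$$ where $\sigma_{ij}=\pm1$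 is the Koszul sign of moving $X_iX_j$ to the front of $X_1\cdots X_{p+1}$ and, in each term, the remaining $X_s$ follow in their order; $(i_X\omega)(X_1,\dots,X_{p-1})=(-1)^{|\omega|(|X|-1)}\omega(X,X_1,\dots,X_{p-1})$, with $i_Xf=0$ for a function $f$; and $\mathcal{L}_X=i_X\circ\mathrm d+(-1)^{|X|}\,\mathrm d\circ i_X$. A *graded Courant algebroid of degree $\ell$* is a tuple $(\mathcal E,\rho,g,[\cdot,\cdot])$ where $\mathcal{E}$ is a graded vector bundle over $\mathcal{M}$; $\rho:\mathcal E\to T\mathcal M$ is a vector bundle map of degree $\ell$; $g:\mathcal E\to\mathcal E^*$ is a fiber-wise metric of degree $\ell$, that is, a vector bundle isomorphism of degree $\ell$ such that $\langle\psi,\psi'\rangle:=(-1)^{(|\psi|+\ell)\ell}[g(\psi)](\psi')$ satisfies $\langle\psi,\psi'\rangle=(-1)^{(|\psi|+\ell)(|\psi'|+\ell)}\langle\psi',\psi\rangle$; and $[\cdot,\cdot]$ is an $\mathbb R$-bilinear bracket of degree $\ell$ on global sections; such that for all global sections, with $\hat\rho(\psi)=(-1)^{(|\psi|+\ell)\ell}\rho(\psi)$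 and $\mathrm D=g^{-1}\circ\rho^T\circ\mathrm d$, where $[\rho^T(\alpha)](\psi)=(-1)^{|\alpha|\ell}\alpha(\rho(\psi))$, 1. $\hat\rho(\psi)\langle\psi',\psi''\rangle=\langle[\psi,\psi'],\psi''\rangle+(-1)^{(|\psi|+\ell)(|\psi'|+\ell)}\langle\psi',[\psi,\psi'']\rangle$; 2. $[\psi,\psi']+(-1)^{(|\psi|+\ell)(|\psi'|+\ell)}[\psi',\psi]=(-1)^{|\psi|+|\psi'|}\mathrm D\langle\psi,\psi'\rangle$; 3. $[\psi,[\psi',\psi'']]=[[\psi,\psi'],\psi'']+(-1)^{(|\psi|+\ell)(|\psi'|+\ell)}[\psi',[\psi,\psi'']]$. **Statement.** Let $\mathcal M$ be a graded manifold, $\ell\in\mathbb Z$, and $\mathcal E=T[\ell]\mathcal M\oplus T^*\mathcal M$, so that a section of degree $k$ is a pair $(X,\xi)$ with $|X|=k+\ell$ and $|\xi|=k$. Let $\rho(X,\xi)=X$ and $$[g(X,\xi)](Y,\eta)=(-1)^{(|\xi|+\ell)\ell}\xi(Y)+(-1)^{|X||\eta|}\eta(X),\qquad\text{so that}\qquad\langle(X,\xi),(Y,\eta)\rangle=\xi(Y)+(-1)^{|X||Y|}\eta(X).$$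 For a $3$-form $H$ on $\mathcal M$ with $|H|=-\ell$ put $$[(X,\xi),(Y,\eta)]_D^H=\big([X,Y],\ (-1)^{|X|\ell}\mathcal L_X\eta-(-1)^{|Y|(|X|+\ell)}i_Y\mathrm d\xi+(-1)^{\ell}H(X,Y,\cdot)\big).$$ Then $(\mathcal E,\rho,g,[\cdot,\cdot]_D^H)$ is a graded Courant algebroid of degree $\ell$ if and only if $\mathrm dH=0$. In addition, let $H$ be any $3$-form with $|H|=-\ell$, let $\omega$ be a $2$-form with $|\omega|=-\ell$, and put $e^\omega(X,\xi)=(X,\xi+\omega(X,\cdot))$. Then $H+\mathrm d\omega$ is again a $3$-form of degree $-\ell$, $e^\omega$ is a vector bundle automorphism of $\mathcal E$ of degree zero with inverse $e^{-\omega}$, and for all sections $$e^\omega\big([(X,\xi),(Y,\eta)]_D^{H+\mathrm d\omega}\big)=\big[e^\omega(X,\xi),e^\omega(Y,\eta)\big]_D^{H},$$ $\rho\circ e^\omega=\rho$, and $\langle e^\omega(X,\xi),e^\omega(Y,\eta)\rangle=\langle(X,\xi),(Y,\eta)\rangle$. -/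

import Mathlib

open TopologicalSpace
open scoped Manifold

universe u v

namespace GradedGeometry

/-! ### Graded vector spaces

A graded vector space is a sequence `(V_j)` of real vector spaces, given here as a sequence of
subspaces of one ambient space.  Only homogeneous elements occur, and these remember their degree;
a graded linear map is a function on homogeneous elements that is linear in every degree. -/

/-- A homogeneous element of a graded vector space, together with its degree. -/
structure Homog {V : Type*} [AddCommGroup V] [Module ℝ V] (gr : ℤ → Submodule ℝ V) where
  deg : ℤ
  val : V
  mem : val ∈ gr deg

/-- Linearity over `ℝ`, degree by degree. -/
def IsGradedLinear {V W : Type*} [AddCommGroup V] [Module ℝ V] [AddCommGroup W] [Module ℝ W]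
    {gr : ℤ → Submodule ℝ V} (F : Homog gr → W) : Prop :=
  (∀ (n : ℤ) (a b : V) (ha : a ∈ gr n) (hb : b ∈ gr n),
    F ⟨n, a + b, (gr n).add_mem ha hb⟩ = F ⟨n, a, ha⟩ + F ⟨n, b, hb⟩) ∧
  (∀ (n : ℤ) (c : ℝ) (a : V) (ha : a ∈ gr n),
    F ⟨n, c • a, (gr n).smul_mem c ha⟩ = c • F ⟨n, a, ha⟩)

/-! ### Graded domains -/

/-- A graded dimension: `n₀` coordinates of degree zero and `s` further coordinates `ξ_μ`
of the nonzero degrees `deg μ`. -/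
structure GDim where
  n₀ : ℕ
  s : ℕ
  deg : Fin s → ℤ
  deg_ne_zero : ∀ μ, deg μ ≠ 0

namespace GDim

abbrev Base (n : GDim) : Type := EuclideanSpace ℝ (Fin n.n₀)

/-- Smooth functions on an open subset of `ℝ^{n₀}`. -/
abbrev Smooth (n : GDim) (W : Opens n.Base) : Type :=
  ContMDiffMap 𝓘(ℝ, n.Base) 𝓘(ℝ, ℝ) W ℝ ((⊤ : ℕ∞) : WithTop ℕ∞)

/-- Formal power series `∑_p f_p ξ^p` in the `ξ_μ` with smooth coefficients. -/
abbrev Series (n : GDim) (W : Opens n.Base) : Type := (Fin n.s → ℕ) → n.Smooth W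

/-- The exponents `p` of the monomials that occur: odd variables occur at most once. -/
def Admissible (n : GDim) (p : Fin n.s → ℕ) : Prop := ∀ μ, Odd (n.deg μ) → p μ ≤ 1

/-- The degree of the monomial `ξ^p`. -/
def weight (n : GDim) (p : Fin n.s → ℕ) : ℤ := ∑ μ, (p μ : ℤ) * n.deg μ

/-- The functions of degree `k` on the graded domain. -/
def IsHomogeneous (n : GDim) {W : Opens n.Base} (k : ℤ) (f : n.Series W) : Prop :=
  ∀ p, f p ≠ 0 → n.Admissible p ∧ n.weight p = k

/-- The sign obtained on reordering `ξ^q ξ^r` into `ξ^(q+r)`. -/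
noncomputable def reorderSign (n : GDim) (q r : Fin n.s → ℕ) : ℝ :=
  (-1 : ℝ) ^ (∑ μ, ∑ ν, if μ < ν then (q ν : ℤ) * n.deg ν * ((r μ : ℤ) * n.deg μ) else 0)

noncomputable def one (n : GDim) (W : Opens n.Base) : n.Series W := fun p => if p = 0 then 1 else 0

open Classical in
/-- The product of formal power series with `ξ_μ ξ_ν = (-1)^(|ξ_μ||ξ_ν|) ξ_ν ξ_μ`. -/
noncomputable def mul (n : GDim) {W : Opens n.Base} (f g : n.Series W) : n.Series W := fun p =>
  if n.Admissible p then
    ∑ q ∈ Finset.Iic p, n.reorderSign q (p - q) • (f q * g (p - q))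
  else 0

end GDim

/-! ### Graded manifolds -/

/-- A sheaf of graded commutative associative unital real algebras.  The algebra over `U` is the
sequence `(gr U k)_k`, and `C U` is its direct sum; gluing is required degree by degree. -/
structure GradedAlgebraSheaf (X : Type u) [TopologicalSpace X] where
  C : Opens X → Type v
  [ring : ∀ U, Ring (C U)]
  [algebra : ∀ U, Algebra ℝ (C U)]
  gr : ∀ U, ℤ → Submodule ℝ (C U)
  [graded : ∀ U, GradedAlgebra (gr U)]
  comm : ∀ U (i j : ℤ) (f g : C U), f ∈ gr U i → g ∈ gr U j →
    f * g = (-1 : ℝ) ^ (i * j) • (g * f)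
  res : ∀ {U V : Opens X}, V ≤ U → (C U →ₐ[ℝ] C V)
  res_mem : ∀ {U V : Opens X} (h : V ≤ U) (k : ℤ) (f : C U), f ∈ gr U k → res h f ∈ gr V k
  res_self : ∀ (U : Opens X) (f : C U), res (le_refl U) f = f
  res_res : ∀ {U V W : Opens X} (h : V ≤ U) (h' : W ≤ V) (f : C U),
    res h' (res h f) = res (h'.trans h) f
  glue : ∀ {ι : Type u} (U : ι → Opens X) (k : ℤ) (f : ∀ i, C (U i)), (∀ i, f i ∈ gr (U i) k) →
    (∀ i j, res (inf_le_left : U i ⊓ U j ≤ U i) (f i) =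
      res (inf_le_right : U i ⊓ U j ≤ U j) (f j)) →
    ∃! F : C (⨆ i, U i), F ∈ gr (⨆ i, U i) k ∧ ∀ i, res (le_iSup U i) F = f i

attribute [instance] GradedAlgebraSheaf.ring GradedAlgebraSheaf.algebra GradedAlgebraSheaf.graded

variable {X : Type u} [TopologicalSpace X]

/-- The open set of `X` that corresponds to `W` under a homeomorphism between open subsets. -/
def chartPreimage {n : GDim} (e : OpenPartialHomeomorph X n.Base) (W : Opens n.Base) : Opens X :=
  ⟨e.source ∩ e ⁻¹' W, e.isOpen_inter_preimage W.isOpen⟩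

lemma chartPreimage_mono {n : GDim} (e : OpenPartialHomeomorph X n.Base) {W W' : Opens n.Base}
    (h : W' ≤ W) : chartPreimage e W' ≤ chartPreimage e W :=
  fun _ hx => ⟨hx.1, h hx.2⟩

/-- A graded chart: a homeomorphism from an open subset of `X` onto an open subset of `ℝ^{n₀}`
together with an isomorphism of the sheaves of graded algebras with the graded domain. -/
structure GradedChart (O : GradedAlgebraSheaf.{u, v} X) (n : GDim) where
  homeo : OpenPartialHomeomorph X n.Base
  coord : ∀ W : Opens n.Base, (W : Set n.Base) ⊆ homeo.target →
    (O.C (chartPreimage homeo W) →ₗ[ℝ] n.Series W)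
  bijOn : ∀ W hW (k : ℤ), Set.BijOn (coord W hW) (O.gr (chartPreimage homeo W) k)
    {f | n.IsHomogeneous k f}
  map_one : ∀ W hW, coord W hW 1 = n.one W
  map_mul : ∀ W hW f g, coord W hW (f * g) = n.mul (coord W hW f) (coord W hW g)
  map_res : ∀ (W : Opens n.Base) (hW : (W : Set n.Base) ⊆ homeo.target) (W' : Opens n.Base)
    (hW' : (W' : Set n.Base) ⊆ homeo.target) (h : W' ≤ W) (f : O.C (chartPreimage homeo W))
    (p : Fin n.s → ℕ) (x : W'),
    coord W' hW' (O.res (chartPreimage_mono homeo h) f) p x = coord W hW f p ⟨x, h x.2⟩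

/-- A graded manifold of graded dimension `dim` over `X`.  (That the stalks are local graded rings
follows from the existence of the charts.) -/
structure GradedManifold (X : Type u) [TopologicalSpace X] [T2Space X]
    [SecondCountableTopology X] extends GradedAlgebraSheaf.{u, v} X where
  dim : GDim
  exists_chart : ∀ x : X, ∃ c : GradedChart toGradedAlgebraSheaf dim, x ∈ c.homeo.source

variable [T2Space X] [SecondCountableTopology X]

/-! ### Graded vector bundles -/

/-- The data of a sheaf of graded modules over the functions on `M`: sections over open sets,
their degrees, the action `f ▷ ψ` and the restriction maps. -/
structure PreBundle (M : GradedManifold.{u, v} X) where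
  Sec : Opens X → Type v
  [addCommGroup : ∀ U, AddCommGroup (Sec U)]
  [module : ∀ U, Module ℝ (Sec U)]
  gr : ∀ U, ℤ → Submodule ℝ (Sec U)
  act : ∀ U, Homog (M.gr U) → (Sec U →ₗ[ℝ] Sec U)
  act_mem : ∀ U (f : Homog (M.gr U)) (k : ℤ) (ψ : Sec U), ψ ∈ gr U k →
    act U f ψ ∈ gr U (f.deg + k)
  res : ∀ {U V : Opens X}, V ≤ U → ∀ {k : ℤ}, gr U k → gr V k

attribute [instance] PreBundle.addCommGroup PreBundle.module

/-- The restriction of a homogeneous function. -/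
def resFun (M : GradedManifold.{u, v} X) {U V : Opens X} (h : V ≤ U) (f : Homog (M.gr U)) :
    Homog (M.gr V) :=
  ⟨f.deg, M.res h f.val, M.res_mem h _ _ f.mem⟩

namespace PreBundle

variable {M : GradedManifold.{u, v} X}

/-- The homogeneous section `f ▷ ψ`. -/
def smul (E : PreBundle M) {U : Opens X} (f : Homog (M.gr U)) (ψ : Homog (E.gr U)) :
    Homog (E.gr U) :=
  ⟨f.deg + ψ.deg, E.act U f ψ.val, E.act_mem U f ψ.deg ψ.val ψ.mem⟩

/-- The restriction of a homogeneous section. -/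
def resSec (E : PreBundle M) {U V : Opens X} (h : V ≤ U) (ψ : Homog (E.gr U)) :
    Homog (E.gr V) :=
  ⟨ψ.deg, E.res h ⟨ψ.val, ψ.mem⟩, (E.res h ⟨ψ.val, ψ.mem⟩).2⟩

/-- Graded vector bundles: sheaves of graded modules over the functions on `M` that are locally
freely and finitely generated, of a constant graded rank. -/
structure IsGradedVectorBundle (E : PreBundle M) : Prop where
  act_linear : ∀ U, IsGradedLinear (E.act U)
  one_act : ∀ U k (h : (1 : M.C U) ∈ M.gr U 0), ∀ ψ ∈ E.gr U k, E.act U ⟨0, 1, h⟩ ψ = ψ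
  mul_act : ∀ U (f g : Homog (M.gr U)) (h : f.val * g.val ∈ M.gr U (f.deg + g.deg)) k,
    ∀ ψ ∈ E.gr U k, E.act U ⟨f.deg + g.deg, f.val * g.val, h⟩ ψ = E.act U f (E.act U g ψ)
  res_add : ∀ {U V : Opens X} (h : V ≤ U) (k : ℤ) (ψ φ : E.gr U k),
    E.res h (ψ + φ) = E.res h ψ + E.res h φ
  res_smul : ∀ {U V : Opens X} (h : V ≤ U) (k : ℤ) (c : ℝ) (ψ : E.gr U k),
    E.res h (c • ψ) = c • E.res h ψ
  res_act : ∀ {U V : Opens X} (h : V ≤ U) (f : Homog (M.gr U)) (ψ : Homog (E.gr U)),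
    E.resSec h (E.smul f ψ) = E.smul (resFun M h f) (E.resSec h ψ)
  res_self : ∀ (U : Opens X) (k : ℤ) (ψ : E.gr U k), E.res (le_refl U) ψ = ψ
  res_res : ∀ {U V W : Opens X} (h : V ≤ U) (h' : W ≤ V) (k : ℤ) (ψ : E.gr U k),
    E.res h' (E.res h ψ) = E.res (h'.trans h) ψ
  glue : ∀ {ι : Type u} (U : ι → Opens X) (k : ℤ) (ψ : ∀ i, E.gr (U i) k),
    (∀ i j, E.res (inf_le_left : U i ⊓ U j ≤ U i) (ψ i) =
      E.res (inf_le_right : U i ⊓ U j ≤ U j) (ψ j)) →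
    ∃! Ψ : E.gr (⨆ i, U i) k, ∀ i, E.res (le_iSup U i) Ψ = ψ i
  locally_free : ∃ (r : ℕ) (δ : Fin r → ℤ), ∀ x : X, ∃ U : Opens X, x ∈ U ∧
    ∃ Φ : ∀ a, E.gr U (δ a), ∀ (V : Opens X) (hV : V ≤ U) (k : ℤ) (ψ : E.gr V k),
      ∃! f : ∀ a, M.gr V (k - δ a),
        (ψ : E.Sec V) = ∑ a, E.act V ⟨k - δ a, f a, (f a).2⟩ (E.res hV (Φ a))

/-- Vector bundle maps of degree `d`, as maps of global sections that are linear over the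
functions. -/
structure IsBundleMap (E E' : PreBundle M) (d : ℤ) (F : Homog (E.gr ⊤) → E'.Sec ⊤) : Prop where
  linear : IsGradedLinear F
  mem : ∀ ψ, F ψ ∈ E'.gr ⊤ (ψ.deg + d)
  map_act : ∀ (f : Homog (M.gr ⊤)) (ψ : Homog (E.gr ⊤)),
    F (E.smul f ψ) = (-1 : ℝ) ^ (f.deg * d) • E'.act ⊤ f (F ψ)

/-- The degree shift `E[ℓ]`, with sections `Γ(U)[ℓ]_j = Γ(U)_(j+ℓ)` and the action
`f ▷' ψ = (-1)^(|f|ℓ) f ▷ ψ`. -/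
noncomputable abbrev shift (ℓ : ℤ) (E : PreBundle M) : PreBundle M where
  Sec := E.Sec
  gr U j := E.gr U (j + ℓ)
  act U f := (-1 : ℝ) ^ (f.deg * ℓ) • E.act U f
  act_mem U f k ψ hψ := by
    have h := E.act_mem U f (k + ℓ) ψ hψ
    rw [← add_assoc] at h
    exact Submodule.smul_mem _ _ h
  res {_ _} h {_} ψ := E.res h ψ

/-- The direct sum `E ⊕ F`. -/
abbrev dsum (E F : PreBundle M) : PreBundle M where
  Sec U := E.Sec U × F.Sec U
  gr U j := (E.gr U j).prod (F.gr U j)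
  act U f := LinearMap.prodMap (E.act U f) (F.act U f)
  act_mem U f k _ hψ := ⟨E.act_mem U f k _ hψ.1, F.act_mem U f k _ hψ.2⟩
  res {_ _} h {_} ψ := ⟨(E.res h ⟨ψ.1.1, ψ.2.1⟩, F.res h ⟨ψ.1.2, ψ.2.2⟩),
    (E.res h ⟨ψ.1.1, ψ.2.1⟩).2, (F.res h ⟨ψ.1.2, ψ.2.2⟩).2⟩

/-- The maps `Γ_E(U) → C(U)` of degree `k` that are linear over the functions, i.e.
`α (f ▷ ψ) = (-1)^(|α||f|) f α(ψ)`. -/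
def dualGr (E : PreBundle M) (U : Opens X) (k : ℤ) : Submodule ℝ (Homog (E.gr U) → M.C U) where
  carrier := {α | IsGradedLinear α ∧ (∀ ψ, α ψ ∈ M.gr U (ψ.deg + k)) ∧
    ∀ (f : Homog (M.gr U)) (ψ : Homog (E.gr U)),
      α (E.smul f ψ) = (-1 : ℝ) ^ (k * f.deg) • (f.val * α ψ)}
  zero_mem' := by
    refine ⟨⟨?_, ?_⟩, ?_, ?_⟩ <;> intros <;> simp
  add_mem' := by
    rintro α β ⟨⟨a1, a2⟩, a3, a4⟩ ⟨⟨b1, b2⟩, b3, b4⟩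
    refine ⟨⟨?_, ?_⟩, ?_, ?_⟩
    · intro n a b ha hb
      simp only [Pi.add_apply, a1 n a b ha hb, b1 n a b ha hb]
      abel
    · intro n c a ha
      simp only [Pi.add_apply, a2 n c a ha, b2 n c a ha, smul_add]
    · intro ψ
      exact Submodule.add_mem _ (a3 ψ) (b3 ψ)
    · intro f ψ
      simp only [Pi.add_apply, a4 f ψ, b4 f ψ, mul_add, smul_add]
  smul_mem' := by
    rintro r α ⟨⟨a1, a2⟩, a3, a4⟩
    refine ⟨⟨?_, ?_⟩, ?_, ?_⟩
    · intro n a b ha hb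
      simp only [Pi.smul_apply, a1 n a b ha hb, smul_add]
    · intro n c a ha
      simp only [Pi.smul_apply, a2 n c a ha, smul_comm r c]
    · intro ψ
      exact Submodule.smul_mem _ _ (a3 ψ)
    · intro f ψ
      simp only [Pi.smul_apply, a4 f ψ, mul_smul_comm, smul_comm r]

/-- The dual bundle `E^*`.  The restriction of `α` to `V` is the unique form `β` on `V` with
`β(ψ|_V) = α(ψ)|_V`. -/
noncomputable abbrev dual (E : PreBundle M) : PreBundle M where
  Sec U := Homog (E.gr U) → M.C U
  gr U k := E.dualGr U k
  act U f :=
    { toFun := fun α ψ => f.val * α ψ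
      map_add' := fun α β => by funext ψ; simp [mul_add]
      map_smul' := fun c α => by funext ψ; simp }
  act_mem U f k α hα := by
    obtain ⟨⟨a1, a2⟩, a3, a4⟩ := hα
    refine ⟨⟨?_, ?_⟩, ?_, ?_⟩
    · intro n a b ha hb
      simp only [LinearMap.coe_mk, AddHom.coe_mk, a1 n a b ha hb, mul_add]
    · intro n c a ha
      simp only [LinearMap.coe_mk, AddHom.coe_mk, a2 n c a ha, mul_smul_comm]
    · intro ψ
      have h := SetLike.mul_mem_graded f.mem (a3 ψ)
      rwa [show f.deg + (ψ.deg + k) = ψ.deg + (f.deg + k) by ring] at h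
    · intro g ψ
      simp only [LinearMap.coe_mk, AddHom.coe_mk, a4 g ψ, mul_smul_comm]
      rw [← mul_assoc, M.comm U _ _ _ _ f.mem g.mem, smul_mul_assoc, smul_smul, mul_assoc,
        ← zpow_add₀ (by norm_num : (-1 : ℝ) ≠ 0)]
      congr 2
      ring
  res {U V} h {k} α := Classical.epsilon fun β : E.dualGr V k =>
    ∀ ψ : Homog (E.gr U), β.1 (E.resSec h ψ) = M.res h (α.1 ψ)

end PreBundle

/-! ### The tangent bundle and the graded commutator -/

variable (M : GradedManifold.{u, v} X)

/-- Graded derivations of degree `k` of the algebra of functions on `U`. -/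
def gDer (U : Opens X) (k : ℤ) : Submodule ℝ (M.C U →ₗ[ℝ] M.C U) where
  carrier := {Y | (∀ j, ∀ f ∈ M.gr U j, Y f ∈ M.gr U (j + k)) ∧
    ∀ j, ∀ f ∈ M.gr U j, ∀ g, Y (f * g) = Y f * g + (-1 : ℝ) ^ (k * j) • (f * Y g)}
  zero_mem' := by
    constructor <;> intros <;> simp
  add_mem' := by
    rintro Y Z ⟨a1, a2⟩ ⟨b1, b2⟩
    refine ⟨fun j f hf => Submodule.add_mem _ (a1 j f hf) (b1 j f hf), fun j f hf g => ?_⟩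
    simp only [LinearMap.add_apply, a2 j f hf g, b2 j f hf g, add_mul, mul_add, smul_add]
    abel
  smul_mem' := by
    rintro c Y ⟨a1, a2⟩
    refine ⟨fun j f hf => Submodule.smul_mem _ _ (a1 j f hf), fun j f hf g => ?_⟩
    simp only [LinearMap.smul_apply, a2 j f hf g, smul_add, smul_mul_assoc, mul_smul_comm,
      smul_comm c]

/-- The tangent bundle: the sections over `U` are the graded derivations of the functions on `U`,
with `(f ▷ Y)(g) = f Y(g)`.  The restriction of `Y` to `V` is the unique derivation `Z` with
`Z(f|_V) = Y(f)|_V`. -/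
noncomputable abbrev tangent : PreBundle M where
  Sec U := M.C U →ₗ[ℝ] M.C U
  gr U k := gDer M U k
  act U f :=
    { toFun := fun Y => LinearMap.mulLeft ℝ f.val ∘ₗ Y
      map_add' := fun Y Z => by ext g; simp [mul_add]
      map_smul' := fun c Y => by ext g; simp }
  act_mem U f k Y hY := by
    obtain ⟨a1, a2⟩ := hY
    refine ⟨fun j g hg => ?_, fun j g hg g' => ?_⟩
    · have h := SetLike.mul_mem_graded f.mem (a1 j g hg)
      rwa [show f.deg + (j + k) = j + (f.deg + k) by ring] at h
    · simp only [LinearMap.coe_mk, AddHom.coe_mk, LinearMap.comp_apply,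
        LinearMap.mulLeft_apply, a2 j g hg g', mul_add, mul_smul_comm]
      rw [← mul_assoc, ← mul_assoc, M.comm U _ _ _ _ f.mem hg, smul_mul_assoc, smul_smul,
        mul_assoc g, ← zpow_add₀ (by norm_num : (-1 : ℝ) ≠ 0)]
      congr 3
      ring
  res {U V} h {k} Y := Classical.epsilon fun Z : gDer M V k =>
    ∀ f : M.C U, Z.1 (M.res h f) = M.res h (Y.1 f)

/-- Global vector fields, each with its degree. -/
abbrev VField : Type v := Homog (gDer M ⊤)

variable {M}

/-- The graded commutator `[Y, Z] = Y Z - (-1)^(|Y||Z|) Z Y`. -/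
noncomputable def lie (Y Z : VField M) : VField M where
  deg := Y.deg + Z.deg
  val := (Y.val ∘ₗ Z.val - (-1 : ℝ) ^ (Y.deg * Z.deg) • (Z.val ∘ₗ Y.val) : M.C ⊤ →ₗ[ℝ] M.C ⊤)
  mem := by
    obtain ⟨k, Y, a1, a2⟩ := Y
    obtain ⟨l, Z, b1, b2⟩ := Z
    refine ⟨fun j f hf => ?_, fun j f hf g => ?_⟩
    · have h1 := a1 _ _ (b1 j f hf)
      have h2 := b1 _ _ (a1 j f hf)
      rw [show j + l + k = j + (k + l) by ring] at h1
      rw [show j + k + l = j + (k + l) by ring] at h2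
      exact Submodule.sub_mem _ h1 (Submodule.smul_mem _ _ h2)
    · have hn : (-1 : ℝ) ≠ 0 := by norm_num
      have e1 := a2 _ _ (b1 j f hf) g
      have e2 := b2 _ _ (a1 j f hf) g
      simp only [LinearMap.sub_apply, LinearMap.smul_apply, LinearMap.comp_apply, a2 j f hf,
        b2 j f hf, map_add, map_smul, e1, e2, smul_add, smul_smul, sub_mul, mul_sub, smul_sub,
        smul_mul_assoc, mul_smul_comm]
      simp only [← zpow_add₀ hn]
      have s1 : ((-1 : ℝ) ^ (k * l + l * (j + k))) = (-1) ^ (l * j) := by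
        rw [show k * l + l * (j + k) = l * j + 2 * (k * l) by ring, zpow_add₀ hn,
          Even.neg_one_zpow (even_two_mul (k * l)), mul_one]
      have s2 : ((-1 : ℝ) ^ (k * (j + l))) = (-1) ^ (k * l + k * j) := by
        congr 1; ring
      have s3 : ((-1 : ℝ) ^ (l * j + k * j)) = (-1) ^ ((k + l) * j) := by
        congr 1; ring
      have s4 : ((-1 : ℝ) ^ (k * l + (k * j + l * j))) = (-1) ^ ((k + l) * j + k * l) := by
        congr 1; ring
      rw [s1, s2, s3, s4]
      abel

/-! ### Differential forms -/

/-- Skew-symmetric `p`-forms of degree `k` on a graded vector bundle. -/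
structure IsForm (E : PreBundle M) (p : ℕ) (k : ℤ) (ω : (Fin p → Homog (E.gr ⊤)) → M.C ⊤) :
    Prop where
  mem : ∀ x, ω x ∈ M.gr ⊤ (k + ∑ i, (x i).deg)
  linear : ∀ (x : Fin p → Homog (E.gr ⊤)) (i : Fin p),
    IsGradedLinear fun y => ω (Function.update x i y)
  smul_first : ∀ (f : Homog (M.gr ⊤)) (x : Fin p → Homog (E.gr ⊤)) (i : Fin p), (i : ℕ) = 0 →
    ω (Function.update x i (E.smul f (x i))) = (-1 : ℝ) ^ (f.deg * k) • (f.val * ω x)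
  skew : ∀ (x : Fin p → Homog (E.gr ⊤)) (i j : Fin p), (j : ℕ) = i + 1 →
    ω x = -((-1 : ℝ) ^ ((x i).deg * (x j).deg) • ω (x ∘ Equiv.swap i j))

variable (M) in
/-- The functions of `p` vector fields among which the `p`-forms on `M` live. -/
abbrev FormFun (p : ℕ) : Type v := (Fin p → VField M) → M.C ⊤

/-- The terms of `(dω)(x_0, …, x_p)` with a vector field acting on a value of `ω`;
`k` is the degree of `ω`. -/
noncomputable def dActionTerm (k : ℤ) {p : ℕ} (ω : FormFun M p) : FormFun M (p + 1) :=
  fun x => ∑ r : Fin (p + 1),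
    (-1 : ℝ) ^ ((r : ℤ) + ((x r).deg - 1) * k + (x r).deg * ∑ s ∈ Finset.Iio r, (x s).deg) •
      (x r).val (ω (r.removeNth x))

/-- The terms of `(dω)(x_0, …, x_p)` with a commutator `[x_i, x_j]`, `i < j`, in the first place,
followed by the remaining `x_s` in order.  The sign includes the one that arises
from moving `x_i x_j` to the front of `x_0 ⋯ x_p`. -/
noncomputable def dBracketTerm (k : ℤ) : {p : ℕ} → FormFun M p → FormFun M (p + 1)
  | 0, _ => 0
  | q + 1, ω => fun x => ∑ j : Fin (q + 2), ∑ i : Fin (q + 1),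
      if i.castSucc < j then
        (-1 : ℝ) ^ (k + (i : ℤ) + (j : ℤ)
            + (x i.castSucc).deg * (∑ s ∈ Finset.Iio i.castSucc, (x s).deg)
            + (x j).deg * (∑ s ∈ (Finset.Iio j).erase i.castSucc, (x s).deg)) •
          ω (Fin.cons (lie (x i.castSucc) (x j)) (i.removeNth (j.removeNth x)))
      else 0

/-- The exterior derivative of a `p`-form of degree `k`. -/
noncomputable def dForm (k : ℤ) {p : ℕ} (ω : FormFun M p) : FormFun M (p + 1) :=
  dActionTerm k ω + dBracketTerm k ω

/-- The interior product `i_Y ω` of a form of degree `k`. -/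
noncomputable def contract (k : ℤ) {p : ℕ} (Y : VField M) (ω : FormFun M (p + 1)) : FormFun M p :=
  fun x => (-1 : ℝ) ^ (k * (Y.deg - 1)) • ω (Fin.cons Y x)

/-- The Lie derivative `i_Y d + (-1)^|Y| d i_Y` of a form of degree `k` and positive arity. -/
noncomputable def lieDeriv (k : ℤ) {p : ℕ} (Y : VField M) (ω : FormFun M (p + 1)) :
    FormFun M (p + 1) :=
  contract k Y (dForm k ω) + (-1 : ℝ) ^ Y.deg • dForm (k + Y.deg) (contract k Y ω)

/-- A section of the cotangent bundle, viewed as a form in one argument. -/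
def toForm (ξ : VField M → M.C ⊤) : FormFun M 1 := fun x => ξ (x 0)

/-- A form in one argument, viewed as a section of the cotangent bundle. -/
def ofForm (ω : FormFun M 1) : VField M → M.C ⊤ := fun Y => ω ![Y]

/-- The differential `df` of a function of degree `k`. -/
noncomputable def dFun (k : ℤ) (f : M.C ⊤) : VField M → M.C ⊤ :=
  ofForm (dForm k (p := 0) fun _ => f)

/-! ### Graded Courant algebroids -/

/-- The bilinear form `⟨ψ, φ⟩ = (-1)^((|ψ|+ℓ)ℓ) [g(ψ)](φ)` of a bundle map `g : E → E^*` of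
degree `ℓ`. -/
noncomputable def pairing {E : PreBundle M} (ℓ : ℤ) (g : Homog (E.gr ⊤) → E.dual.Sec ⊤)
    (ψ φ : Homog (E.gr ⊤)) : M.C ⊤ :=
  (-1 : ℝ) ^ ((ψ.deg + ℓ) * ℓ) • g ψ φ

/-- Fiber-wise metrics of degree `ℓ`: vector bundle isomorphisms `E → E^*` of degree `ℓ` with
graded symmetric bilinear form. -/
structure IsFiberwiseMetric (E : PreBundle M) (ℓ : ℤ) (g : Homog (E.gr ⊤) → E.dual.Sec ⊤) :
    Prop where
  isBundleMap : E.IsBundleMap E.dual ℓ g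
  symm : ∀ ψ φ : Homog (E.gr ⊤),
    pairing ℓ g ψ φ = (-1 : ℝ) ^ ((ψ.deg + ℓ) * (φ.deg + ℓ)) • pairing ℓ g φ ψ
  bijective : ∀ (k : ℤ) (α : E.dual.gr ⊤ (k + ℓ)),
    ∃! ψ : E.gr ⊤ k, g ⟨k, ψ, ψ.2⟩ = α

/-- Graded Courant algebroids `(E, ρ, g, [·,·])` of degree `ℓ` over `M`. -/
structure IsGradedCourantAlgebroid (E : PreBundle M) (ℓ : ℤ)
    (ρ : Homog (E.gr ⊤) → (tangent M).Sec ⊤) (g : Homog (E.gr ⊤) → E.dual.Sec ⊤)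
    (br : Homog (E.gr ⊤) → Homog (E.gr ⊤) → E.Sec ⊤) : Prop where
  isGradedVectorBundle : E.IsGradedVectorBundle
  anchor : E.IsBundleMap (tangent M) ℓ ρ
  metric : IsFiberwiseMetric E ℓ g
  bracket_linear_left : ∀ φ, IsGradedLinear fun ψ => br ψ φ
  bracket_linear_right : ∀ ψ, IsGradedLinear fun φ => br ψ φ
  bracket_mem : ∀ ψ φ, br ψ φ ∈ E.gr ⊤ (ψ.deg + φ.deg + ℓ)
  /-- `ρ̂(ψ)⟨φ, χ⟩ = ⟨[ψ, φ], χ⟩ + (-1)^((|ψ|+ℓ)(|φ|+ℓ)) ⟨φ, [ψ, χ]⟩` -/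
  compatible : ∀ ψ φ χ : Homog (E.gr ⊤),
    (-1 : ℝ) ^ ((ψ.deg + ℓ) * ℓ) • ρ ψ (pairing ℓ g φ χ) =
      pairing ℓ g ⟨_, br ψ φ, bracket_mem ψ φ⟩ χ +
        (-1 : ℝ) ^ ((ψ.deg + ℓ) * (φ.deg + ℓ)) • pairing ℓ g φ ⟨_, br ψ χ, bracket_mem ψ χ⟩
  /-- `[ψ, φ] + (-1)^((|ψ|+ℓ)(|φ|+ℓ)) [φ, ψ] = (-1)^(|ψ|+|φ|) D⟨ψ, φ⟩`.  Here `D f` is the section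
  `χ` of degree `|f|` such that `g(χ)` is the transpose
  `(ρᵀ(df))(θ) = (-1)^(|f|ℓ) df(ρ(θ))`. -/
  skew : ∀ ψ φ : Homog (E.gr ⊤), ∃ χ : Homog (E.gr ⊤),
    χ.deg = ψ.deg + φ.deg + ℓ ∧
    (∀ θ : Homog (E.gr ⊤), g χ θ = (-1 : ℝ) ^ ((ψ.deg + φ.deg + ℓ) * ℓ) •
      dFun (ψ.deg + φ.deg + ℓ) (pairing ℓ g ψ φ) ⟨_, ρ θ, anchor.mem θ⟩) ∧
    br ψ φ + (-1 : ℝ) ^ ((ψ.deg + ℓ) * (φ.deg + ℓ)) • br φ ψ =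
      (-1 : ℝ) ^ (ψ.deg + φ.deg) • χ.val
  /-- `[ψ, [φ, χ]] = [[ψ, φ], χ] + (-1)^((|ψ|+ℓ)(|φ|+ℓ)) [φ, [ψ, χ]]` -/
  jacobi : ∀ ψ φ χ : Homog (E.gr ⊤),
    br ψ ⟨_, br φ χ, bracket_mem φ χ⟩ = br ⟨_, br ψ φ, bracket_mem ψ φ⟩ χ +
      (-1 : ℝ) ^ ((ψ.deg + ℓ) * (φ.deg + ℓ)) • br φ ⟨_, br ψ χ, bracket_mem ψ χ⟩

/-! ### The bundle `T[ℓ]M ⊕ T^*M` and the Dorfman bracket -/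

variable (M) in
/-- The graded vector bundle `T[ℓ]M ⊕ T^*M`. -/
noncomputable abbrev genTangent (ℓ : ℤ) : PreBundle M :=
  ((tangent M).shift ℓ).dsum (tangent M).dual

variable {ℓ : ℤ}

/-- The vector field `Y` in a section `(Y, ξ)`; its degree is `|(Y, ξ)| + ℓ`. -/
noncomputable def vec (ψ : Homog ((genTangent M ℓ).gr ⊤)) : VField M :=
  ⟨ψ.deg + ℓ, ψ.val.1, ψ.mem.1⟩

/-- The `1`-form `ξ` in a section `(Y, ξ)`; its degree is `|(Y, ξ)|`. -/
noncomputable def cov (ψ : Homog ((genTangent M ℓ).gr ⊤)) : VField M → M.C ⊤ := ψ.val.2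

variable (M ℓ) in
/-- The anchor `ρ(Y, ξ) = Y`. -/
noncomputable def genAnchor (ψ : Homog ((genTangent M ℓ).gr ⊤)) : (tangent M).Sec ⊤ := (vec ψ).val

variable (M ℓ) in
/-- The canonical metric `g(Y, ξ) = (ξ, Y)`, where `(ξ, Y)` acts on sections by
`(Z, η) ↦ (-1)^((|ξ|+ℓ)ℓ) ξ(Z) + (-1)^(|Y||η|) η(Y)`. -/
noncomputable def genMetric (ψ : Homog ((genTangent M ℓ).gr ⊤)) : (genTangent M ℓ).dual.Sec ⊤ :=
  fun φ => (-1 : ℝ) ^ ((ψ.deg + ℓ) * ℓ) • cov ψ (vec φ) +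
    (-1 : ℝ) ^ ((vec ψ).deg * φ.deg) • cov φ (vec ψ)

/-- The degree `ℓ` Dorfman bracket twisted by `H`,
`([Y, Z], (-1)^(|Y|ℓ) L_Y η - (-1)^(|Z|(|Y|+ℓ)) i_Z dξ + (-1)^ℓ H(Y, Z, ·))`
for `ψ = (Y, ξ)` and `φ = (Z, η)`. -/
noncomputable def dorfman (ℓ : ℤ) (H : FormFun M 3) (ψ φ : Homog ((genTangent M ℓ).gr ⊤)) :
    (genTangent M ℓ).Sec ⊤ :=
  ((lie (vec ψ) (vec φ)).val,
    (-1 : ℝ) ^ ((vec ψ).deg * ℓ) • ofForm (lieDeriv φ.deg (vec ψ) (toForm (cov φ)))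
      - (-1 : ℝ) ^ ((vec φ).deg * ((vec ψ).deg + ℓ)) •
          ofForm (contract ψ.deg (vec φ) (dForm ψ.deg (toForm (cov ψ))))
      + (-1 : ℝ) ^ ℓ • fun Z => H ![vec ψ, vec φ, Z])

/-- The map `e^ω(Y, ξ) = (Y, ξ + ω(Y, ·))`. -/
noncomputable def expForm (ℓ : ℤ) (ω : FormFun M 2) (ψ : Homog ((genTangent M ℓ).gr ⊤)) :
    (genTangent M ℓ).Sec ⊤ :=
  ((vec ψ).val, cov ψ + fun Z => ω ![vec ψ, Z])

/-- `F` is a vector bundle isomorphism `E → E` of degree zero with inverse `G`. -/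
structure IsBundleAutomorphism (E : PreBundle M) (F G : Homog (E.gr ⊤) → E.Sec ⊤) : Prop where
  isBundleMap : E.IsBundleMap E 0 F
  isBundleMap_inv : E.IsBundleMap E 0 G
  left_inv : ∀ ψ (h : F ψ ∈ E.gr ⊤ ψ.deg), G ⟨ψ.deg, F ψ, h⟩ = ψ.val
  right_inv : ∀ ψ (h : G ψ ∈ E.gr ⊤ ψ.deg), F ⟨ψ.deg, G ψ, h⟩ = ψ.val

/-- `F` is a degree zero map with `F([ψ, φ]) = [F(ψ), F(φ)]'`, for brackets `[·,·]` and `[·,·]'` of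
degree `ℓ`. -/
structure Intertwines (E : PreBundle M) (ℓ : ℤ) (F : Homog (E.gr ⊤) → E.Sec ⊤)
    (br br' : Homog (E.gr ⊤) → Homog (E.gr ⊤) → E.Sec ⊤) : Prop where
  mem : ∀ ψ, F ψ ∈ E.gr ⊤ ψ.deg
  bracket_mem : ∀ ψ φ, br ψ φ ∈ E.gr ⊤ (ψ.deg + φ.deg + ℓ)
  map_bracket : ∀ ψ φ, F ⟨_, br ψ φ, bracket_mem ψ φ⟩ =
    br' ⟨_, F ψ, mem ψ⟩ ⟨_, F φ, mem φ⟩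

end GradedGeometry

open GradedGeometry

set_option linter.unnecessarySeqFocus false
set_option linter.unusedSectionVars false

/-! ### Sign arithmetic modulo two. -/

namespace GradedGeometry

/-! The decisive computation is `dorfman_jacobiator`. Expand the bracket on an arbitrary vector
field into actions of vector fields on functions and values on commutators. In the compatibility and
symmetry axioms the contributions of H cancel because H is skew, so these axioms hold for every
3-form (`dorfman_compatible`, `dorfman_skew`). In the Jacobi axiom the vector parts agree by the
graded Jacobi identity for commutators, the terms in the three 1-forms cancel for the same reason,
and the terms in H are exactly the ten terms of dH(X, Y, Z, W). So the Jacobi axiom holds when dH =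
0. Conversely every vector field X is the vector part of the section (X, 0), so the Jacobi axiom
forces dH = 0 on all quadruples of vector fields.

The twist is a similar calculation. Adding ω(X, ·) to the form part changes the Dorfman bracket by
the terms of dω(X, Y, ·) other than the one with [X, Y] in front; that one is supplied by applying ω
to the vector part [X, Y] of the bracket (`expForm_intertwines`). The pairing is preserved since ω
is skew, and dω is a form because the derivatives of a coefficient function cancel
(`IsForm.dForm_two`).

All signs depend only on parities of degrees. Each identity is reduced to an identity between
coefficients that are functions of finitely many elements of `ZMod 2`, and these are decided by
enumeration.

Most of the remaining work shows that T[ℓ]M ⊕ T*M is a graded vector bundle and that g is an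
isomorphism. Bump functions, taken from charts and extended by zero (`exists_bump`), make
derivations and dual sections local operators and extend germs to larger open sets; hence
restrictions exist and are unique, and the tangent and dual presheaves are sheaves. The tangent
sheaf is locally free because the partial derivatives in a chart are dual to the coordinates, and a
derivation that annihilates the coordinates vanishes (`gDer_eq_zero_of_coordinates`): Hadamard's
lemma treats the smooth functions of the degree zero coordinates, and an induction on the order in
the remaining variables treats power series. Duals, shifts and direct sums of local frames are again
local frames.

For the metric, the form part of a preimage is read off on sections (Y, 0). The vector part needs
reflexivity of the tangent bundle: an element β of the double dual gives the derivation f ↦ (-1)^|f|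
β(df), and β is evaluation at this derivation because exact 1-forms locally generate all 1-forms
(`dual_dualGr_ext`). -/

/-- The sign of a parity. -/
def paritySign (z : ZMod 2) : ℤ := if z = 0 then 1 else -1

lemma neg_one_zpow_eq_paritySign (n : ℤ) : (-1 : ℝ) ^ n = ((paritySign (n : ZMod 2) : ℤ) : ℝ) := by
  unfold paritySign
  rcases Int.even_or_odd n with h | h
  · rw [h.neg_one_zpow, if_pos ((ZMod.intCast_zmod_eq_zero_iff_dvd n 2).2 h.two_dvd)]; simp
  · rw [h.neg_one_zpow, if_neg]
    · simp
    · intro h'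
      have := (ZMod.intCast_zmod_eq_zero_iff_dvd n 2).1 h'
      exact (Int.not_even_iff_odd.2 h) (even_iff_two_dvd.2 this)

/-- Entry point of the sign calculations: real powers of -1 become integer scalars that depend only
on a residue in `ZMod 2`, so that equality of coefficients is decidable. -/
lemma neg_one_zpow_smul {A : Type*} [AddCommGroup A] [Module ℝ A] (n : ℤ) (x : A) :
    (-1 : ℝ) ^ n • x = paritySign (n : ZMod 2) • x := by
  rw [neg_one_zpow_eq_paritySign, Int.cast_smul_eq_zsmul]

lemma neg_one_zpow_congr {m n : ℤ} (h : (m : ZMod 2) = n) : (-1 : ℝ) ^ m = (-1) ^ n := by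
  rw [neg_one_zpow_eq_paritySign, neg_one_zpow_eq_paritySign, h]

lemma Homog.ext' {V : Type*} [AddCommGroup V] [Module ℝ V] {gr : ℤ → Submodule ℝ V}
    {a b : Homog gr} (h : a.deg = b.deg) (h' : a.val = b.val) : a = b := by
  cases a; cases b; cases h; cases h'; rfl

variable {X : Type u} [TopologicalSpace X] [T2Space X] [SecondCountableTopology X]
  {M : GradedManifold.{u, v} X}

/-! ### Explicit formulas for forms of low arity -/

lemma fun_fin_three_eq {α : Type*} (x : Fin 3 → α) : x = ![x 0, x 1, x 2] := by
  funext i; fin_cases i <;> rfl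

lemma fun_fin_four_eq {α : Type*} (x : Fin 4 → α) : x = ![x 0, x 1, x 2, x 3] := by
  funext i; fin_cases i <;> rfl

lemma dForm_zero_apply (k : ℤ) (f : M.C ⊤) (Y : VField M) :
    dForm k (p := 0) (fun _ => f) ![Y] = (-1 : ℝ) ^ ((Y.deg - 1) * k) • Y.val f := by
  simp [dForm, dActionTerm, dBracketTerm]

section VectorLiterals

variable {α : Type*} (a b c d : α)

lemma removeNth_one_two : Fin.removeNth 1 ![a, b] = ![a] := by
  funext i; fin_cases i; rfl

lemma removeNth_one_three : Fin.removeNth 1 ![a, b, c] = ![a, c] := by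
  funext i; fin_cases i <;> rfl

lemma removeNth_two_three : Fin.removeNth 2 ![a, b, c] = ![a, b] := by
  funext i; fin_cases i <;> rfl

lemma removeNth_one_four : Fin.removeNth 1 ![a, b, c, d] = ![a, c, d] := by
  funext i; fin_cases i <;> rfl

lemma removeNth_two_four : Fin.removeNth 2 ![a, b, c, d] = ![a, b, d] := by
  funext i; fin_cases i <;> rfl

lemma removeNth_three_four : Fin.removeNth 3 ![a, b, c, d] = ![a, b, c] := by
  funext i; fin_cases i <;> rfl

lemma cons_eq_vecCons {n : ℕ} (v : Fin n → α) :
    (Fin.cons a v : Fin (n + 1) → α) = Matrix.vecCons a v := rfl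

end VectorLiterals

lemma Iio_two_three : Finset.Iio (2 : Fin 3) = {0, 1} := by decide
lemma Iio_two_four : Finset.Iio (2 : Fin 4) = {0, 1} := by decide
lemma Iio_three_four : Finset.Iio (3 : Fin 4) = {0, 1, 2} := by decide
lemma Iio_zero_succ (n : ℕ) : Finset.Iio (0 : Fin (n + 1)) = ∅ := by
  ext i; simp
lemma Iio_one_succ (n : ℕ) : Finset.Iio (1 : Fin (n + 2)) = {0} := by
  ext i; simp [Fin.lt_one_iff]

lemma dForm_one_apply (k : ℤ) (ω : FormFun M 1) (Y Z : VField M) :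
    dForm k ω ![Y, Z] = (-1 : ℝ) ^ ((Y.deg - 1) * k) • Y.val (ω ![Z])
      - (-1 : ℝ) ^ ((Z.deg - 1) * k + Z.deg * Y.deg) • Z.val (ω ![Y])
      - (-1 : ℝ) ^ k • ω ![lie Y Z] := by
  simp [dForm, dActionTerm, dBracketTerm, Fin.sum_univ_succ, removeNth_one_two,
    cons_eq_vecCons, Iio_zero_succ, Iio_one_succ]
  simp only [neg_one_zpow_smul]
  push_cast
  -- Only the residues of the degrees matter. Once they are variables, `match_scalars` leaves one
  -- equation per term, and `decide` runs through all parities.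
  generalize (k : ZMod 2) = k, (Y.deg : ZMod 2) = y, (Z.deg : ZMod 2) = z
  match_scalars <;> (revert k y z; decide)

lemma dForm_two_apply (k : ℤ) (ω : FormFun M 2) (Y Z W : VField M) :
    dForm k ω ![Y, Z, W] = (-1 : ℝ) ^ ((Y.deg - 1) * k) • Y.val (ω ![Z, W])
      - (-1 : ℝ) ^ ((Z.deg - 1) * k + Z.deg * Y.deg) • Z.val (ω ![Y, W])
      + (-1 : ℝ) ^ ((W.deg - 1) * k + W.deg * (Y.deg + Z.deg)) • W.val (ω ![Y, Z])
      - (-1 : ℝ) ^ k • ω ![lie Y Z, W]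
      + (-1 : ℝ) ^ (k + W.deg * Z.deg) • ω ![lie Y W, Z]
      - (-1 : ℝ) ^ (k + Z.deg * Y.deg + W.deg * Y.deg) • ω ![lie Z W, Y] := by
  simp [dForm, dActionTerm, dBracketTerm, Fin.sum_univ_succ, removeNth_one_two,
    removeNth_one_three, removeNth_two_three,
    cons_eq_vecCons, Iio_zero_succ, Iio_one_succ, Iio_two_three]
  simp only [neg_one_zpow_smul]
  push_cast
  generalize (k : ZMod 2) = k, (Y.deg : ZMod 2) = y, (Z.deg : ZMod 2) = z, (W.deg : ZMod 2) = w
  match_scalars <;> (revert k y z w; decide)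

lemma dForm_three_apply (k : ℤ) (ω : FormFun M 3) (Y Z W V : VField M) :
    dForm k ω ![Y, Z, W, V] = (-1 : ℝ) ^ ((Y.deg - 1) * k) • Y.val (ω ![Z, W, V])
      - (-1 : ℝ) ^ ((Z.deg - 1) * k + Z.deg * Y.deg) • Z.val (ω ![Y, W, V])
      + (-1 : ℝ) ^ ((W.deg - 1) * k + W.deg * (Y.deg + Z.deg)) • W.val (ω ![Y, Z, V])
      - (-1 : ℝ) ^ ((V.deg - 1) * k + V.deg * (Y.deg + Z.deg + W.deg)) • V.val (ω ![Y, Z, W])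
      - (-1 : ℝ) ^ k • ω ![lie Y Z, W, V]
      + (-1 : ℝ) ^ (k + W.deg * Z.deg) • ω ![lie Y W, Z, V]
      - (-1 : ℝ) ^ (k + V.deg * (Z.deg + W.deg)) • ω ![lie Y V, Z, W]
      - (-1 : ℝ) ^ (k + Z.deg * Y.deg + W.deg * Y.deg) • ω ![lie Z W, Y, V]
      + (-1 : ℝ) ^ (k + Z.deg * Y.deg + V.deg * (Y.deg + W.deg)) • ω ![lie Z V, Y, W]
      - (-1 : ℝ) ^ (k + W.deg * (Y.deg + Z.deg) + V.deg * (Y.deg + Z.deg)) •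
          ω ![lie W V, Y, Z] := by
  simp [dForm, dActionTerm, dBracketTerm, Fin.sum_univ_succ,
    removeNth_one_three, removeNth_two_three, removeNth_one_four, removeNth_two_four,
    removeNth_three_four,
    cons_eq_vecCons, Iio_zero_succ, Iio_one_succ, Iio_two_four, Iio_three_four]
  simp only [neg_one_zpow_smul]
  push_cast
  generalize (k : ZMod 2) = k, (Y.deg : ZMod 2) = y, (Z.deg : ZMod 2) = z, (W.deg : ZMod 2) = w,
    (V.deg : ZMod 2) = t
  match_scalars <;> (revert k y z w t; decide)

end GradedGeometry

namespace GradedGeometry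

/-! ### Graded linear maps applied to homogeneous elements. -/

section GradedLinear

variable {V W : Type*} [AddCommGroup V] [Module ℝ V] [AddCommGroup W] [Module ℝ W]
  {gr : ℤ → Submodule ℝ V} {F : Homog gr → W}

/-- Degrees such as those of iterated commutators are equal only up to a proof. Taking these
equalities as hypotheses makes linearity usable without casts between degrees. -/
lemma IsGradedLinear.map_add (hF : IsGradedLinear F) {z z₁ z₂ : Homog gr} (h₁ : z₁.deg = z.deg)
    (h₂ : z₂.deg = z.deg) (h : z.val = z₁.val + z₂.val) : F z = F z₁ + F z₂ := by
  obtain ⟨n, v, hv⟩ := z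
  obtain ⟨n₁, v₁, hv₁⟩ := z₁
  obtain ⟨n₂, v₂, hv₂⟩ := z₂
  dsimp only at h₁ h₂ h
  subst h₁ h₂ h
  exact hF.1 _ _ _ hv₁ hv₂

lemma IsGradedLinear.map_smul (hF : IsGradedLinear F) {z z₁ : Homog gr} (h₁ : z₁.deg = z.deg)
    (c : ℝ) (h : z.val = c • z₁.val) : F z = c • F z₁ := by
  obtain ⟨n, v, hv⟩ := z
  obtain ⟨n₁, v₁, hv₁⟩ := z₁
  dsimp only at h₁ h
  subst h₁ h
  exact hF.2 _ _ _ hv₁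

lemma IsGradedLinear.map_add_smul (hF : IsGradedLinear F) {z z₁ z₂ : Homog gr}
    (h₁ : z₁.deg = z.deg) (h₂ : z₂.deg = z.deg) (c : ℝ) (h : z.val = z₁.val + c • z₂.val) :
    F z = F z₁ + c • F z₂ := by
  rw [hF.map_add (z := z) (z₁ := z₁) (z₂ := ⟨z₂.deg, c • z₂.val, (gr _).smul_mem c z₂.mem⟩)
    h₁ h₂ h, hF.map_smul (z := ⟨z₂.deg, c • z₂.val, (gr _).smul_mem c z₂.mem⟩) (z₁ := z₂) rfl c rfl]

lemma IsGradedLinear.map_zero (hF : IsGradedLinear F) {z : Homog gr} (h : z.val = 0) :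
    F z = 0 := by
  rw [hF.map_smul (z := z) (z₁ := z) rfl 0 (by simp [h]), zero_smul]

lemma IsGradedLinear.map_sub (hF : IsGradedLinear F) {z z₁ z₂ : Homog gr} (h₁ : z₁.deg = z.deg)
    (h₂ : z₂.deg = z.deg) (h : z.val = z₁.val - z₂.val) : F z = F z₁ - F z₂ := by
  rw [hF.map_add_smul h₁ h₂ (-1) (by rw [h, sub_eq_add_neg, neg_one_smul]), neg_one_smul,
    sub_eq_add_neg]

end GradedLinear

variable {X : Type u} [TopologicalSpace X] [T2Space X] [SecondCountableTopology X]
  {M : GradedManifold.{u, v} X}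

/-! ### Vector fields -/

/-- The value of a vector field on a homogeneous function. -/
def VField.act (Y : VField M) (f : Homog (M.gr ⊤)) : Homog (M.gr ⊤) :=
  ⟨f.deg + Y.deg, Y.val f.val, Y.mem.1 _ _ f.mem⟩

lemma VField.map_mem (Y : VField M) {k : ℤ} {f : M.C ⊤} (hf : f ∈ M.gr ⊤ k) {n : ℤ}
    (h : n = k + Y.deg) : Y.val f ∈ M.gr ⊤ n := h ▸ Y.mem.1 _ _ hf

lemma VField.map_mul (Y : VField M) (f : Homog (M.gr ⊤)) (g : M.C ⊤) :
    Y.val (f.val * g) = Y.val f.val * g + (-1 : ℝ) ^ (Y.deg * f.deg) • (f.val * Y.val g) :=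
  Y.mem.2 _ _ f.mem g

@[simp] lemma lie_deg (Y Z : VField M) : (lie Y Z).deg = Y.deg + Z.deg := rfl

lemma lie_val_apply (Y Z : VField M) (f : M.C ⊤) :
    (lie Y Z).val f = Y.val (Z.val f) - (-1 : ℝ) ^ (Y.deg * Z.deg) • Z.val (Y.val f) := rfl

/-- The product of a homogeneous function and a vector field. -/
noncomputable def VField.smul (f : Homog (M.gr ⊤)) (Y : VField M) : VField M :=
  (tangent M).smul f Y

@[simp] lemma VField.smul_deg (f : Homog (M.gr ⊤)) (Y : VField M) :
    (VField.smul f Y).deg = f.deg + Y.deg := rfl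

lemma VField.smul_val_apply (f : Homog (M.gr ⊤)) (Y : VField M) (g : M.C ⊤) :
    (VField.smul f Y).val g = f.val * Y.val g := rfl

@[simp] lemma VField.act_deg (Y : VField M) (f : Homog (M.gr ⊤)) :
    (Y.act f).deg = f.deg + Y.deg := rfl

@[simp] lemma VField.act_val (Y : VField M) (f : Homog (M.gr ⊤)) :
    (Y.act f).val = Y.val f.val := rfl

/-- Commutator identities are stated on values because the homogeneous elements on the two sides
carry degrees that are not syntactically equal. -/
lemma lie_swap_val_apply (Y Z : VField M) (f : M.C ⊤) :
    (lie Z Y).val f = (-(-1 : ℝ) ^ (Y.deg * Z.deg)) • (lie Y Z).val f := by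
  simp only [lie_val_apply, neg_one_zpow_smul, neg_smul]
  push_cast
  generalize (Y.deg : ZMod 2) = y, (Z.deg : ZMod 2) = z
  match_scalars <;> (revert y z; decide)

/-- Expanding every commutator leaves only triple compositions, whose coefficients agree by a parity
check. -/
lemma lie_lie_val_apply (Y Z W : VField M) (f : M.C ⊤) : (lie Y (lie Z W)).val f =
    (lie (lie Y Z) W).val f + (-1 : ℝ) ^ (Y.deg * Z.deg) • (lie Z (lie Y W)).val f := by
  simp only [lie_val_apply, map_sub, map_smul]
  simp only [neg_one_zpow_smul, lie_deg]
  push_cast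
  generalize (Y.deg : ZMod 2) = y, (Z.deg : ZMod 2) = z, (W.deg : ZMod 2) = w
  match_scalars <;> (revert y z w; decide)

/-- The term with `Y` acting on the coefficient comes from the Leibniz rule; the other two terms
assemble to the commutator of `Y` and `Z`. -/
lemma lie_smul_val_apply (Y Z : VField M) (f : Homog (M.gr ⊤)) (g : M.C ⊤) :
    (lie Y (VField.smul f Z)).val g = (VField.smul (Y.act f) Z).val g
      + (-1 : ℝ) ^ (Y.deg * f.deg) • (VField.smul f (lie Y Z)).val g := by
  simp only [lie_val_apply, VField.map_mul, VField.act_val,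
    mul_sub, mul_smul_comm, VField.smul_val_apply, VField.smul_deg, neg_one_zpow_smul]
  push_cast
  generalize (Y.deg : ZMod 2) = y, (Z.deg : ZMod 2) = z, (f.deg : ZMod 2) = w
  match_scalars <;> (revert y z w; decide)

lemma smul_lie_swap_val_apply (Y Z : VField M) (f : Homog (M.gr ⊤)) (g : M.C ⊤) :
    (VField.smul f (lie Z Y)).val g =
      (-(-1 : ℝ) ^ (Y.deg * Z.deg)) • (VField.smul f (lie Y Z)).val g := by
  rw [VField.smul_val_apply, lie_swap_val_apply, mul_smul_comm, VField.smul_val_apply]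

section Linear

variable {A : Type*} [AddCommGroup A] [Module ℝ A] {F : VField M → A}

/-- This and the next lemmas transfer commutator identities through a graded linear map, which is
how they enter forms with a commutator in one slot. -/
lemma IsGradedLinear.map_lie_swap (hF : IsGradedLinear F) (Y Z : VField M) :
    F (lie Z Y) = -((-1 : ℝ) ^ (Y.deg * Z.deg) • F (lie Y Z)) := by
  rw [hF.map_smul (z := lie Z Y) (z₁ := lie Y Z) (by simp [add_comm]) (-(-1 : ℝ) ^ (Y.deg * Z.deg))
    ?_, neg_smul]
  exact LinearMap.ext fun f => lie_swap_val_apply Y Z f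

lemma IsGradedLinear.map_lie_lie (hF : IsGradedLinear F) (Y Z W : VField M) :
    F (lie Y (lie Z W)) = F (lie (lie Y Z) W) + (-1 : ℝ) ^ (Y.deg * Z.deg) • F (lie Z (lie Y W)) := by
  refine hF.map_add_smul (by simp; ring) (by simp; ring) _ ?_
  exact LinearMap.ext fun f => lie_lie_val_apply Y Z W f

lemma IsGradedLinear.map_lie_smul (hF : IsGradedLinear F) (Y Z : VField M) (f : Homog (M.gr ⊤)) :
    F (lie Y (VField.smul f Z)) = F (VField.smul (Y.act f) Z)
      + (-1 : ℝ) ^ (Y.deg * f.deg) • F (VField.smul f (lie Y Z)) := by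
  refine hF.map_add_smul (by simp; ring) (by simp; ring) _ ?_
  exact LinearMap.ext fun g => lie_smul_val_apply Y Z f g

end Linear

/-- Antisymmetry reduces the coefficient in the left slot to the Leibniz rule in the right slot. -/
lemma IsGradedLinear.map_smul_lie {A : Type*} [AddCommGroup A] [Module ℝ A] {F : VField M → A}
    (hF : IsGradedLinear F) (Y Z : VField M) (f : Homog (M.gr ⊤)) :
    F (lie (VField.smul f Y) Z) = F (VField.smul f (lie Y Z))
      - (-1 : ℝ) ^ ((f.deg + Y.deg) * Z.deg) • F (VField.smul (Z.act f) Y) := by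
  rw [hF.map_lie_swap Z, hF.map_lie_smul]
  have e : F (VField.smul f (lie Z Y)) =
      -((-1 : ℝ) ^ (Y.deg * Z.deg) • F (VField.smul f (lie Y Z))) := by
    rw [hF.map_smul (z₁ := VField.smul f (lie Y Z)) (by simp; ring)
      (-(-1 : ℝ) ^ (Y.deg * Z.deg)) ?_, neg_smul]
    exact LinearMap.ext fun g => smul_lie_swap_val_apply Y Z f g
  rw [e]
  simp only [neg_one_zpow_smul, VField.smul_deg]
  push_cast
  generalize (Y.deg : ZMod 2) = y, (Z.deg : ZMod 2) = z, (f.deg : ZMod 2) = w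
  match_scalars <;> (revert y z w; decide)

/-! ### One-forms -/

section OneForm

variable {k : ℤ} {ξ : VField M → M.C ⊤}

lemma oneForm_mem (hξ : ξ ∈ (tangent M).dualGr ⊤ k) (Y : VField M) {n : ℤ} (h : n = Y.deg + k) :
    ξ Y ∈ M.gr ⊤ n := h ▸ hξ.2.1 Y

lemma oneForm_smul (hξ : ξ ∈ (tangent M).dualGr ⊤ k) (f : Homog (M.gr ⊤)) (Y : VField M) :
    ξ (VField.smul f Y) = (-1 : ℝ) ^ (k * f.deg) • (f.val * ξ Y) := hξ.2.2 f Y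

end OneForm

/-! ### Forms of arity two and three -/

section Form

variable {E : PreBundle M} {k : ℤ}

lemma IsForm.linear_two_fst {ω : (Fin 2 → Homog (E.gr ⊤)) → M.C ⊤} (h : IsForm E 2 k ω)
    (Z : Homog (E.gr ⊤)) : IsGradedLinear fun Y => ω ![Y, Z] := by
  have e : (fun Y => ω ![Y, Z]) = fun Y => ω (Function.update ![Z, Z] 0 Y) := by
    funext Y; congr 1; funext i; fin_cases i <;> rfl
  rw [e]; exact h.linear _ _

lemma IsForm.linear_two_snd {ω : (Fin 2 → Homog (E.gr ⊤)) → M.C ⊤} (h : IsForm E 2 k ω)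
    (Y : Homog (E.gr ⊤)) : IsGradedLinear fun Z => ω ![Y, Z] := by
  have e : (fun Z => ω ![Y, Z]) = fun Z => ω (Function.update ![Y, Y] 1 Z) := by
    funext Z; congr 1; funext i; fin_cases i <;> rfl
  rw [e]; exact h.linear _ _

lemma IsForm.swap_two {ω : (Fin 2 → Homog (E.gr ⊤)) → M.C ⊤} (h : IsForm E 2 k ω)
    (Y Z : Homog (E.gr ⊤)) : ω ![Z, Y] = -((-1 : ℝ) ^ (Y.deg * Z.deg) • ω ![Y, Z]) := by
  rw [h.skew ![Z, Y] 0 1 rfl]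
  have e : ![Z, Y] ∘ Equiv.swap (0 : Fin 2) 1 = ![Y, Z] := by
    funext i; fin_cases i <;> rfl
  rw [e, mul_comm]; rfl

lemma IsForm.smul_two_fst {ω : (Fin 2 → Homog (E.gr ⊤)) → M.C ⊤} (h : IsForm E 2 k ω)
    (f : Homog (M.gr ⊤)) (Y Z : Homog (E.gr ⊤)) :
    ω ![E.smul f Y, Z] = (-1 : ℝ) ^ (f.deg * k) • (f.val * ω ![Y, Z]) := by
  rw [← h.smul_first f ![Y, Z] 0 rfl]
  congr 1; funext i; fin_cases i <;> rfl

/-- Linearity over functions is assumed only in the first slot; skew-symmetry carries it to the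
second and produces the extra sign in the degree of `Y`. -/
lemma IsForm.smul_two_snd {ω : (Fin 2 → Homog (E.gr ⊤)) → M.C ⊤} (h : IsForm E 2 k ω)
    (f : Homog (M.gr ⊤)) (Y Z : Homog (E.gr ⊤)) :
    ω ![Y, E.smul f Z] = (-1 : ℝ) ^ (f.deg * (k + Y.deg)) • (f.val * ω ![Y, Z]) := by
  rw [h.swap_two (E.smul f Z) Y, h.smul_two_fst, h.swap_two Y Z]
  simp only [neg_one_zpow_smul, PreBundle.smul, mul_neg, mul_smul_comm]
  push_cast
  generalize (Y.deg : ZMod 2) = y, (Z.deg : ZMod 2) = z, (f.deg : ZMod 2) = w, (k : ZMod 2) = k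
  match_scalars <;> (revert y z w k; decide)

variable {ω : (Fin 3 → Homog (E.gr ⊤)) → M.C ⊤}

lemma IsForm.linear_three_fst (h : IsForm E 3 k ω) (Z W : Homog (E.gr ⊤)) :
    IsGradedLinear fun Y => ω ![Y, Z, W] := by
  have e : (fun Y => ω ![Y, Z, W]) = fun Y => ω (Function.update ![Z, Z, W] 0 Y) := by
    funext Y; congr 1; funext i; fin_cases i <;> rfl
  rw [e]; exact h.linear _ _

lemma IsForm.linear_three_snd (h : IsForm E 3 k ω) (Y W : Homog (E.gr ⊤)) :
    IsGradedLinear fun Z => ω ![Y, Z, W] := by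
  have e : (fun Z => ω ![Y, Z, W]) = fun Z => ω (Function.update ![Y, Y, W] 1 Z) := by
    funext Z; congr 1; funext i; fin_cases i <;> rfl
  rw [e]; exact h.linear _ _

lemma IsForm.linear_three_trd (h : IsForm E 3 k ω) (Y Z : Homog (E.gr ⊤)) :
    IsGradedLinear fun W => ω ![Y, Z, W] := by
  have e : (fun W => ω ![Y, Z, W]) = fun W => ω (Function.update ![Y, Z, Y] 2 W) := by
    funext W; congr 1; funext i; fin_cases i <;> rfl
  rw [e]; exact h.linear _ _

lemma IsForm.swap_three_fst (h : IsForm E 3 k ω) (Y Z W : Homog (E.gr ⊤)) :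
    ω ![Z, Y, W] = -((-1 : ℝ) ^ (Y.deg * Z.deg) • ω ![Y, Z, W]) := by
  rw [h.skew ![Z, Y, W] 0 1 rfl]
  have e : ![Z, Y, W] ∘ Equiv.swap (0 : Fin 3) 1 = ![Y, Z, W] := by
    funext i; fin_cases i <;> rfl
  rw [e, mul_comm]; rfl

lemma IsForm.swap_three_snd (h : IsForm E 3 k ω) (Y Z W : Homog (E.gr ⊤)) :
    ω ![Y, W, Z] = -((-1 : ℝ) ^ (Z.deg * W.deg) • ω ![Y, Z, W]) := by
  rw [h.skew ![Y, W, Z] 1 2 rfl]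
  have e : ![Y, W, Z] ∘ Equiv.swap (1 : Fin 3) 2 = ![Y, Z, W] := by
    funext i; fin_cases i <;> rfl
  rw [e, mul_comm]; rfl

/-- A rotation is a product of two adjacent transpositions, so the two minus signs cancel and only
the Koszul sign survives. -/
lemma IsForm.rotate_three (h : IsForm E 3 k ω) (Y Z W : Homog (E.gr ⊤)) :
    ω ![W, Y, Z] = (-1 : ℝ) ^ (W.deg * (Y.deg + Z.deg)) • ω ![Y, Z, W] := by
  rw [h.swap_three_fst Y W Z, h.swap_three_snd Y Z W]
  simp only [neg_one_zpow_smul]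
  push_cast
  generalize (Y.deg : ZMod 2) = y, (Z.deg : ZMod 2) = z, (W.deg : ZMod 2) = w
  match_scalars <;> (revert y z w; decide)

lemma IsForm.smul_three_fst (h : IsForm E 3 k ω) (f : Homog (M.gr ⊤)) (Y Z W : Homog (E.gr ⊤)) :
    ω ![E.smul f Y, Z, W] = (-1 : ℝ) ^ (f.deg * k) • (f.val * ω ![Y, Z, W]) := by
  rw [← h.smul_first f ![Y, Z, W] 0 rfl]
  congr 1; funext i; fin_cases i <;> rfl

lemma IsForm.smul_three_trd (h : IsForm E 3 k ω) (f : Homog (M.gr ⊤)) (Y Z W : Homog (E.gr ⊤)) :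
    ω ![Y, Z, E.smul f W] =
      (-1 : ℝ) ^ (f.deg * (k + Y.deg + Z.deg)) • (f.val * ω ![Y, Z, W]) := by
  have e := h.rotate_three Y Z (E.smul f W)
  rw [h.smul_three_fst, h.rotate_three Y Z W] at e
  -- After rotating the last argument to the front, the sign of the rotation is removed by
  -- multiplying with it once more: its square is 1.
  have e' := congrArg (fun t => (-1 : ℝ) ^ ((f.deg + W.deg) * (Y.deg + Z.deg)) • t) e
  simp only [neg_one_zpow_smul, PreBundle.smul, mul_smul_comm, smul_smul] at e' ⊢
  push_cast at e' ⊢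
  generalize (Y.deg : ZMod 2) = y, (Z.deg : ZMod 2) = z, (W.deg : ZMod 2) = w,
    (f.deg : ZMod 2) = a, (k : ZMod 2) = k at e' ⊢
  have h1 : paritySign ((a + w) * (y + z)) * paritySign ((a + w) * (y + z)) = 1 := by
    clear e'; revert a w y z; decide
  rw [h1, one_smul] at e'
  rw [← e']
  clear e'
  match_scalars <;> (revert y z w a k; decide)

end Form

end GradedGeometry

namespace GradedGeometry

variable {X : Type u} [TopologicalSpace X] [T2Space X] [SecondCountableTopology X]
  {M : GradedManifold.{u, v} X} {ℓ : ℤ}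

/-! ### The Dorfman bracket -/

@[simp] lemma vec_deg (ψ : Homog ((genTangent M ℓ).gr ⊤)) : (vec ψ).deg = ψ.deg + ℓ := rfl

lemma cov_mem (ψ : Homog ((genTangent M ℓ).gr ⊤)) : cov ψ ∈ (tangent M).dualGr ⊤ ψ.deg :=
  ψ.mem.2

lemma cov_linear (ψ : Homog ((genTangent M ℓ).gr ⊤)) : IsGradedLinear (cov ψ) := (cov_mem ψ).1

/-- In Cartan's formula the two terms in which `Z` acts on `η Y`, one from each summand, cancel. -/
lemma lieDeriv_one_apply (k : ℤ) (Y : VField M) (η : VField M → M.C ⊤) (Z : VField M) :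
    ofForm (lieDeriv k Y (toForm η)) Z =
      Y.val (η Z) - (-1 : ℝ) ^ (k * Y.deg) • η (lie Y Z) := by
  have h1 : contract k Y (dForm k (toForm η)) ![Z] =
      (-1 : ℝ) ^ (k * (Y.deg - 1)) • dForm k (toForm η) ![Y, Z] := rfl
  have h2 : contract k Y (toForm η) = fun _ => (-1 : ℝ) ^ (k * (Y.deg - 1)) • η Y := rfl
  have h3 : ∀ W : VField M, toForm η ![W] = η W := fun _ => rfl
  rw [ofForm, lieDeriv, Pi.add_apply, Pi.smul_apply, h1, h2, dForm_zero_apply, dForm_one_apply]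
  simp only [h3, map_smul]
  simp only [neg_one_zpow_smul]
  push_cast
  generalize (Y.deg : ZMod 2) = y, (Z.deg : ZMod 2) = z, (k : ZMod 2) = k
  match_scalars <;> (revert y z k; decide)

lemma contract_dForm_one_apply (k : ℤ) (Y : VField M) (ξ : VField M → M.C ⊤) (Z : VField M) :
    ofForm (contract k Y (dForm k (toForm ξ))) Z =
      Y.val (ξ Z) - (-1 : ℝ) ^ (k * (Y.deg + Z.deg) + Y.deg * Z.deg) • Z.val (ξ Y)
        - (-1 : ℝ) ^ (k * Y.deg) • ξ (lie Y Z) := by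
  have h1 : contract k Y (dForm k (toForm ξ)) ![Z] =
      (-1 : ℝ) ^ (k * (Y.deg - 1)) • dForm k (toForm ξ) ![Y, Z] := rfl
  have h3 : ∀ W : VField M, toForm ξ ![W] = ξ W := fun _ => rfl
  rw [ofForm, h1, dForm_one_apply]
  simp only [h3, neg_one_zpow_smul]
  push_cast
  generalize (Y.deg : ZMod 2) = y, (Z.deg : ZMod 2) = z, (k : ZMod 2) = k
  match_scalars <;> (revert y z k; decide)

/-- This expansion, free of exterior derivatives of 1-forms, is the form in which all bracket
identities are checked. -/
lemma dorfman_snd_apply (H : FormFun M 3) (ψ φ : Homog ((genTangent M ℓ).gr ⊤)) (Z : VField M) :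
    (dorfman ℓ H ψ φ).2 Z =
      (-1 : ℝ) ^ ((ψ.deg + ℓ) * ℓ) • (vec ψ).val (cov φ Z)
      - (-1 : ℝ) ^ ((ψ.deg + ℓ) * (φ.deg + ℓ)) • cov φ (lie (vec ψ) Z)
      - (-1 : ℝ) ^ (ψ.deg * (φ.deg + ℓ)) • (vec φ).val (cov ψ Z)
      + (-1 : ℝ) ^ (Z.deg * (ψ.deg + φ.deg + ℓ)) • Z.val (cov ψ (vec φ))
      + cov ψ (lie (vec φ) Z)
      + (-1 : ℝ) ^ ℓ • H ![vec ψ, vec φ, Z] := by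
  have h : (dorfman ℓ H ψ φ).2 Z =
      (-1 : ℝ) ^ ((vec ψ).deg * ℓ) • ofForm (lieDeriv φ.deg (vec ψ) (toForm (cov φ))) Z
      - (-1 : ℝ) ^ ((vec φ).deg * ((vec ψ).deg + ℓ)) •
          ofForm (contract ψ.deg (vec φ) (dForm ψ.deg (toForm (cov ψ)))) Z
      + (-1 : ℝ) ^ ℓ • H ![vec ψ, vec φ, Z] := rfl
  rw [h, lieDeriv_one_apply, contract_dForm_one_apply]
  simp only [vec_deg, neg_one_zpow_smul]
  push_cast
  generalize (ψ.deg : ZMod 2) = a, (φ.deg : ZMod 2) = b, (Z.deg : ZMod 2) = z, (ℓ : ZMod 2) = l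
  match_scalars <;> (revert a b z l; decide)

lemma IsForm.snd_mem_dualGr {k : ℤ} {ω : FormFun M 2} (hω : IsForm (tangent M) 2 k ω)
    (Y : VField M) {n : ℤ} (hn : n = k + Y.deg) :
    (fun Z => ω ![Y, Z]) ∈ (tangent M).dualGr ⊤ n := by
  refine ⟨hω.linear_two_snd Y, fun Z => ?_, fun f Z => ?_⟩
  · have := hω.mem ![Y, Z]
    simp only [Fin.sum_univ_two, Matrix.cons_val_zero, Matrix.cons_val_one] at this
    rwa [show k + (Y.deg + Z.deg) = Z.deg + n by rw [hn]; ring] at this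
  · dsimp only
    rw [hω.smul_two_snd f Y Z, hn, mul_comm]

lemma IsForm.trd_mem_dualGr {k : ℤ} {H : FormFun M 3} (hH : IsForm (tangent M) 3 k H)
    (Y Z : VField M) {n : ℤ} (hn : n = k + Y.deg + Z.deg) :
    (fun W => H ![Y, Z, W]) ∈ (tangent M).dualGr ⊤ n := by
  refine ⟨hH.linear_three_trd Y Z, fun W => ?_, fun f W => ?_⟩
  · have := hH.mem ![Y, Z, W]
    simp only [Fin.sum_univ_three, Matrix.cons_val_zero, Matrix.cons_val_one, Matrix.cons_val]
      at this
    rwa [show k + (Y.deg + Z.deg + W.deg) = W.deg + n by rw [hn]; ring] at this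
  · dsimp only
    rw [hH.smul_three_trd f Y Z W, hn, mul_comm]

lemma VField.act_apply_linear {k : ℤ} {ξ : VField M → M.C ⊤} (hξ : ξ ∈ (tangent M).dualGr ⊤ k)
    (Y : VField M) : IsGradedLinear fun Z => Y.val (ξ Z) := by
  refine ⟨fun n a b ha hb => ?_, fun n c a ha => ?_⟩
  · simp only [hξ.1.1 n a b ha hb, map_add]
  · simp only [hξ.1.2 n c a ha, map_smul]

/-- The commutator is written out, with `s` in place of its sign, so that a sum of underlying linear
maps can be inserted without packing it as a vector field. -/
lemma lie_add_val_apply (Y : VField M) (s : ℝ) (a b : M.C ⊤ →ₗ[ℝ] M.C ⊤) (f : M.C ⊤) :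
    Y.val ((a + b) f) - s • (a + b) (Y.val f) =
      (Y.val (a f) - s • a (Y.val f)) + (Y.val (b f) - s • b (Y.val f)) := by
  simp only [LinearMap.add_apply, map_add, smul_add]
  abel

lemma lie_smul_scalar_val_apply (Y : VField M) (s c : ℝ) (a : M.C ⊤ →ₗ[ℝ] M.C ⊤) (f : M.C ⊤) :
    Y.val ((c • a) f) - s • (c • a) (Y.val f) = c • (Y.val (a f) - s • a (Y.val f)) := by
  simp only [LinearMap.smul_apply, map_smul, smul_sub, smul_comm s c]

lemma IsGradedLinear.comp_lie {A : Type*} [AddCommGroup A] [Module ℝ A] {F : VField M → A}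
    (hF : IsGradedLinear F) (Y : VField M) : IsGradedLinear fun Z => F (lie Y Z) := by
  refine ⟨fun n a b ha hb => ?_, fun n c a ha => ?_⟩
  · exact hF.map_add (z₁ := lie Y ⟨n, a, ha⟩) (z₂ := lie Y ⟨n, b, hb⟩) rfl rfl
      (LinearMap.ext fun f => lie_add_val_apply Y _ a b f)
  · exact hF.map_smul (z := lie Y ⟨n, c • a, (gDer M ⊤ n).smul_mem c ha⟩) (z₁ := lie Y ⟨n, a, ha⟩)
      rfl c (LinearMap.ext fun f => lie_smul_scalar_val_apply Y ((-1 : ℝ) ^ (Y.deg * n)) c a f)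

lemma IsGradedLinear.sub {V W : Type*} [AddCommGroup V] [Module ℝ V] [AddCommGroup W] [Module ℝ W]
    {gr : ℤ → Submodule ℝ V} {F G : Homog gr → W} (hF : IsGradedLinear F) (hG : IsGradedLinear G) :
    IsGradedLinear fun z => F z - G z := by
  refine ⟨fun n a b ha hb => ?_, fun n c a ha => ?_⟩
  · simp only [hF.1 n a b ha hb, hG.1 n a b ha hb]
    abel
  · simp only [hF.2 n c a ha, hG.2 n c a ha, smul_sub]

/-- Linearity is required within each degree separately, and there a factor depending on the degree
is constant. This absorbs all Koszul signs. -/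
lemma IsGradedLinear.deg_smul {V W : Type*} [AddCommGroup V] [Module ℝ V] [AddCommGroup W]
    [Module ℝ W] {gr : ℤ → Submodule ℝ V} {F : Homog gr → W} (hF : IsGradedLinear F)
    (s : ℤ → ℝ) : IsGradedLinear fun z => s z.deg • F z := by
  refine ⟨fun n a b ha hb => ?_, fun n c a ha => ?_⟩
  · simp only [hF.1 n a b ha hb, smul_add]
  · simp only [hF.2 n c a ha, smul_comm c]

lemma isGradedLinear_apply (g : M.C ⊤) : IsGradedLinear fun Z : VField M => Z.val g :=
  ⟨fun _ a b _ _ => LinearMap.add_apply a b g, fun _ c a _ => LinearMap.smul_apply c a g⟩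

/-- For linearity over functions, the derivative of the coefficient in `Y.val (η (f ▷ Z))` cancels
the one that the Leibniz rule for the commutator puts into `η`. -/
lemma lieDeriv_mem_dualGr {k : ℤ} {η : VField M → M.C ⊤} (hη : η ∈ (tangent M).dualGr ⊤ k)
    (Y : VField M) : ofForm (lieDeriv k Y (toForm η)) ∈ (tangent M).dualGr ⊤ (k + Y.deg) := by
  have e : ofForm (lieDeriv k Y (toForm η)) =
      fun Z => Y.val (η Z) - (-1 : ℝ) ^ (k * Y.deg) • η (lie Y Z) :=
    funext fun Z => lieDeriv_one_apply k Y η Z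
  rw [e]
  refine ⟨(VField.act_apply_linear hη Y).sub
    ((hη.1.comp_lie Y).deg_smul fun _ => (-1 : ℝ) ^ (k * Y.deg)), fun Z => ?_, fun f Z => ?_⟩
  · refine Submodule.sub_mem _ (Y.map_mem (hη.2.1 Z) (by ring)) (Submodule.smul_mem _ _ ?_)
    exact oneForm_mem hη _ (by simp; ring)
  · change Y.val (η (VField.smul f Z)) - (-1 : ℝ) ^ (k * Y.deg) • η (lie Y (VField.smul f Z)) =
      (-1 : ℝ) ^ ((k + Y.deg) * f.deg) • (f.val * (Y.val (η Z) - (-1 : ℝ) ^ (k * Y.deg) • η (lie Y Z)))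
    rw [hη.1.map_lie_smul, oneForm_smul hη, oneForm_smul hη, oneForm_smul hη, map_smul, VField.map_mul]
    simp only [mul_sub, mul_smul_comm, VField.act_deg, VField.act_val, neg_one_zpow_smul]
    push_cast
    generalize (Y.deg : ZMod 2) = y, (f.deg : ZMod 2) = w, (k : ZMod 2) = k
    match_scalars <;> (revert y w k; decide)

/-- The derivatives of the coefficient cancel as for the Lie derivative; the additional term, where
`Z` acts on `ξ Y`, is linear over functions by itself. -/
lemma contract_dForm_mem_dualGr {k : ℤ} {ξ : VField M → M.C ⊤} (hξ : ξ ∈ (tangent M).dualGr ⊤ k)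
    (Y : VField M) :
    ofForm (contract k Y (dForm k (toForm ξ))) ∈ (tangent M).dualGr ⊤ (k + Y.deg) := by
  have e : ofForm (contract k Y (dForm k (toForm ξ))) =
      fun Z => Y.val (ξ Z) - (-1 : ℝ) ^ (k * (Y.deg + Z.deg) + Y.deg * Z.deg) • Z.val (ξ Y)
        - (-1 : ℝ) ^ (k * Y.deg) • ξ (lie Y Z) :=
    funext fun Z => contract_dForm_one_apply k Y ξ Z
  rw [e]
  refine ⟨((VField.act_apply_linear hξ Y).sub ((isGradedLinear_apply (ξ Y)).deg_smul
    fun z => (-1 : ℝ) ^ (k * (Y.deg + z) + Y.deg * z))).sub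
    ((hξ.1.comp_lie Y).deg_smul fun _ => (-1 : ℝ) ^ (k * Y.deg)), fun Z => ?_, fun f Z => ?_⟩
  · refine Submodule.sub_mem _ (Submodule.sub_mem _ (Y.map_mem (hξ.2.1 Z) (by ring))
      (Submodule.smul_mem _ _ (VField.map_mem Z (hξ.2.1 Y) (by ring)))) (Submodule.smul_mem _ _ ?_)
    exact oneForm_mem hξ _ (by simp; ring)
  · change Y.val (ξ (VField.smul f Z))
      - (-1 : ℝ) ^ (k * (Y.deg + (f.deg + Z.deg)) + Y.deg * (f.deg + Z.deg)) •
          (VField.smul f Z).val (ξ Y)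
      - (-1 : ℝ) ^ (k * Y.deg) • ξ (lie Y (VField.smul f Z)) =
      (-1 : ℝ) ^ ((k + Y.deg) * f.deg) • (f.val * (Y.val (ξ Z)
        - (-1 : ℝ) ^ (k * (Y.deg + Z.deg) + Y.deg * Z.deg) • Z.val (ξ Y)
        - (-1 : ℝ) ^ (k * Y.deg) • ξ (lie Y Z)))
    rw [hξ.1.map_lie_smul, oneForm_smul hξ, oneForm_smul hξ, oneForm_smul hξ, map_smul, VField.map_mul,
      VField.smul_val_apply]
    simp only [mul_sub, mul_smul_comm, VField.act_deg, VField.act_val, neg_one_zpow_smul]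
    push_cast
    generalize (Y.deg : ZMod 2) = y, (f.deg : ZMod 2) = w, (k : ZMod 2) = k, (Z.deg : ZMod 2) = z
    match_scalars <;> (revert y w k z; decide)

lemma dorfman_mem {H : FormFun M 3} (hH : IsForm (tangent M) 3 (-ℓ) H)
    (ψ φ : Homog ((genTangent M ℓ).gr ⊤)) :
    dorfman ℓ H ψ φ ∈ (genTangent M ℓ).gr ⊤ (ψ.deg + φ.deg + ℓ) := by
  refine ⟨?_, ?_⟩
  · have := (lie (vec ψ) (vec φ)).mem
    rw [show (lie (vec ψ) (vec φ)).deg = ψ.deg + φ.deg + ℓ + ℓ by simp; ring] at this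
    exact this
  · refine Submodule.add_mem _ (Submodule.sub_mem _ (Submodule.smul_mem _ _ ?_)
      (Submodule.smul_mem _ _ ?_)) (Submodule.smul_mem _ _ ?_)
    · have := lieDeriv_mem_dualGr (cov_mem φ) (vec ψ)
      rwa [show φ.deg + (vec ψ).deg = ψ.deg + φ.deg + ℓ by simp; ring] at this
    · have := contract_dForm_mem_dualGr (cov_mem ψ) (vec φ)
      rwa [show ψ.deg + (vec φ).deg = ψ.deg + φ.deg + ℓ by simp; ring] at this
    · exact hH.trd_mem_dualGr _ _ (by simp; ring)

lemma vec_dorfman {H : FormFun M 3} (ψ φ : Homog ((genTangent M ℓ).gr ⊤))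
    (h : dorfman ℓ H ψ φ ∈ (genTangent M ℓ).gr ⊤ (ψ.deg + φ.deg + ℓ)) :
    vec (⟨_, dorfman ℓ H ψ φ, h⟩ : Homog ((genTangent M ℓ).gr ⊤)) = lie (vec ψ) (vec φ) :=
  Homog.ext' (by simp; ring) rfl

/-- The twisted Dorfman bracket of two sections as a homogeneous section. -/
noncomputable def dorfmanHom {H : FormFun M 3} (hH : IsForm (tangent M) 3 (-ℓ) H)
    (ψ φ : Homog ((genTangent M ℓ).gr ⊤)) : Homog ((genTangent M ℓ).gr ⊤) :=
  ⟨_, dorfman ℓ H ψ φ, dorfman_mem hH ψ φ⟩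

section DorfmanHom

variable {H : FormFun M 3} (hH : IsForm (tangent M) 3 (-ℓ) H)
  (ψ φ χ : Homog ((genTangent M ℓ).gr ⊤))

@[simp] lemma dorfmanHom_deg : (dorfmanHom hH ψ φ).deg = ψ.deg + φ.deg + ℓ := rfl

lemma vec_dorfmanHom : vec (dorfmanHom hH ψ φ) = lie (vec ψ) (vec φ) := vec_dorfman ψ φ _

lemma cov_dorfmanHom (Z : VField M) : cov (dorfmanHom hH ψ φ) Z =
      (-1 : ℝ) ^ ((ψ.deg + ℓ) * ℓ) • (vec ψ).val (cov φ Z)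
      - (-1 : ℝ) ^ ((ψ.deg + ℓ) * (φ.deg + ℓ)) • cov φ (lie (vec ψ) Z)
      - (-1 : ℝ) ^ (ψ.deg * (φ.deg + ℓ)) • (vec φ).val (cov ψ Z)
      + (-1 : ℝ) ^ (Z.deg * (ψ.deg + φ.deg + ℓ)) • Z.val (cov ψ (vec φ))
      + cov ψ (lie (vec φ) Z)
      + (-1 : ℝ) ^ ℓ • H ![vec ψ, vec φ, Z] := dorfman_snd_apply H ψ φ Z

lemma pairing_genMetric : pairing ℓ (genMetric M ℓ) ψ φ =
    cov ψ (vec φ) + (-1 : ℝ) ^ ((ψ.deg + ℓ) * (φ.deg + ℓ)) • cov φ (vec ψ) := by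
  simp only [pairing, genMetric, vec_deg, neg_one_zpow_smul]
  push_cast
  generalize (ψ.deg : ZMod 2) = a, (φ.deg : ZMod 2) = b, (ℓ : ZMod 2) = l
  match_scalars <;> (revert a b l; decide)

/-- The two values of `H` cancel by skew-symmetry in the last two arguments, and the values of `cov
ψ` on the opposite commutators of `vec φ` and `vec χ` cancel likewise. No closedness is involved. -/
lemma dorfman_compatible :
    (-1 : ℝ) ^ ((ψ.deg + ℓ) * ℓ) • (vec ψ).val (pairing ℓ (genMetric M ℓ) φ χ) =
      pairing ℓ (genMetric M ℓ) (dorfmanHom hH ψ φ) χ +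
        (-1 : ℝ) ^ ((ψ.deg + ℓ) * (φ.deg + ℓ)) •
          pairing ℓ (genMetric M ℓ) φ (dorfmanHom hH ψ χ) := by
  simp only [pairing_genMetric, vec_dorfmanHom, cov_dorfmanHom, map_add, map_smul,
    (cov_linear ψ).map_lie_swap (vec φ) (vec χ), hH.swap_three_snd (vec ψ) (vec φ) (vec χ)]
  simp only [neg_one_zpow_smul, dorfmanHom_deg, vec_deg]
  push_cast
  generalize (ψ.deg : ZMod 2) = a, (φ.deg : ZMod 2) = b, (χ.deg : ZMod 2) = c, (ℓ : ZMod 2) = l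
  match_scalars <;> (revert a b c l; decide)

/-- Symmetrizing removes `H`, the commutator terms and the actions of `vec ψ` and `vec φ`. What is
left is `Z` acting on the pairing, that is, its differential up to sign. -/
lemma dorfman_skew (Z : VField M) :
    cov (dorfmanHom hH ψ φ) Z
      + (-1 : ℝ) ^ ((ψ.deg + ℓ) * (φ.deg + ℓ)) • cov (dorfmanHom hH φ ψ) Z =
    (-1 : ℝ) ^ (ψ.deg + φ.deg + ℓ) •
      dFun (ψ.deg + φ.deg + ℓ) (pairing ℓ (genMetric M ℓ) ψ φ) Z := by
  rw [dFun, ofForm, dForm_zero_apply, pairing_genMetric, cov_dorfmanHom, cov_dorfmanHom,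
    hH.swap_three_fst (vec ψ) (vec φ) Z]
  simp only [map_add, map_smul]
  simp only [neg_one_zpow_smul, vec_deg]
  push_cast
  generalize (ψ.deg : ZMod 2) = a, (φ.deg : ZMod 2) = b, (Z.deg : ZMod 2) = c, (ℓ : ZMod 2) = l
  match_scalars <;> (revert a b c l; decide)

/-- Terms with two successive vector field actions cancel directly, and those with nested
commutators cancel by the Jacobi identity inside `cov χ`, `cov φ` and `cov ψ`. The three brackets
contribute three, four and three terms in `H`, which are the ten terms of the differential. -/
lemma dorfman_jacobiator (W : VField M) :
    cov (dorfmanHom hH ψ (dorfmanHom hH φ χ)) W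
      - cov (dorfmanHom hH (dorfmanHom hH ψ φ) χ) W
      - (-1 : ℝ) ^ ((ψ.deg + ℓ) * (φ.deg + ℓ)) •
          cov (dorfmanHom hH φ (dorfmanHom hH ψ χ)) W =
    dForm (-ℓ) H ![vec ψ, vec φ, vec χ, W] := by
  have hψ := cov_linear ψ
  have hφ := cov_linear φ
  have hχ := cov_linear χ
  simp only [cov_dorfmanHom, vec_dorfmanHom, dForm_three_apply, map_add, map_sub, map_smul,
    lie_val_apply]
  -- Besides applying Jacobi to each 1-form, every commutator inside `H` is moved to the first slot,
  -- where the formula for the differential has it.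
  rw [hχ.map_lie_lie (vec ψ) (vec φ) W, hφ.map_lie_lie (vec ψ) (vec χ) W,
    hψ.map_lie_lie (vec φ) (vec χ) W, hH.rotate_three (vec φ) (vec χ) (lie (vec ψ) W),
    hH.rotate_three (vec ψ) (vec χ) (lie (vec φ) W),
    hH.rotate_three (vec ψ) (vec φ) (lie (vec χ) W),
    hH.swap_three_fst (vec ψ) (lie (vec φ) (vec χ)) W,
    hH.swap_three_fst (vec φ) (lie (vec ψ) (vec χ)) W]
  simp only [neg_one_zpow_smul, vec_deg, dorfmanHom_deg, lie_deg]
  push_cast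
  generalize (ψ.deg : ZMod 2) = a, (φ.deg : ZMod 2) = b, (χ.deg : ZMod 2) = c, (ℓ : ZMod 2) = l,
    (W.deg : ZMod 2) = w
  match_scalars <;> (revert a b c l w; decide)

end DorfmanHom

end GradedGeometry

namespace GradedGeometry

/-! ### Combinators for graded linear maps -/

section Combinators

variable {V W W' : Type*} [AddCommGroup V] [Module ℝ V] [AddCommGroup W] [Module ℝ W]
  [AddCommGroup W'] [Module ℝ W'] {gr : ℤ → Submodule ℝ V} {F G : Homog gr → W}

lemma IsGradedLinear.add (hF : IsGradedLinear F) (hG : IsGradedLinear G) :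
    IsGradedLinear fun z => F z + G z := by
  refine ⟨fun n a b ha hb => ?_, fun n c a ha => ?_⟩
  · simp only [hF.1 n a b ha hb, hG.1 n a b ha hb]
    abel
  · simp only [hF.2 n c a ha, hG.2 n c a ha, smul_add]

lemma IsGradedLinear.neg (hF : IsGradedLinear F) : IsGradedLinear fun z => -F z := by
  have := hF.deg_smul fun _ => -1
  simpa using this

lemma IsGradedLinear.linear_comp (hF : IsGradedLinear F) (T : W →ₗ[ℝ] W') :
    IsGradedLinear fun z => T (F z) := by
  refine ⟨fun n a b ha hb => ?_, fun n c a ha => ?_⟩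
  · simp only [hF.1 n a b ha hb, _root_.map_add]
  · simp only [hF.2 n c a ha, _root_.map_smul]

lemma IsGradedLinear.prodMk {G : Homog gr → W'} (hF : IsGradedLinear F) (hG : IsGradedLinear G) :
    IsGradedLinear fun z => (F z, G z) := by
  refine ⟨fun n a b ha hb => ?_, fun n c a ha => ?_⟩
  · simp only [hF.1 n a b ha hb, hG.1 n a b ha hb, Prod.mk_add_mk]
  · simp only [hF.2 n c a ha, hG.2 n c a ha, Prod.smul_mk]

lemma isGradedLinear_pi {ι : Type*} {F : Homog gr → ι → W}
    (hF : ∀ i, IsGradedLinear fun z => F z i) : IsGradedLinear F :=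
  ⟨fun n a b ha hb => funext fun i => (hF i).1 n a b ha hb,
    fun n c a ha => funext fun i => (hF i).2 n c a ha⟩

end Combinators

variable {X : Type u} [TopologicalSpace X] [T2Space X] [SecondCountableTopology X]
  {M : GradedManifold.{u, v} X} {ℓ : ℤ}

lemma IsGradedLinear.comp_lie_left {A : Type*} [AddCommGroup A] [Module ℝ A] {F : VField M → A}
    (hF : IsGradedLinear F) (Z : VField M) : IsGradedLinear fun Y => F (lie Y Z) := by
  have e : (fun Y => F (lie Y Z)) = fun Y => -((-1 : ℝ) ^ (Z.deg * Y.deg) • F (lie Z Y)) :=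
    funext fun Y => hF.map_lie_swap Z Y
  rw [e]
  exact ((hF.comp_lie Z).deg_smul fun n => (-1 : ℝ) ^ (Z.deg * n)).neg

/-- The vector part of a section of degree n has degree n + ℓ, so linearity in degree n uses
linearity of `F` in the shifted degree. -/
lemma IsGradedLinear.comp_vec {A : Type*} [AddCommGroup A] [Module ℝ A] {F : VField M → A}
    (hF : IsGradedLinear F) :
    IsGradedLinear fun ψ : Homog ((genTangent M ℓ).gr ⊤) => F (vec ψ) :=
  ⟨fun n a b ha hb => hF.1 (n + ℓ) a.1 b.1 ha.1 hb.1, fun n c a ha => hF.2 (n + ℓ) c a.1 ha.1⟩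

lemma isGradedLinear_cov (Z : VField M) :
    IsGradedLinear fun ψ : Homog ((genTangent M ℓ).gr ⊤) => cov ψ Z :=
  ⟨fun _ _ _ _ _ => rfl, fun _ _ _ _ => rfl⟩

lemma isGradedLinear_val : IsGradedLinear fun Z : VField M => Z.val :=
  ⟨fun _ _ _ _ _ => rfl, fun _ _ _ _ => rfl⟩

/-! ### Linearity of the structure maps -/

/-- On a fixed vector field each of the six expanded terms is a linear expression in `ψ` times a
sign depending only on its degree. -/
lemma dorfman_linear_left {H : FormFun M 3} (hH : IsForm (tangent M) 3 (-ℓ) H)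
    (φ : Homog ((genTangent M ℓ).gr ⊤)) : IsGradedLinear fun ψ => dorfman ℓ H ψ φ := by
  refine IsGradedLinear.prodMk (F := fun ψ => (lie (vec ψ) (vec φ)).val)
    (isGradedLinear_val.comp_lie_left (vec φ)).comp_vec (isGradedLinear_pi fun Z => ?_)
  change IsGradedLinear fun ψ => (dorfman ℓ H ψ φ).2 Z
  simp only [dorfman_snd_apply]
  refine (((((((isGradedLinear_apply _).comp_vec).deg_smul fun n => (-1 : ℝ) ^ ((n + ℓ) * ℓ)).sub
    ((((cov_linear φ).comp_lie_left Z).comp_vec).deg_smul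
      fun n => (-1 : ℝ) ^ ((n + ℓ) * (φ.deg + ℓ)))).sub
    (((isGradedLinear_cov Z).linear_comp (vec φ).val).deg_smul
      fun n => (-1 : ℝ) ^ (n * (φ.deg + ℓ)))).add
    (((isGradedLinear_cov (vec φ)).linear_comp Z.val).deg_smul
      fun n => (-1 : ℝ) ^ (Z.deg * (n + φ.deg + ℓ)))).add
    (isGradedLinear_cov _)).add
    (((hH.linear_three_fst (vec φ) Z).comp_vec).deg_smul fun _ => (-1 : ℝ) ^ ℓ)

lemma dorfman_linear_right {H : FormFun M 3} (hH : IsForm (tangent M) 3 (-ℓ) H)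
    (ψ : Homog ((genTangent M ℓ).gr ⊤)) : IsGradedLinear fun φ => dorfman ℓ H ψ φ := by
  refine IsGradedLinear.prodMk (F := fun φ => (lie (vec ψ) (vec φ)).val)
    (isGradedLinear_val.comp_lie (vec ψ)).comp_vec (isGradedLinear_pi fun Z => ?_)
  change IsGradedLinear fun φ => (dorfman ℓ H ψ φ).2 Z
  simp only [dorfman_snd_apply]
  refine ((((((((isGradedLinear_cov Z).linear_comp (vec ψ).val)).deg_smul
      fun _ => (-1 : ℝ) ^ ((ψ.deg + ℓ) * ℓ)).sub
    ((isGradedLinear_cov _).deg_smul fun n => (-1 : ℝ) ^ ((ψ.deg + ℓ) * (n + ℓ)))).sub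
    (((isGradedLinear_apply _).comp_vec).deg_smul fun n => (-1 : ℝ) ^ (ψ.deg * (n + ℓ)))).add
    (((cov_linear ψ).comp_vec.linear_comp Z.val).deg_smul
      fun n => (-1 : ℝ) ^ (Z.deg * (ψ.deg + n + ℓ)))).add
    ((cov_linear ψ).comp_lie_left Z).comp_vec).add
    (((hH.linear_three_snd (vec ψ) Z).comp_vec).deg_smul fun _ => (-1 : ℝ) ^ ℓ)

/-- The sign is that of the action on the shifted bundle; the form part of a section carries none.
-/
lemma genTangent_smul_vec {A : Type*} [AddCommGroup A] [Module ℝ A] {F : VField M → A}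
    (hF : IsGradedLinear F) (f : Homog (M.gr ⊤)) (ψ : Homog ((genTangent M ℓ).gr ⊤)) :
    F (vec ((genTangent M ℓ).smul f ψ)) =
      (-1 : ℝ) ^ (f.deg * ℓ) • F (VField.smul f (vec ψ)) :=
  hF.map_smul (by simp [PreBundle.smul]; ring) _ rfl

lemma genTangent_smul_cov (f : Homog (M.gr ⊤)) (ψ : Homog ((genTangent M ℓ).gr ⊤))
    (Z : VField M) : cov ((genTangent M ℓ).smul f ψ) Z = f.val * cov ψ Z := rfl

/-- The sign built into the shifted action is precisely the one required of a bundle map of degree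
ℓ, so compatibility with the action is definitional. -/
lemma genAnchor_isBundleMap : (genTangent M ℓ).IsBundleMap (tangent M) ℓ (genAnchor M ℓ) where
  linear := isGradedLinear_val.comp_vec
  mem ψ := (vec ψ).mem
  map_act _ _ := rfl

lemma genMetric_apply (ψ φ : Homog ((genTangent M ℓ).gr ⊤)) : genMetric M ℓ ψ φ =
    (-1 : ℝ) ^ ((ψ.deg + ℓ) * ℓ) • cov ψ (vec φ) +
    (-1 : ℝ) ^ ((ψ.deg + ℓ) * φ.deg) • cov φ (vec ψ) := rfl

lemma genMetric_mem (ψ : Homog ((genTangent M ℓ).gr ⊤)) :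
    genMetric M ℓ ψ ∈ (genTangent M ℓ).dualGr ⊤ (ψ.deg + ℓ) := by
  refine ⟨?_, fun φ => ?_, fun f φ => ?_⟩
  · exact ((cov_linear ψ).comp_vec.deg_smul fun _ => (-1 : ℝ) ^ ((ψ.deg + ℓ) * ℓ)).add
      ((isGradedLinear_cov (vec ψ)).deg_smul fun n => (-1 : ℝ) ^ ((ψ.deg + ℓ) * n))
  · exact Submodule.add_mem _ (Submodule.smul_mem _ _ (oneForm_mem (cov_mem ψ) _ (by simp; ring)))
      (Submodule.smul_mem _ _ (oneForm_mem (cov_mem φ) _ (by simp; ring)))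
  · rw [genMetric_apply, genTangent_smul_vec (cov_linear ψ), genTangent_smul_cov,
      oneForm_smul (cov_mem ψ), genMetric_apply]
    have e : ((genTangent M ℓ).smul f φ).deg = f.deg + φ.deg := rfl
    simp only [e, neg_one_zpow_smul, mul_add, mul_smul_comm]
    push_cast
    generalize (ψ.deg : ZMod 2) = a, (φ.deg : ZMod 2) = b, (f.deg : ZMod 2) = w, (ℓ : ZMod 2) = l
    match_scalars <;> (revert a b w l; decide)

lemma genMetric_isBundleMap :
    (genTangent M ℓ).IsBundleMap (genTangent M ℓ).dual ℓ (genMetric M ℓ) where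
  linear := isGradedLinear_pi fun φ =>
    ((isGradedLinear_cov (vec φ)).deg_smul fun n => (-1 : ℝ) ^ ((n + ℓ) * ℓ)).add
      ((cov_linear φ).comp_vec.deg_smul fun n => (-1 : ℝ) ^ ((n + ℓ) * φ.deg))
  mem := genMetric_mem
  map_act f ψ := by
    funext φ
    change genMetric M ℓ ((genTangent M ℓ).smul f ψ) φ =
      (-1 : ℝ) ^ (f.deg * ℓ) • (f.val * genMetric M ℓ ψ φ)
    rw [genMetric_apply, genTangent_smul_vec (cov_linear φ), genTangent_smul_cov,
      oneForm_smul (cov_mem φ), genMetric_apply]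
    have e : ((genTangent M ℓ).smul f ψ).deg = f.deg + ψ.deg := rfl
    simp only [e, neg_one_zpow_smul, mul_add, mul_smul_comm]
    push_cast
    generalize (ψ.deg : ZMod 2) = a, (φ.deg : ZMod 2) = b, (f.deg : ZMod 2) = w, (ℓ : ZMod 2) = l
    match_scalars <;> (revert a b w l; decide)

lemma genMetric_symm (ψ φ : Homog ((genTangent M ℓ).gr ⊤)) :
    pairing ℓ (genMetric M ℓ) ψ φ =
      (-1 : ℝ) ^ ((ψ.deg + ℓ) * (φ.deg + ℓ)) • pairing ℓ (genMetric M ℓ) φ ψ := by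
  rw [pairing_genMetric, pairing_genMetric]
  simp only [neg_one_zpow_smul]
  push_cast
  generalize (ψ.deg : ZMod 2) = a, (φ.deg : ZMod 2) = b, (ℓ : ZMod 2) = l
  match_scalars <;> (revert a b l; decide)

/-! ### The differential of a function and of a two-form -/

lemma dFun_apply (k : ℤ) (f : M.C ⊤) (Z : VField M) :
    dFun k f Z = (-1 : ℝ) ^ ((Z.deg - 1) * k) • Z.val f := dForm_zero_apply k f Z

lemma dFun_mem {k : ℤ} {f : M.C ⊤} (hf : f ∈ M.gr ⊤ k) : dFun k f ∈ (tangent M).dualGr ⊤ k := by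
  have e : dFun k f = fun Z : VField M => (-1 : ℝ) ^ ((Z.deg - 1) * k) • Z.val f :=
    funext fun Z => dFun_apply k f Z
  rw [e]
  refine ⟨(isGradedLinear_apply f).deg_smul fun n => (-1 : ℝ) ^ ((n - 1) * k), fun Z => ?_,
    fun g Z => ?_⟩
  · exact Submodule.smul_mem _ _ (VField.map_mem Z hf (by ring))
  · change (-1 : ℝ) ^ ((g.deg + Z.deg - 1) * k) • (g.val * Z.val f) =
      (-1 : ℝ) ^ (k * g.deg) • (g.val * ((-1 : ℝ) ^ ((Z.deg - 1) * k) • Z.val f))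
    simp only [neg_one_zpow_smul, mul_smul_comm]
    push_cast
    generalize (g.deg : ZMod 2) = a, (Z.deg : ZMod 2) = z, (k : ZMod 2) = k
    match_scalars <;> (revert a z k; decide)

/-- It suffices to treat the first slot and the two adjacent transpositions, since the
transpositions carry linearity from each slot to the next. -/
lemma isForm_three {E : PreBundle M} {k : ℤ} {ω : (Fin 3 → Homog (E.gr ⊤)) → M.C ⊤}
    (mem : ∀ Y Z W, ω ![Y, Z, W] ∈ M.gr ⊤ (k + (Y.deg + Z.deg + W.deg)))
    (linear : ∀ Z W, IsGradedLinear fun Y => ω ![Y, Z, W])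
    (smul : ∀ f Y Z W, ω ![E.smul f Y, Z, W] = (-1 : ℝ) ^ (f.deg * k) • (f.val * ω ![Y, Z, W]))
    (swap : ∀ Y Z W, ω ![Y, Z, W] = -((-1 : ℝ) ^ (Y.deg * Z.deg) • ω ![Z, Y, W]))
    (swap' : ∀ Y Z W, ω ![Y, Z, W] = -((-1 : ℝ) ^ (Z.deg * W.deg) • ω ![Y, W, Z])) :
    IsForm E 3 k ω := by
  have l2 : ∀ Y W, IsGradedLinear fun Z => ω ![Y, Z, W] := fun Y W => by
    have e : (fun Z => ω ![Y, Z, W]) = fun Z => -((-1 : ℝ) ^ (Y.deg * Z.deg) • ω ![Z, Y, W]) :=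
      funext fun Z => swap Y Z W
    rw [e]
    exact ((linear Y W).deg_smul fun n => (-1 : ℝ) ^ (Y.deg * n)).neg
  have l3 : ∀ Y Z, IsGradedLinear fun W => ω ![Y, Z, W] := fun Y Z => by
    have e : (fun W => ω ![Y, Z, W]) = fun W => -((-1 : ℝ) ^ (Z.deg * W.deg) • ω ![Y, W, Z]) :=
      funext fun W => swap' Y Z W
    rw [e]
    exact ((l2 Y Z).deg_smul fun n => (-1 : ℝ) ^ (Z.deg * n)).neg
  refine ⟨fun x => ?_, fun x i => ?_, fun f x i hi => ?_, fun x i j hij => ?_⟩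
  · rw [fun_fin_three_eq x, Fin.sum_univ_three]
    exact mem _ _ _
  · have e : ∀ y, Function.update x 0 y = ![y, x 1, x 2] ∧ Function.update x 1 y = ![x 0, y, x 2] ∧
        Function.update x 2 y = ![x 0, x 1, y] := fun y => by
      refine ⟨?_, ?_, ?_⟩ <;> (funext j; fin_cases j <;> rfl)
    fin_cases i
    · simpa only [Fin.zero_eta, (e _).1] using linear (x 1) (x 2)
    · simpa only [Fin.mk_one, (e _).2.1] using l2 (x 0) (x 2)
    · simpa only [Fin.reduceFinMk, (e _).2.2] using l3 (x 0) (x 1)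
  · obtain rfl : i = 0 := Fin.ext hi
    have e : Function.update x 0 (E.smul f (x 0)) = ![E.smul f (x 0), x 1, x 2] := by
      funext j; fin_cases j <;> rfl
    rw [e, smul, ← fun_fin_three_eq x]
  · have e : x ∘ Equiv.swap 0 1 = ![x 1, x 0, x 2] ∧ x ∘ Equiv.swap 1 2 = ![x 0, x 2, x 1] := by
      refine ⟨?_, ?_⟩ <;> (funext j; fin_cases j <;> rfl)
    fin_cases i <;> fin_cases j <;> simp at hij
    · have := swap (x 0) (x 1) (x 2)
      rwa [← fun_fin_three_eq x, ← e.1] at this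
    · have := swap' (x 0) (x 1) (x 2)
      rwa [← fun_fin_three_eq x, ← e.2] at this

/-- With a coefficient in the first argument, the derivatives of that coefficient along `Z` and `W`
cancel against those from the commutators in which the scaled field occurs. -/
lemma IsForm.dForm_two {k : ℤ} {ω : FormFun M 2} (hω : IsForm (tangent M) 2 k ω) :
    IsForm (tangent M) 3 k (dForm k ω) := by
  have hm : ∀ (Y Z : VField M) {n : ℤ}, n = k + (Y.deg + Z.deg) → ω ![Y, Z] ∈ M.gr ⊤ n := by
    rintro Y Z n rfl
    simpa [Fin.sum_univ_two] using hω.mem ![Y, Z]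
  refine isForm_three (fun Y Z W => ?_) (fun Z W => ?_) (fun f Y Z W => ?_) (fun Y Z W => ?_)
    (fun Y Z W => ?_)
  · rw [dForm_two_apply]
    refine Submodule.sub_mem _ (Submodule.add_mem _ (Submodule.sub_mem _ (Submodule.add_mem _
      (Submodule.sub_mem _ ?_ ?_) ?_) ?_) ?_) ?_ <;> refine Submodule.smul_mem _ _ ?_
    · exact VField.map_mem Y (hm Z W rfl) (by ring)
    · exact VField.map_mem Z (hm Y W rfl) (by ring)
    · exact VField.map_mem W (hm Y Z rfl) (by ring)
    · exact hm _ _ (by simp only [lie_deg, add_assoc])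
    · exact hm _ _ (by simp only [lie_deg]; ring)
    · exact hm _ _ (by simp only [lie_deg]; ring)
  · simp only [dForm_two_apply]
    refine ((((((isGradedLinear_apply _).deg_smul fun n => (-1 : ℝ) ^ ((n - 1) * k)).sub
      (((hω.linear_two_fst W).linear_comp _).deg_smul
        fun n => (-1 : ℝ) ^ ((Z.deg - 1) * k + Z.deg * n))).add
      (((hω.linear_two_fst Z).linear_comp _).deg_smul
        fun n => (-1 : ℝ) ^ ((W.deg - 1) * k + W.deg * (n + Z.deg)))).sub
      (((hω.linear_two_fst W).comp_lie_left Z).deg_smul fun _ => (-1 : ℝ) ^ k)).add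
      (((hω.linear_two_fst Z).comp_lie_left W).deg_smul
        fun _ => (-1 : ℝ) ^ (k + W.deg * Z.deg))).sub
      ((hω.linear_two_snd _).deg_smul fun n => (-1 : ℝ) ^ (k + Z.deg * n + W.deg * n))
  · change dForm k ω ![VField.smul f Y, Z, W] = _
    have s1 : ∀ (f : Homog (M.gr ⊤)) (Y Z : VField M), ω ![VField.smul f Y, Z] =
      (-1 : ℝ) ^ (f.deg * k) • (f.val * ω ![Y, Z]) := hω.smul_two_fst
    have s2 : ∀ (f : Homog (M.gr ⊤)) (Y Z : VField M), ω ![Y, VField.smul f Z] =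
      (-1 : ℝ) ^ (f.deg * (k + Y.deg)) • (f.val * ω ![Y, Z]) := hω.smul_two_snd
    rw [dForm_two_apply, dForm_two_apply, (hω.linear_two_fst W).map_smul_lie,
      (hω.linear_two_fst Z).map_smul_lie]
    simp only [s1, s2, map_smul, VField.map_mul, VField.smul_val_apply]
    simp only [neg_one_zpow_smul, VField.act_deg, VField.act_val, VField.smul_deg, lie_deg,
      mul_add, mul_sub, mul_smul_comm]
    push_cast
    generalize (Y.deg : ZMod 2) = y, (f.deg : ZMod 2) = a, (k : ZMod 2) = k, (Z.deg : ZMod 2) = z,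
      (W.deg : ZMod 2) = w
    match_scalars <;> (revert y a k z w; decide)
  · rw [dForm_two_apply, dForm_two_apply, hω.swap_two Y Z, (hω.linear_two_fst W).map_lie_swap Y Z,
      map_neg, map_smul]
    simp only [neg_one_zpow_smul]
    push_cast
    generalize (Y.deg : ZMod 2) = y, (k : ZMod 2) = k, (Z.deg : ZMod 2) = z, (W.deg : ZMod 2) = w
    match_scalars <;> (revert y k z w; decide)
  · rw [dForm_two_apply, dForm_two_apply, hω.swap_two Z W, (hω.linear_two_fst Y).map_lie_swap Z W,
      map_neg, map_smul]
    simp only [neg_one_zpow_smul]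
    push_cast
    generalize (Y.deg : ZMod 2) = y, (k : ZMod 2) = k, (Z.deg : ZMod 2) = z, (W.deg : ZMod 2) = w
    match_scalars <;> (revert y k z w; decide)

/-! ### The twist by a two-form -/

lemma IsForm.add {E : PreBundle M} {p : ℕ} {k : ℤ} {ω ω' : (Fin p → Homog (E.gr ⊤)) → M.C ⊤}
    (h : IsForm E p k ω) (h' : IsForm E p k ω') : IsForm E p k (ω + ω') where
  mem x := Submodule.add_mem _ (h.mem x) (h'.mem x)
  linear x i := (h.linear x i).add (h'.linear x i)
  smul_first f x i hi := by
    simp only [Pi.add_apply, h.smul_first f x i hi, h'.smul_first f x i hi, mul_add, smul_add]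
  skew x i j hij := by
    rw [Pi.add_apply, h.skew x i j hij, h'.skew x i j hij, Pi.add_apply, smul_add, neg_add]

lemma IsForm.neg {E : PreBundle M} {p : ℕ} {k : ℤ} {ω : (Fin p → Homog (E.gr ⊤)) → M.C ⊤}
    (h : IsForm E p k ω) : IsForm E p k (-ω) where
  mem x := Submodule.neg_mem _ (h.mem x)
  linear x i := (h.linear x i).neg
  smul_first f x i hi := by
    simp only [Pi.neg_apply, h.smul_first f x i hi, mul_neg, smul_neg]
  skew x i j hij := by
    rw [Pi.neg_apply, h.skew x i j hij, Pi.neg_apply, smul_neg]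

section ExpForm

variable {ω : FormFun M 2}

lemma expForm_mem (hω : IsForm (tangent M) 2 (-ℓ) ω)
    (ψ : Homog ((genTangent M ℓ).gr ⊤)) :
    expForm ℓ ω ψ ∈ (genTangent M ℓ).gr ⊤ ψ.deg :=
  ⟨(vec ψ).mem, Submodule.add_mem _ (cov_mem ψ) (hω.snd_mem_dualGr (vec ψ) (by simp))⟩

lemma vec_expForm (ψ : Homog ((genTangent M ℓ).gr ⊤))
    (h : expForm ℓ ω ψ ∈ (genTangent M ℓ).gr ⊤ ψ.deg) :
    vec (⟨_, expForm ℓ ω ψ, h⟩ : Homog ((genTangent M ℓ).gr ⊤)) = vec ψ := rfl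

lemma cov_expForm (ψ : Homog ((genTangent M ℓ).gr ⊤))
    (h : expForm ℓ ω ψ ∈ (genTangent M ℓ).gr ⊤ ψ.deg) (Z : VField M) :
    cov (⟨_, expForm ℓ ω ψ, h⟩ : Homog ((genTangent M ℓ).gr ⊤)) Z = cov ψ Z + ω ![vec ψ, Z] := rfl

lemma expForm_isBundleMap (hω : IsForm (tangent M) 2 (-ℓ) ω) :
    (genTangent M ℓ).IsBundleMap (genTangent M ℓ) 0 (expForm ℓ ω) where
  linear := IsGradedLinear.prodMk (F := fun ψ => (vec ψ).val) isGradedLinear_val.comp_vec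
    (isGradedLinear_pi fun Z => (isGradedLinear_cov Z).add (hω.linear_two_fst Z).comp_vec)
  mem ψ := by
    have := expForm_mem hω ψ
    rwa [add_zero]
  map_act f ψ := by
    rw [mul_zero, zpow_zero, one_smul]
    refine Prod.ext rfl (funext fun Z => ?_)
    change cov ((genTangent M ℓ).smul f ψ) Z + ω ![vec ((genTangent M ℓ).smul f ψ), Z] =
      f.val * (cov ψ Z + ω ![vec ψ, Z])
    have s1 : ω ![VField.smul f (vec ψ), Z] = (-1 : ℝ) ^ (f.deg * -ℓ) • (f.val * ω ![vec ψ, Z]) :=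
      hω.smul_two_fst f (vec ψ) Z
    -- The sign of the shifted action cancels the sign of moving the coefficient past `ω`, because
    -- `ω` has degree -ℓ.
    rw [genTangent_smul_vec (hω.linear_two_fst Z), genTangent_smul_cov, s1, smul_smul,
      ← zpow_add₀ (by norm_num), mul_neg, add_neg_cancel, zpow_zero, one_smul, mul_add]

lemma expForm_neg_expForm (ω : FormFun M 2) (ψ : Homog ((genTangent M ℓ).gr ⊤))
    (h : expForm ℓ ω ψ ∈ (genTangent M ℓ).gr ⊤ ψ.deg) :
    expForm ℓ (-ω) ⟨ψ.deg, expForm ℓ ω ψ, h⟩ = ψ.val := by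
  refine Prod.ext rfl (funext fun Z => ?_)
  change cov ψ Z + ω ![vec ψ, Z] + -ω ![vec ψ, Z] = cov ψ Z
  rw [add_neg_cancel_right]

lemma expForm_isBundleAutomorphism (hω : IsForm (tangent M) 2 (-ℓ) ω) :
    IsBundleAutomorphism (genTangent M ℓ) (expForm ℓ ω) (expForm ℓ (-ω)) where
  isBundleMap := expForm_isBundleMap hω
  isBundleMap_inv := expForm_isBundleMap hω.neg
  left_inv := expForm_neg_expForm ω
  right_inv ψ h := by
    have := expForm_neg_expForm (-ω) ψ h
    rwa [neg_neg] at this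

/-- The section `e^ω(ψ)` as a homogeneous section. -/
noncomputable def expFormHom (hω : IsForm (tangent M) 2 (-ℓ) ω)
    (ψ : Homog ((genTangent M ℓ).gr ⊤)) : Homog ((genTangent M ℓ).gr ⊤) :=
  ⟨ψ.deg, expForm ℓ ω ψ, expForm_mem hω ψ⟩

/-- The vector parts agree. In the form part the `ω`-terms of the right side are those of its
differential on `vec ψ`, `vec φ`, `Z`, apart from the term with their commutator in front; on the
left that term is compensated by `ω` applied to the vector part of the bracket. -/
lemma expForm_intertwines (hω : IsForm (tangent M) 2 (-ℓ) ω) {H : FormFun M 3} (hH : IsForm (tangent M) 3 (-ℓ) H) :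
    Intertwines (genTangent M ℓ) ℓ (expForm ℓ ω) (dorfman ℓ (H + dForm (-ℓ) ω)) (dorfman ℓ H) where
  mem := expForm_mem hω
  bracket_mem := dorfman_mem (hH.add hω.dForm_two)
  map_bracket ψ φ := by
    refine Prod.ext rfl (funext fun Z => ?_)
    change (dorfman ℓ (H + dForm (-ℓ) ω) ψ φ).2 Z
      + ω ![vec (⟨_, dorfman ℓ (H + dForm (-ℓ) ω) ψ φ, _⟩ : Homog ((genTangent M ℓ).gr ⊤)), Z] =
      (dorfman ℓ H (expFormHom hω ψ) (expFormHom hω φ)).2 Z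
    have hd : ∀ ψ, (expFormHom hω ψ).deg = ψ.deg := fun _ => rfl
    have hv : ∀ ψ, vec (expFormHom hω ψ) = vec ψ := fun _ => rfl
    have hc : ∀ ψ Z, cov (expFormHom hω ψ) Z = cov ψ Z + ω ![vec ψ, Z] := fun _ _ => rfl
    rw [vec_dorfman, dorfman_snd_apply, dorfman_snd_apply]
    simp only [hd, hv, hc, Pi.add_apply, dForm_two_apply, map_add]
    -- The bracket produces commutators in the second slot of `ω`, the differential in the first.
    rw [hω.swap_two (vec φ) (lie (vec ψ) Z), hω.swap_two (vec ψ) (lie (vec φ) Z)]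
    simp only [neg_one_zpow_smul, lie_deg, vec_deg]
    push_cast
    generalize (ψ.deg : ZMod 2) = a, (φ.deg : ZMod 2) = b, (Z.deg : ZMod 2) = z, (ℓ : ZMod 2) = l
    match_scalars <;> (revert a b z l; decide)

lemma pairing_expForm (hω : IsForm (tangent M) 2 (-ℓ) ω)
    (ψ φ : Homog ((genTangent M ℓ).gr ⊤))
    (hψ : expForm ℓ ω ψ ∈ (genTangent M ℓ).gr ⊤ ψ.deg)
    (hφ : expForm ℓ ω φ ∈ (genTangent M ℓ).gr ⊤ φ.deg) :
    pairing ℓ (genMetric M ℓ) ⟨_, expForm ℓ ω ψ, hψ⟩ ⟨_, expForm ℓ ω φ, hφ⟩ =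
      pairing ℓ (genMetric M ℓ) ψ φ := by
  rw [pairing_genMetric, pairing_genMetric, vec_expForm, vec_expForm, cov_expForm, cov_expForm,
    hω.swap_two (vec ψ) (vec φ)]
  simp only [neg_one_zpow_smul, vec_deg]
  push_cast
  generalize (ψ.deg : ZMod 2) = a, (φ.deg : ZMod 2) = b, (ℓ : ZMod 2) = l
  match_scalars <;> (revert a b l; decide)

end ExpForm

end GradedGeometry

namespace GradedGeometry

variable {X : Type u} [TopologicalSpace X] [T2Space X] [SecondCountableTopology X]
  {M : GradedManifold.{u, v} X}

/-! ### Sheaves of graded modules -/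

namespace PreBundle

/-- Sheaves of graded modules over the functions on `M`. -/
structure IsModuleSheaf (E : PreBundle M) : Prop where
  act_linear : ∀ U, IsGradedLinear (E.act U)
  one_act : ∀ U k (h : (1 : M.C U) ∈ M.gr U 0), ∀ ψ ∈ E.gr U k, E.act U ⟨0, 1, h⟩ ψ = ψ
  mul_act : ∀ U (f g : Homog (M.gr U)) (h : f.val * g.val ∈ M.gr U (f.deg + g.deg)) k,
    ∀ ψ ∈ E.gr U k, E.act U ⟨f.deg + g.deg, f.val * g.val, h⟩ ψ = E.act U f (E.act U g ψ)
  res_add : ∀ {U V : Opens X} (h : V ≤ U) (k : ℤ) (ψ φ : E.gr U k),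
    E.res h (ψ + φ) = E.res h ψ + E.res h φ
  res_smul : ∀ {U V : Opens X} (h : V ≤ U) (k : ℤ) (c : ℝ) (ψ : E.gr U k),
    E.res h (c • ψ) = c • E.res h ψ
  res_act : ∀ {U V : Opens X} (h : V ≤ U) (f : Homog (M.gr U)) (ψ : Homog (E.gr U)),
    E.resSec h (E.smul f ψ) = E.smul (resFun M h f) (E.resSec h ψ)
  res_self : ∀ (U : Opens X) (k : ℤ) (ψ : E.gr U k), E.res (le_refl U) ψ = ψ
  res_res : ∀ {U V W : Opens X} (h : V ≤ U) (h' : W ≤ V) (k : ℤ) (ψ : E.gr U k),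
    E.res h' (E.res h ψ) = E.res (h'.trans h) ψ
  glue : ∀ {ι : Type u} (U : ι → Opens X) (k : ℤ) (ψ : ∀ i, E.gr (U i) k),
    (∀ i j, E.res (inf_le_left : U i ⊓ U j ≤ U i) (ψ i) =
      E.res (inf_le_right : U i ⊓ U j ≤ U j) (ψ j)) →
    ∃! Ψ : E.gr (⨆ i, U i) k, ∀ i, E.res (le_iSup U i) Ψ = ψ i

lemma IsGradedVectorBundle.isModuleSheaf {E : PreBundle M} (h : E.IsGradedVectorBundle) :
    E.IsModuleSheaf :=
  { h with }

variable (M) in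
/-- The functions on `M` as a graded module over themselves. -/
noncomputable abbrev functions : PreBundle M where
  Sec := M.C
  gr := M.gr
  act _ f := LinearMap.mulLeft ℝ f.val
  act_mem _ f _ _ hψ := SetLike.mul_mem_graded f.mem hψ
  res h _ f := ⟨M.res h f.1, M.res_mem h _ _ f.2⟩

lemma functions_isModuleSheaf : (functions M).IsModuleSheaf where
  act_linear _ := by
    refine ⟨fun n a b _ _ => LinearMap.ext fun g => ?_, fun n c a _ => LinearMap.ext fun g => ?_⟩
    · exact add_mul a b g
    · exact smul_mul_assoc c a g
  one_act _ _ _ ψ _ := one_mul ψ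
  mul_act _ f g _ _ ψ _ := mul_assoc f.val g.val ψ
  res_add h _ ψ φ := Subtype.ext (map_add (M.res h) ψ.1 φ.1)
  res_smul h _ c ψ := Subtype.ext (map_smul (M.res h) c ψ.1)
  res_act h f ψ := Homog.ext' rfl (map_mul (M.res h) f.val ψ.val)
  res_self U _ ψ := Subtype.ext (M.res_self U ψ.1)
  res_res h h' _ ψ := Subtype.ext (M.res_res h h' ψ.1)
  glue U k ψ hψ := by
    obtain ⟨F, ⟨hF, hF'⟩, hu⟩ := M.glue U k (fun i => (ψ i).1) (fun i => (ψ i).2)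
      fun i j => congrArg Subtype.val (hψ i j)
    refine ⟨⟨F, hF⟩, fun i => Subtype.ext (hF' i), fun G hG => Subtype.ext ?_⟩
    exact hu G.1 ⟨G.2, fun i => congrArg Subtype.val (hG i)⟩

/-- The product of a homogeneous function and a homogeneous section, of prescribed degree. -/
def gmul (E : PreBundle M) {U : Opens X} {j k n : ℤ} (h : j + k = n) (f : M.gr U j)
    (ψ : E.gr U k) : E.gr U n :=
  ⟨E.act U ⟨j, f.1, f.2⟩ ψ.1, h ▸ E.act_mem U ⟨j, f.1, f.2⟩ k ψ.1 ψ.2⟩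

namespace IsModuleSheaf

variable {E : PreBundle M} (hE : E.IsModuleSheaf) {U V W : Opens X} {k : ℤ}

include hE

lemma res_zero (h : V ≤ U) : E.res h (0 : E.gr U k) = 0 := by
  have := hE.res_smul h k 0 0
  simpa using this

lemma res_neg (h : V ≤ U) (ψ : E.gr U k) : E.res h (-ψ) = -E.res h ψ := by
  have := hE.res_smul h k (-1) ψ
  simpa using this

lemma res_sub (h : V ≤ U) (ψ φ : E.gr U k) : E.res h (ψ - φ) = E.res h ψ - E.res h φ := by
  rw [sub_eq_add_neg, hE.res_add, hE.res_neg, ← sub_eq_add_neg]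

lemma res_gmul (h : V ≤ U) {j n : ℤ} (hn : j + k = n) (f : M.gr U j) (ψ : E.gr U k) :
    E.res h (E.gmul hn f ψ) = E.gmul hn ((functions M).res h f) (E.res h ψ) := by
  subst hn
  have := hE.res_act h ⟨j, f.1, f.2⟩ ⟨k, ψ.1, ψ.2⟩
  exact Subtype.ext (Homog.mk.inj this).2

/-- The sheaf axiom speaks of the supremum itself; this version serves open sets that are only
provably equal to it. -/
lemma glue_of_eq {ι : Type u} (V : ι → Opens X) (hU : U = ⨆ i, V i) (hV : ∀ i, V i ≤ U)
    (ψ : ∀ i, E.gr (V i) k)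
    (h : ∀ i j, E.res (inf_le_left : V i ⊓ V j ≤ V i) (ψ i) =
      E.res (inf_le_right : V i ⊓ V j ≤ V j) (ψ j)) :
    ∃! Ψ : E.gr U k, ∀ i, E.res (hV i) Ψ = ψ i := by
  subst hU
  exact hE.glue V k ψ h

/-- Sections that agree locally are equal. -/
lemma eq_of_locally_eq (ψ φ : E.gr U k)
    (h : ∀ x ∈ U, ∃ V : Opens X, x ∈ V ∧ ∃ hV : V ≤ U, E.res hV ψ = E.res hV φ) : ψ = φ := by
  choose V hxV hVU hV using h
  have hU : U = ⨆ x : U, V x.1 x.2 := by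
    refine le_antisymm (fun x hx => ?_) (iSup_le fun x => hVU x.1 x.2)
    exact Opens.mem_iSup.2 ⟨⟨x, hx⟩, hxV x hx⟩
  -- Both sections glue the restrictions of `ψ`, so uniqueness of gluing identifies them.
  refine (hE.glue_of_eq (fun x : U => V x.1 x.2) hU (fun x => hVU x.1 x.2)
    (fun x => E.res (hVU x.1 x.2) ψ) fun x y => ?_).unique (fun x => rfl)
    fun x => (hV x.1 x.2).symm
  rw [hE.res_res, hE.res_res]

/-- Gluing of a family of sections indexed by points. -/
lemma exists_glue_points (V : ∀ x ∈ U, Opens X) (hxV : ∀ x hx, x ∈ V x hx)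
    (hVU : ∀ x hx, V x hx ≤ U) (ψ : ∀ x hx, E.gr (V x hx) k)
    (h : ∀ x hx y hy (W : Opens X) (h₁ : W ≤ V x hx) (h₂ : W ≤ V y hy),
      E.res h₁ (ψ x hx) = E.res h₂ (ψ y hy)) :
    ∃ Ψ : E.gr U k, ∀ x hx, E.res (hVU x hx) Ψ = ψ x hx := by
  have hU : U = ⨆ x : U, V x.1 x.2 := by
    refine le_antisymm (fun x hx => ?_) (iSup_le fun x => hVU x.1 x.2)
    exact Opens.mem_iSup.2 ⟨⟨x, hx⟩, hxV x hx⟩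
  obtain ⟨Ψ, hΨ, -⟩ := hE.glue_of_eq (fun x : U => V x.1 x.2) hU (fun x => hVU x.1 x.2)
    (fun x => ψ x.1 x.2) fun x y => h _ _ _ _ _ _ _
  exact ⟨Ψ, fun x hx => hΨ ⟨x, hx⟩⟩

/-- Gluing of two sections. -/
lemma exists_glue_two {V₁ V₂ : Opens X} (h₁ : V₁ ≤ U) (h₂ : V₂ ≤ U) (hU : U ≤ V₁ ⊔ V₂)
    (ψ₁ : E.gr V₁ k) (ψ₂ : E.gr V₂ k)
    (h : E.res (inf_le_left : V₁ ⊓ V₂ ≤ V₁) ψ₁ = E.res (inf_le_right : V₁ ⊓ V₂ ≤ V₂) ψ₂) :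
    ∃ Ψ : E.gr U k, E.res h₁ Ψ = ψ₁ ∧ E.res h₂ Ψ = ψ₂ := by
  have hc : ∀ (W : Opens X) (a : W ≤ V₁) (b : W ≤ V₂), E.res a ψ₁ = E.res b ψ₂ := fun W a b => by
    rw [← hE.res_res inf_le_left (le_inf a b), h, hE.res_res]
  obtain ⟨Ψ, hΨ, -⟩ := hE.glue_of_eq (U := U) (k := k)
    -- The sheaf axiom indexes covers in universe `u`, hence the lifted two-element type.
    (fun b : ULift.{u} Bool => Bool.rec V₂ V₁ b.down)
    (le_antisymm (hU.trans (sup_le (le_iSup_of_le ⟨true⟩ le_rfl) (le_iSup_of_le ⟨false⟩ le_rfl)))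
      (iSup_le (by rintro ⟨_ | _⟩ <;> assumption)))
    (by rintro ⟨_ | _⟩ <;> assumption)
    (fun b => match b with | ⟨true⟩ => ψ₁ | ⟨false⟩ => ψ₂) (by
      rintro ⟨_ | _⟩ ⟨_ | _⟩
      · rfl
      · exact (hc _ _ _).symm
      · exact hc _ _ _
      · rfl)
  exact ⟨Ψ, hΨ ⟨true⟩, hΨ ⟨false⟩⟩

end IsModuleSheaf

end PreBundle

end GradedGeometry

namespace GradedGeometry

variable {X : Type u} [TopologicalSpace X] [T2Space X] [SecondCountableTopology X]
  {M : GradedManifold.{u, v} X}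

/-! ### Bump functions -/

namespace GDim

variable {n : GDim}

/-- The restriction to `W` of a function that is smooth on `W`. -/
def smoothOfContDiffOn {W : Opens n.Base} (f : n.Base → ℝ)
    (hf : ContDiffOn ℝ ((⊤ : ℕ∞) : WithTop ℕ∞) f W) : n.Smooth W :=
  ⟨fun x => f x, fun x => contMDiffAt_subtype_iff.2
    (hf.contDiffAt (W.isOpen.mem_nhds x.2)).contMDiffAt⟩

@[simp] lemma smoothOfContDiffOn_apply {W : Opens n.Base} (f : n.Base → ℝ)
    (hf : ContDiffOn ℝ ((⊤ : ℕ∞) : WithTop ℕ∞) f W) (x : W) : smoothOfContDiffOn f hf x = f x := rfl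

/-- The power series with a single term `f ξ^p`. -/
noncomputable def monomial {W : Opens n.Base} (p : Fin n.s → ℕ) (f : n.Smooth W) : n.Series W :=
  fun q => if q = p then f else 0

lemma monomial_isHomogeneous {W : Opens n.Base} {p : Fin n.s → ℕ} (hp : n.Admissible p)
    (f : n.Smooth W) {k : ℤ} (hk : n.weight p = k) : n.IsHomogeneous k (monomial p f) := by
  intro q hq
  by_cases h : q = p
  · subst h; exact ⟨hp, hk⟩
  · exact absurd (if_neg h) hq

lemma admissible_zero : n.Admissible 0 := fun _ _ => Nat.zero_le _

lemma weight_zero : n.weight 0 = 0 := by simp [weight]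

end GDim

namespace GradedChart

variable {O : GradedAlgebraSheaf.{u, v} X} {n : GDim} (c : GradedChart O n)

lemma coord_injOn {W : Opens n.Base} (hW : (W : Set n.Base) ⊆ c.homeo.target) {k : ℤ}
    {f g : O.C (chartPreimage c.homeo W)} (hf : f ∈ O.gr _ k) (hg : g ∈ O.gr _ k)
    (h : c.coord W hW f = c.coord W hW g) : f = g :=
  (c.bijOn W hW k).injOn hf hg h

lemma exists_coord_eq {W : Opens n.Base} (hW : (W : Set n.Base) ⊆ c.homeo.target) {k : ℤ}
    {s : n.Series W} (hs : n.IsHomogeneous k s) : ∃ f ∈ O.gr _ k, c.coord W hW f = s := by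
  obtain ⟨f, hf, h⟩ := (c.bijOn W hW k).surjOn hs
  exact ⟨f, hf, h⟩

end GradedChart

/-- Bump functions: in every neighbourhood `U` of `x` there is a function that is `1` near `x` and
vanishes on an open set `W` covering the complement of `U`. -/
lemma exists_bump (M : GradedManifold.{u, v} X) (U : Opens X) {x : X} (hx : x ∈ U) :
    ∃ χ : M.gr ⊤ 0, ∃ V W : Opens X, x ∈ V ∧ V ≤ U ∧ ⊤ ≤ U ⊔ W ∧
      M.res (le_top : V ≤ ⊤) χ.1 = 1 ∧ M.res (le_top : W ≤ ⊤) χ.1 = 0 := by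
  obtain ⟨c, hc⟩ := M.exists_chart x
  let e := c.homeo
  have hT : e.target ∩ e.symm ⁻¹' U ∈ nhds (e x) :=
    (e.symm.isOpen_inter_preimage U.isOpen).mem_nhds
      ⟨e.map_source hc, by rw [Set.mem_preimage, e.left_inv hc]; exact hx⟩
  obtain ⟨r, hr, hrT⟩ := Metric.nhds_basis_ball.mem_iff.1 hT
  -- The bump is 1 on the ball `B'` of radius r/3 and vanishes at distance at least r/2, which
  -- leaves inside `B` the collar `B''` on which it is zero.
  let b : ContDiffBump (e x) := ⟨r / 3, r / 2, by positivity, by linarith⟩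
  let B : Opens M.dim.Base := ⟨Metric.ball (e x) r, Metric.isOpen_ball⟩
  let B' : Opens M.dim.Base := ⟨Metric.ball (e x) (r / 3), Metric.isOpen_ball⟩
  let B'' : Opens M.dim.Base := B ⊓ ⟨(Metric.closedBall (e x) (r / 2))ᶜ, Metric.isClosed_closedBall.isOpen_compl⟩
  have hB : (B : Set M.dim.Base) ⊆ c.homeo.target := fun y hy => (hrT hy).1
  have hB'B : B' ≤ B := Metric.ball_subset_ball (by linarith)
  have hB''B : B'' ≤ B := inf_le_left
  have hB'' : (B'' : Set M.dim.Base) ⊆ c.homeo.target := fun y hy => hB (hB''B hy)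
  have hB' : (B' : Set M.dim.Base) ⊆ c.homeo.target := fun y hy => hB (hB'B hy)
  -- The closed ball is compact, and a compact subset of a Hausdorff space is closed; its complement
  -- `W` is where the zero function will be glued on.
  have hK : IsClosed (e.symm '' Metric.closedBall (e x) (r / 2)) := by
    refine ((isCompact_closedBall _ _).image_of_continuousOn (e.symm.continuousOn.mono ?_)).isClosed
    exact fun y hy => hB (Metric.closedBall_subset_ball (by linarith) hy)
  let W : Opens X := ⟨(e.symm '' Metric.closedBall (e x) (r / 2))ᶜ, hK.isOpen_compl⟩
  have hBU : chartPreimage e B ≤ U := fun y hy => by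
    have := (hrT hy.2).2
    rwa [Set.mem_preimage, e.left_inv hy.1] at this
  have hcov : ⊤ ≤ chartPreimage e B ⊔ W := fun y _ => by
    by_cases hy : y ∈ e.symm '' Metric.closedBall (e x) (r / 2)
    · obtain ⟨z, hz, rfl⟩ := hy
      have hzB : z ∈ B := Metric.closedBall_subset_ball (by linarith) hz
      refine Or.inl ⟨e.map_target (hB hzB), ?_⟩
      rw [Set.mem_preimage, e.right_inv (hB hzB)]
      exact hzB
    · exact Or.inr hy
  have hsm : ContDiffOn ℝ ((⊤ : ℕ∞) : WithTop ℕ∞) b B := b.contDiff.contDiffOn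
  obtain ⟨χ, hχ, hχc⟩ := c.exists_coord_eq hB
    (GDim.monomial_isHomogeneous GDim.admissible_zero (GDim.smoothOfContDiffOn b hsm) GDim.weight_zero)
  -- The overlap lies over the collar, so the chart function and zero agree there and can be glued.
  have hinf : chartPreimage e B ⊓ W ≤ chartPreimage e B'' := fun y hy => by
    refine ⟨hy.1.1, hy.1.2, fun hy' => hy.2 ⟨e y, hy', e.left_inv hy.1.1⟩⟩
  have h0 : M.res (chartPreimage_mono c.homeo hB''B) χ = 0 := by
    refine c.coord_injOn hB'' (M.res_mem _ _ _ hχ) (Submodule.zero_mem _) ?_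
    rw [map_zero]
    funext p
    ext y
    rw [c.map_res B hB B'' hB'' hB''B, hχc]
    by_cases hp : p = 0
    · subst hp
      simp only [GDim.monomial, if_true, GDim.smoothOfContDiffOn_apply]
      exact b.zero_of_le_dist (not_le.1 (fun h => y.2.2 (Metric.mem_closedBall.2 h))).le
    · simp only [GDim.monomial, if_neg hp]; rfl
  have h1 : M.res (chartPreimage_mono c.homeo hB'B) χ = 1 := by
    refine c.coord_injOn hB' (M.res_mem _ _ _ hχ)
      (SetLike.GradedOne.one_mem) ?_
    rw [c.map_one]
    funext p
    ext y
    rw [c.map_res B hB B' hB' hB'B, hχc]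
    by_cases hp : p = 0
    · subst hp
      simp only [GDim.monomial, GDim.one, if_true, GDim.smoothOfContDiffOn_apply]
      exact b.one_of_mem_closedBall (Metric.ball_subset_closedBall y.2)
    · simp only [GDim.monomial, GDim.one, if_neg hp]; rfl
  obtain ⟨Ψ, hΨ, hΨ'⟩ := PreBundle.functions_isModuleSheaf.exists_glue_two (M := M) (U := ⊤) le_top le_top
    hcov ⟨χ, hχ⟩ (0 : M.gr W 0) (by
      refine Subtype.ext ?_
      change M.res _ χ = M.res _ 0
      rw [map_zero, ← M.res_res (chartPreimage_mono c.homeo hB''B) hinf, h0, map_zero])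
  have hΨ : M.res le_top Ψ.1 = χ := congrArg Subtype.val hΨ
  have hΨ' : M.res le_top Ψ.1 = 0 := congrArg Subtype.val hΨ'
  refine ⟨Ψ, chartPreimage e B', W, ⟨hc, Metric.mem_ball_self (by positivity)⟩,
    (chartPreimage_mono c.homeo hB'B).trans hBU, hcov.trans (sup_le_sup_right hBU W), ?_, hΨ'⟩
  rw [← M.res_res le_top (chartPreimage_mono c.homeo hB'B), hΨ, h1]

/-! ### Extension of germs of sections -/

namespace PreBundle.IsModuleSheaf

variable {E : PreBundle M} (hE : E.IsModuleSheaf) {U V W : Opens X} {k : ℤ}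

include hE

omit hE in
lemma gmul_zero {j n : ℤ} (hn : j + k = n) (f : M.gr U j) : E.gmul hn f (0 : E.gr U k) = 0 :=
  Subtype.ext (map_zero (E.act U ⟨j, f.1, f.2⟩))

lemma zero_gmul {j n : ℤ} (hn : j + k = n) (ψ : E.gr U k) : E.gmul hn (0 : M.gr U j) ψ = 0 := by
  have h : E.act U ⟨j, 0, Submodule.zero_mem _⟩ = 0 := (hE.act_linear U).map_zero rfl
  exact Subtype.ext (congrArg (fun T => T ψ.1) h)

lemma one_gmul {n : ℤ} (hn : 0 + k = n) (f : M.gr U 0) (hf : f.1 = 1) (ψ : E.gr U k) :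
    (E.gmul hn f ψ).1 = ψ.1 := by
  obtain ⟨f, hf'⟩ := f
  subst hf
  exact hE.one_act U k hf' ψ.1 ψ.2

/-- Every section over `V` extends to a larger open set `U` after shrinking `V` around a point. -/
lemma exists_extension (hVU : V ≤ U) {x : X} (hx : x ∈ V) (ψ : E.gr V k) :
    ∃ V' : Opens X, x ∈ V' ∧ ∃ h : V' ≤ V, ∃ Ψ : E.gr U k,
      E.res (h.trans hVU) Ψ = E.res h ψ := by
  obtain ⟨χ, V', W, hxV', hV'V, hcov, h1, h0⟩ := exists_bump M V hx
  -- The section is multiplied by the bump function and continued by zero; near `x` the bump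
  -- function is 1, so nothing changes there.
  obtain ⟨Ψ, hΨ, -⟩ := hE.exists_glue_two (U := U) (V₁ := V) (V₂ := U ⊓ W) hVU inf_le_left
    (fun y hy => (hcov (Opens.mem_top y)).imp id fun hyW => ⟨hy, hyW⟩)
    (E.gmul (zero_add k) ((functions M).res le_top χ) ψ) 0 (by
      rw [hE.res_gmul, hE.res_zero]
      have e : (functions M).res (inf_le_left : V ⊓ (U ⊓ W) ≤ V)
          ((functions M).res (le_top : V ≤ ⊤) χ) = 0 := by
        refine Subtype.ext ?_
        change M.res _ (M.res _ χ.1) = 0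
        rw [M.res_res, ← M.res_res (le_top : W ≤ ⊤) (inf_le_right.trans inf_le_right), h0, map_zero]
      rw [e, hE.zero_gmul])
  refine ⟨V', hxV', hV'V, Ψ, ?_⟩
  rw [← hE.res_res hVU hV'V, hΨ, hE.res_gmul]
  refine Subtype.ext (hE.one_gmul _ _ ?_ _)
  change M.res _ (M.res _ χ.1) = 1
  rw [M.res_res, h1]

end PreBundle.IsModuleSheaf

end GradedGeometry

/-! ### Linear maps from their homogeneous components, and restriction of local operators. -/

namespace GradedGeometry

/-- A homogeneous element of degree `k`. -/
def Homog.of {V : Type*} [AddCommGroup V] [Module ℝ V] {gr : ℤ → Submodule ℝ V} {k : ℤ}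
    (ψ : gr k) : Homog gr := ⟨k, ψ.1, ψ.2⟩

section OfLinear

variable {V W : Type*} [AddCommGroup V] [Module ℝ V] [AddCommGroup W] [Module ℝ W]
  {gr : ℤ → Submodule ℝ V} {F : Homog gr → W} {k : ℤ}

lemma IsGradedLinear.of_add (hF : IsGradedLinear F) (ψ φ : gr k) :
    F (Homog.of (ψ + φ)) = F (Homog.of ψ) + F (Homog.of φ) := hF.1 k ψ.1 φ.1 ψ.2 φ.2

lemma IsGradedLinear.of_smul (hF : IsGradedLinear F) (c : ℝ) (ψ : gr k) :
    F (Homog.of (c • ψ)) = c • F (Homog.of ψ) := hF.2 k c ψ.1 ψ.2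

lemma IsGradedLinear.of_sub (hF : IsGradedLinear F) (ψ φ : gr k) :
    F (Homog.of (ψ - φ)) = F (Homog.of ψ) - F (Homog.of φ) :=
  hF.map_sub rfl rfl rfl

end OfLinear

variable {X : Type u} [TopologicalSpace X] [T2Space X] [SecondCountableTopology X]
  {M : GradedManifold.{u, v} X}

/-- Homogeneous functions that agree locally are equal. -/
lemma function_eq_of_locally_eq {U : Opens X} {k : ℤ} {f g : M.C U} (hf : f ∈ M.gr U k)
    (hg : g ∈ M.gr U k)
    (h : ∀ x ∈ U, ∃ V : Opens X, x ∈ V ∧ ∃ hV : V ≤ U, M.res hV f = M.res hV g) : f = g := by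
  have := PreBundle.functions_isModuleSheaf.eq_of_locally_eq (M := M) (⟨f, hf⟩ : M.gr U k) ⟨g, hg⟩
    fun x hx => by
      obtain ⟨V, hxV, hV, e⟩ := h x hx
      exact ⟨V, hxV, hV, Subtype.ext e⟩
  exact congrArg Subtype.val this

/-- Linear maps on the algebra of functions are determined by homogeneous functions. -/
lemma linearMap_ext_homog {U : Opens X} {W : Type*} [AddCommGroup W] [Module ℝ W]
    {Y Z : M.C U →ₗ[ℝ] W} (h : ∀ k, ∀ f ∈ M.gr U k, Y f = Z f) : Y = Z := by
  refine LinearMap.ext fun f => ?_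
  induction f using DirectSum.Decomposition.inductionOn (M.gr U) with
  | zero => simp
  | homogeneous f => exact h _ _ f.2
  | add f g hf hg => rw [map_add, map_add, hf, hg]

/-- The functions over `U` are the direct sum of their homogeneous parts, so linear maps on the
parts assemble. -/
lemma exists_linearMap_of_homog {U : Opens X} {W : Type*} [AddCommGroup W] [Module ℝ W]
    {P : Homog (M.gr U) → W} (hP : IsGradedLinear P) :
    ∃ Y : M.C U →ₗ[ℝ] W, ∀ f, Y f.val = P f := by
  let T : ∀ k, M.gr U k →ₗ[ℝ] W := fun k =>
    { toFun := fun f => P (Homog.of f)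
      map_add' := hP.of_add
      map_smul' := hP.of_smul }
  refine ⟨DirectSum.toModule ℝ ℤ W T ∘ₗ (DirectSum.decomposeLinearEquiv (M.gr U)).toLinearMap,
    fun f => ?_⟩
  have e : DirectSum.decompose (M.gr U) f.val = DirectSum.of (fun k => M.gr U k) f.deg ⟨f.val, f.mem⟩ :=
    DirectSum.decompose_coe (M.gr U) (⟨f.val, f.mem⟩ : M.gr U f.deg)
  change DirectSum.toModule ℝ ℤ W T (DirectSum.decompose (M.gr U) f.val) = P f
  rw [e]
  exact DirectSum.toModule_lof (M := fun k => M.gr U k) (φ := T) ℝ f.deg ⟨f.val, f.mem⟩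

/-- The Leibniz rule in `gDer` allows an arbitrary second factor; additivity reduces it to
homogeneous ones. -/
lemma mem_gDer_of_homog {U : Opens X} {k : ℤ} {Y : M.C U →ₗ[ℝ] M.C U}
    (h : ∀ j, ∀ f ∈ M.gr U j, Y f ∈ M.gr U (j + k))
    (h' : ∀ i j, ∀ f ∈ M.gr U i, ∀ g ∈ M.gr U j,
      Y (f * g) = Y f * g + (-1 : ℝ) ^ (k * i) • (f * Y g)) : Y ∈ gDer M U k := by
  refine ⟨h, fun i f hf g => ?_⟩
  induction g using DirectSum.Decomposition.inductionOn (M.gr U) with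
  | zero => simp
  | homogeneous g => exact h' _ _ f hf _ g.2
  | add g g' hg hg' =>
    rw [mul_add, map_add, hg, hg', map_add, mul_add, mul_add, smul_add]
    abel

/-! ### Local operators -/

/-- Local operators of degree `d` from the sections of `E` over `U` to functions. -/
structure IsLocalOp (E : PreBundle M) (U : Opens X) (d : ℤ) (P : Homog (E.gr U) → M.C U) :
    Prop where
  linear : IsGradedLinear P
  mem : ∀ ψ, P ψ ∈ M.gr U (ψ.deg + d)
  res_eq_zero : ∀ {k : ℤ} (ψ : E.gr U k) {V : Opens X} (h : V ≤ U), E.res h ψ = 0 →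
    M.res h (P (Homog.of ψ)) = 0

namespace IsLocalOp

open PreBundle

variable {E : PreBundle M} {U V : Opens X} {d : ℤ} {P : Homog (E.gr U) → M.C U}
  {Q Q' : Homog (E.gr V) → M.C V}

/-- Locality is assumed for vanishing sections only; linearity extends it to pairs of sections by
taking differences. -/
lemma res_congr (hE : E.IsModuleSheaf) (hP : IsLocalOp E U d P) (hV : V ≤ U) {k : ℤ}
    {ψ φ : E.gr U k} (h : E.res hV ψ = E.res hV φ) :
    M.res hV (P (Homog.of ψ)) = M.res hV (P (Homog.of φ)) := by
  rw [← sub_eq_zero, ← map_sub, ← hP.linear.of_sub]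
  exact hP.res_eq_zero _ hV (by rw [hE.res_sub, h, sub_self])

/-- An operator on `V` that restricts `P` can be computed near a point through any extension of the
section to `U`. -/
lemma res_eq (hE : E.IsModuleSheaf) (hQ : IsLocalOp E V d Q) (hV : V ≤ U)
    (hPQ : ∀ ψ, Q (E.resSec hV ψ) = M.res hV (P ψ)) {V' : Opens X} (h : V' ≤ V) {k : ℤ}
    {ψ : E.gr V k} {Ψ : E.gr U k} (hψ : E.res (h.trans hV) Ψ = E.res h ψ) :
    M.res h (Q (Homog.of ψ)) = M.res (h.trans hV) (P (Homog.of Ψ)) := by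
  rw [← M.res_res hV h, ← hPQ]
  refine hQ.res_congr hE h (φ := E.res hV Ψ) ?_
  rw [hE.res_res, hψ]

/-- Near each point a section over `V` agrees with the restriction of one over `U`, so a local
operator is determined by such restrictions. -/
lemma eq_of_res_eq (hE : E.IsModuleSheaf) (hQ : IsLocalOp E V d Q) (hQ' : IsLocalOp E V d Q')
    (hV : V ≤ U) (h : ∀ ψ, Q (E.resSec hV ψ) = Q' (E.resSec hV ψ)) : Q = Q' := by
  funext ψ
  refine function_eq_of_locally_eq (hQ.mem ψ) (hQ'.mem ψ) fun x hx => ?_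
  obtain ⟨V', hxV', hV', Ψ, hΨ⟩ := hE.exists_extension hV hx (⟨ψ.val, ψ.mem⟩ : E.gr V ψ.deg)
  refine ⟨V', hxV', hV', ?_⟩
  have e : E.res hV' (⟨ψ.val, ψ.mem⟩ : E.gr V ψ.deg) = E.res hV' (E.res hV Ψ) := by
    rw [hE.res_res, hΨ]
  have e1 := hQ.res_congr hE hV' e
  have e2 := hQ'.res_congr hE hV' e
  have e3 := h (Homog.of Ψ)
  exact e1.trans ((congrArg (M.res hV') e3).trans e2.symm)

/-- The restriction of a local operator. -/
lemma exists_restriction (hE : E.IsModuleSheaf) (hP : IsLocalOp E U d P) (hV : V ≤ U) :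
    ∃ Q : Homog (E.gr V) → M.C V, IsLocalOp E V d Q ∧
      ∀ ψ, Q (E.resSec hV ψ) = M.res hV (P ψ) := by
  -- The value at `ψ` is characterized through all local extensions rather than the chosen ones;
  -- this gives independence of choices and hence linearity.
  have key : ∀ ψ : Homog (E.gr V), ∃ F ∈ M.gr V (ψ.deg + d), ∀ (V' : Opens X) (h : V' ≤ V)
      (Ψ : E.gr U ψ.deg), E.res (h.trans hV) Ψ = E.res h ⟨ψ.val, ψ.mem⟩ →
      M.res h F = M.res (h.trans hV) (P (Homog.of Ψ)) := by
    intro ψ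
    have ext := fun x hx => hE.exists_extension hV (x := x) hx (⟨ψ.val, ψ.mem⟩ : E.gr V ψ.deg)
    choose W hxW hWV Ψ hΨ using ext
    -- Two extensions coincide where both agree with `ψ`, so locality of `P` makes their images
    -- coincide there.
    have compat : ∀ (V' : Opens X) (h : V' ≤ V) (Ψ' : E.gr U ψ.deg),
        E.res (h.trans hV) Ψ' = E.res h ⟨ψ.val, ψ.mem⟩ → ∀ x hx (W' : Opens X) (h₁ : W' ≤ W x hx)
        (h₂ : W' ≤ V'), M.res ((h₁.trans (hWV x hx)).trans hV) (P (Homog.of (Ψ x hx))) =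
          M.res ((h₂.trans h).trans hV) (P (Homog.of Ψ')) := by
      intro V' h Ψ' hΨ' x hx W' h₁ h₂
      refine hP.res_congr hE _ ?_
      rw [← hE.res_res ((hWV x hx).trans hV) h₁, hΨ, hE.res_res,
        ← hE.res_res (h.trans hV) h₂, hΨ', hE.res_res]
    obtain ⟨F, hF⟩ := functions_isModuleSheaf.exists_glue_points (M := M) W hxW hWV
      (fun x hx => (⟨M.res ((hWV x hx).trans hV) (P (Homog.of (Ψ x hx))),
        M.res_mem _ _ _ (hP.mem (Homog.of (Ψ x hx)))⟩ : M.gr (W x hx) (ψ.deg + d))) (by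
      intro x hx y hy W' h₁ h₂
      refine Subtype.ext ?_
      change M.res h₁ (M.res _ _) = M.res h₂ (M.res _ _)
      rw [M.res_res, M.res_res]
      exact compat (W y hy) (hWV y hy) (Ψ y hy) (hΨ y hy) x hx W' h₁ h₂)
    refine ⟨F.1, F.2, fun V' h Ψ' hΨ' => ?_⟩
    refine function_eq_of_locally_eq (M.res_mem _ _ _ F.2)
      (M.res_mem _ _ _ (hP.mem (Homog.of Ψ')))
      fun x hx => ⟨V' ⊓ W x (h hx), ⟨hx, hxW _ _⟩, inf_le_left, ?_⟩
    have e : M.res (hWV x (h hx)) F.1 = M.res ((hWV x (h hx)).trans hV) (P (Homog.of (Ψ x (h hx)))) :=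
      congrArg Subtype.val (hF x (h hx))
    rw [M.res_res, ← M.res_res (hWV x (h hx)) inf_le_right, e, M.res_res, M.res_res]
    exact compat V' h Ψ' hΨ' x (h hx) _ inf_le_right inf_le_left
  choose Q hQ hQP using key
  refine ⟨Q, ⟨⟨fun k a b ha hb => ?_, fun k c a ha => ?_⟩, hQ, fun {k} ψ {W} hW h0 => ?_⟩,
    fun ψ => ?_⟩
  · refine function_eq_of_locally_eq (hQ _) (Submodule.add_mem _ (hQ ⟨k, a, ha⟩) (hQ ⟨k, b, hb⟩))
      fun x hx => ?_
    obtain ⟨V₁, hx₁, h₁, A, hA⟩ := hE.exists_extension hV hx (⟨a, ha⟩ : E.gr V k)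
    obtain ⟨V₂, hx₂, h₂, B, hB⟩ := hE.exists_extension hV hx (⟨b, hb⟩ : E.gr V k)
    have hA' : E.res ((inf_le_left.trans h₁).trans hV : V₁ ⊓ V₂ ≤ U) A =
        E.res (inf_le_left.trans h₁) ⟨a, ha⟩ := by
      rw [← hE.res_res (h₁.trans hV) inf_le_left, hA, hE.res_res]
    have hB' : E.res ((inf_le_left.trans h₁).trans hV : V₁ ⊓ V₂ ≤ U) B =
        E.res (inf_le_left.trans h₁) ⟨b, hb⟩ := by
      rw [← hE.res_res (h₂.trans hV) inf_le_right, hB, hE.res_res]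
    refine ⟨V₁ ⊓ V₂, ⟨hx₁, hx₂⟩, inf_le_left.trans h₁, ?_⟩
    rw [map_add, hQP ⟨k, a, ha⟩ _ _ A hA', hQP ⟨k, b, hb⟩ _ _ B hB',
      hQP ⟨k, a + b, _⟩ _ (inf_le_left.trans h₁) (A + B) ?_]
    · rw [← map_add]
      exact congrArg _ (hP.linear.of_add A B)
    · rw [hE.res_add, hA', hB', ← hE.res_add]; rfl
  · refine function_eq_of_locally_eq (hQ _) (Submodule.smul_mem _ c (hQ ⟨k, a, ha⟩))
      fun x hx => ?_
    obtain ⟨V₁, hx₁, h₁, A, hA⟩ := hE.exists_extension hV hx (⟨a, ha⟩ : E.gr V k)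
    refine ⟨V₁, hx₁, h₁, ?_⟩
    rw [map_smul, hQP ⟨k, a, ha⟩ _ _ A hA, hQP ⟨k, c • a, _⟩ _ h₁ (c • A) ?_]
    · rw [← map_smul]
      exact congrArg _ (hP.linear.of_smul c A)
    · rw [hE.res_smul, hA, ← hE.res_smul]; rfl
  · rw [hQP (Homog.of ψ) W hW 0 (by rw [hE.res_zero]; exact h0.symm)]
    rw [hP.linear.map_zero rfl, map_zero]
  -- For a section restricted from `U`, the section itself is an extension over all of `V`.
  · have := hQP (E.resSec hV ψ) V le_rfl ⟨ψ.val, ψ.mem⟩ (by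
      exact (hE.res_res hV le_rfl _ _).symm)
    rw [M.res_self] at this
    exact this

end IsLocalOp

end GradedGeometry

/-! ### Locality of derivations and dual sections; the tangent sheaf. -/

namespace GradedGeometry

variable {X : Type u} [TopologicalSpace X] [T2Space X] [SecondCountableTopology X]
  {M : GradedManifold.{u, v} X}

open PreBundle

/-- A bump function that is 1 near `x` and vanishes on an open set which together with `V` covers
the space kills every section vanishing on `V`. -/
lemma PreBundle.IsModuleSheaf.exists_bump_gmul_eq_zero {E : PreBundle M} (hE : E.IsModuleSheaf)
    {U V : Opens X} (hV : V ≤ U) {k : ℤ} {ψ : E.gr U k} (hψ : E.res hV ψ = 0) {x : X}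
    (hx : x ∈ V) : ∃ χ : M.gr U 0, ∃ V' : Opens X, x ∈ V' ∧ ∃ h : V' ≤ V,
      M.res (h.trans hV) χ.1 = 1 ∧ E.gmul (zero_add k) χ ψ = 0 := by
  obtain ⟨χ, V', W, hxV', hV'V, hcov, h1, h0⟩ := exists_bump M V hx
  refine ⟨(functions M).res le_top χ, V', hxV', hV'V, ?_, ?_⟩
  · change M.res _ (M.res _ χ.1) = 1
    rw [M.res_res, h1]
  · refine hE.eq_of_locally_eq _ _ fun y hy => ?_
    rcases hcov (Opens.mem_top y) with hyV | hyW
    · refine ⟨V, hyV, hV, ?_⟩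
      rw [hE.res_gmul, hψ, IsModuleSheaf.gmul_zero, hE.res_zero]
    · refine ⟨U ⊓ W, ⟨hy, hyW⟩, inf_le_left, ?_⟩
      have e : (functions M).res (inf_le_left : U ⊓ W ≤ U) ((functions M).res (le_top : U ≤ ⊤) χ) =
          0 := by
        refine Subtype.ext ?_
        change M.res _ (M.res _ χ.1) = 0
        rw [M.res_res, ← M.res_res (le_top : W ≤ ⊤) inf_le_right, h0, map_zero]
      rw [hE.res_gmul, e, hE.zero_gmul, hE.res_zero]

/-- If `f` vanishes on `V`, choose χ with χ = 1 near `x` and χ f = 0. Then 0 = Y(χ f) = Y(χ) f + χ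
Y(f), and near `x` the right side is Y(f). -/
lemma isLocalOp_of_gDer {U : Opens X} {k : ℤ} (Y : gDer M U k) :
    IsLocalOp (functions M) U k fun f => Y.1 f.val where
  linear := ⟨fun _ a b _ _ => map_add Y.1 a b, fun _ c a _ => map_smul Y.1 c a⟩
  mem f := Y.2.1 _ _ f.mem
  res_eq_zero {j} f {V} hV h0 := by
    refine function_eq_of_locally_eq (M.res_mem _ _ _ (Y.2.1 _ _ f.2)) (Submodule.zero_mem _)
      fun x hx => ?_
    obtain ⟨χ, V', hxV', hV', h1, hχ⟩ :=
      functions_isModuleSheaf.exists_bump_gmul_eq_zero hV h0 hx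
    refine ⟨V', hxV', hV', ?_⟩
    have e := Y.2.2 0 χ.1 χ.2 f.1
    have hχ' : χ.1 * f.1 = 0 := congrArg Subtype.val hχ
    have h0' : M.res hV f.1 = 0 := congrArg Subtype.val h0
    have h0'' : M.res (hV'.trans hV) f.1 = 0 := by rw [← M.res_res hV hV', h0', map_zero]
    rw [hχ', map_zero, mul_zero, zpow_zero, one_smul] at e
    have e' := congrArg (M.res (hV'.trans hV)) e
    rw [map_zero, map_add, map_mul, map_mul, h1, h0'', mul_zero, zero_add, one_mul] at e'
    rw [M.res_res, map_zero]
    exact e'.symm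

/-- As for derivations, with 0 = α(χ ψ) = χ α(ψ); no sign occurs because χ has degree zero. -/
lemma isLocalOp_of_dualGr {E : PreBundle M} (hE : E.IsModuleSheaf) {U : Opens X} {k : ℤ}
    (α : E.dualGr U k) : IsLocalOp E U k α.1 where
  linear := α.2.1
  mem := α.2.2.1
  res_eq_zero {j} ψ {V} hV h0 := by
    refine function_eq_of_locally_eq (M.res_mem _ _ _ (α.2.2.1 _)) (Submodule.zero_mem _)
      fun x hx => ?_
    obtain ⟨χ, V', hxV', hV', h1, hχ⟩ := hE.exists_bump_gmul_eq_zero hV h0 hx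
    refine ⟨V', hxV', hV', ?_⟩
    have e := α.2.2.2 (Homog.of χ) (Homog.of ψ)
    have hχ' : E.act U ⟨0, χ.1, χ.2⟩ ψ.1 = 0 := congrArg Subtype.val hχ
    rw [α.2.1.map_zero (show (E.smul (Homog.of χ) (Homog.of ψ)).val = 0 from hχ')] at e
    have e' := congrArg (M.res (hV'.trans hV)) e
    have hd : (Homog.of χ : Homog (M.gr U)).deg = 0 := rfl
    rw [map_zero, hd, mul_zero, zpow_zero, one_smul, map_mul] at e'
    have h1' : M.res (hV'.trans hV) (Homog.of χ : Homog (M.gr U)).val = 1 := h1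
    rw [h1', one_mul] at e'
    rw [M.res_res, map_zero]
    exact e'.symm

/-- Gluing of operators with values in functions. -/
lemma exists_glue_operators {E : PreBundle M} (hE : E.IsModuleSheaf) {ι : Type u}
    (U : ι → Opens X) {d : ℤ} (P : ∀ i, Homog (E.gr (U i)) → M.C (U i))
    (hP : ∀ i, IsGradedLinear (P i)) (hm : ∀ i ψ, P i ψ ∈ M.gr (U i) (ψ.deg + d))
    (h : ∀ i j (ψ : Homog (E.gr (⨆ i, U i))),
      M.res (inf_le_left : U i ⊓ U j ≤ U i) (P i (E.resSec (le_iSup U i) ψ)) =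
        M.res (inf_le_right : U i ⊓ U j ≤ U j) (P j (E.resSec (le_iSup U j) ψ))) :
    ∃ Q : Homog (E.gr (⨆ i, U i)) → M.C (⨆ i, U i), IsGradedLinear Q ∧
      (∀ ψ, Q ψ ∈ M.gr _ (ψ.deg + d)) ∧
      ∀ i ψ, M.res (le_iSup U i) (Q ψ) = P i (E.resSec (le_iSup U i) ψ) := by
  have key := fun ψ : Homog (E.gr (⨆ i, U i)) => (M.glue U (ψ.deg + d)
    (fun i => P i (E.resSec (le_iSup U i) ψ)) (fun i => hm i (E.resSec (le_iSup U i) ψ)) fun i j => h i j ψ).exists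
  choose Q hQ hQP using key
  have sep : ∀ {k : ℤ} {F G : M.C (⨆ i, U i)}, F ∈ M.gr _ k → G ∈ M.gr _ k →
      (∀ i, M.res (le_iSup U i) F = M.res (le_iSup U i) G) → F = G := fun hF hG h =>
    function_eq_of_locally_eq hF hG fun x hx => by
      obtain ⟨i, hi⟩ := Opens.mem_iSup.1 hx
      exact ⟨U i, hi, le_iSup U i, h i⟩
  refine ⟨Q, ⟨fun k a b ha hb => ?_, fun k c a ha => ?_⟩, hQ, fun i ψ => hQP ψ i⟩
  · refine sep (hQ _) (Submodule.add_mem _ (hQ ⟨k, a, ha⟩) (hQ ⟨k, b, hb⟩)) fun i => ?_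
    rw [map_add, hQP, hQP, hQP]
    exact (hP i).map_add rfl rfl
      (congrArg Subtype.val (hE.res_add (le_iSup U i) k ⟨a, ha⟩ ⟨b, hb⟩))
  · refine sep (hQ _) (Submodule.smul_mem _ c (hQ ⟨k, a, ha⟩)) fun i => ?_
    rw [map_smul, hQP, hQP]
    exact (hP i).map_smul (z := E.resSec (le_iSup U i) ⟨k, c • a, Submodule.smul_mem _ c ha⟩)
      (z₁ := E.resSec (le_iSup U i) ⟨k, a, ha⟩) rfl c
      (congrArg Subtype.val (hE.res_smul (le_iSup U i) k c ⟨a, ha⟩))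

/-! ### Restriction of derivations -/

section Der

variable {U V W : Opens X} {k : ℤ}

/-- Gives uniqueness of the restricted derivation, which is characterized only by its values on
restricted functions. -/
lemma gDer_ext_of_res_eq (hV : V ≤ U) {Z Z' : gDer M V k}
    (h : ∀ f : M.C U, Z.1 (M.res hV f) = Z'.1 (M.res hV f)) : Z = Z' := by
  have := (isLocalOp_of_gDer Z).eq_of_res_eq functions_isModuleSheaf (isLocalOp_of_gDer Z') hV
    fun ψ => h ψ.val
  refine Subtype.ext (linearMap_ext_homog fun j f hf => ?_)
  exact congrFun this ⟨j, f, hf⟩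

/-- A derivation is restricted as a local operator. The Leibniz rule is then verified near each
point, where both factors extend to `U`. -/
lemma exists_gDer_restriction (hV : V ≤ U) (Y : gDer M U k) :
    ∃ Z : gDer M V k, ∀ f : M.C U, Z.1 (M.res hV f) = M.res hV (Y.1 f) := by
  obtain ⟨Q, hQ, hQP⟩ := (isLocalOp_of_gDer Y).exists_restriction functions_isModuleSheaf hV
  obtain ⟨Z, hZ⟩ := exists_linearMap_of_homog hQ.linear
  have hmem : ∀ j, ∀ f ∈ M.gr V j, Z f ∈ M.gr V (j + k) := fun j f hf => by
    have := hQ.mem ⟨j, f, hf⟩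
    rwa [← hZ] at this
  have hres : ∀ {V' : Opens X} (h : V' ≤ V) {j : ℤ} {f : M.C V} (_ : f ∈ M.gr V j) {F : M.C U}
      (_ : F ∈ M.gr U j), M.res (h.trans hV) F = M.res h f →
      M.res h (Z f) = M.res (h.trans hV) (Y.1 F) := fun {V'} h {j f} hf {F} hF e => by
    have := hQ.res_eq functions_isModuleSheaf hV hQP h (ψ := ⟨f, hf⟩) (Ψ := ⟨F, hF⟩)
      (Subtype.ext e)
    exact (congrArg (M.res h) (hZ ⟨j, f, hf⟩)).trans this
  refine ⟨⟨Z, mem_gDer_of_homog hmem fun i j f hf g hg => ?_⟩, fun f => ?_⟩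
  · have m1 : Z (f * g) ∈ M.gr V (i + j + k) := hmem _ _ (SetLike.mul_mem_graded hf hg)
    have m2 : Z f * g ∈ M.gr V (i + j + k) := by
      rw [show i + j + k = i + k + j by ring]
      exact SetLike.mul_mem_graded (hmem _ _ hf) hg
    have m3 : f * Z g ∈ M.gr V (i + j + k) := by
      rw [show i + j + k = i + (j + k) by ring]
      exact SetLike.mul_mem_graded hf (hmem _ _ hg)
    refine function_eq_of_locally_eq m1 (Submodule.add_mem _ m2 (Submodule.smul_mem _ _ m3))
      fun x hx => ?_
    obtain ⟨V₁, hx₁, h₁, F, hF⟩ :=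
      functions_isModuleSheaf.exists_extension hV hx (⟨f, hf⟩ : M.gr V i)
    obtain ⟨V₂, hx₂, h₂, G, hG⟩ :=
      functions_isModuleSheaf.exists_extension hV hx (⟨g, hg⟩ : M.gr V j)
    have hF : M.res (h₁.trans hV) F.1 = M.res h₁ f := congrArg Subtype.val hF
    have hG : M.res (h₂.trans hV) G.1 = M.res h₂ g := congrArg Subtype.val hG
    have l : V₁ ⊓ V₂ ≤ V := inf_le_left.trans h₁
    have hF' : M.res (l.trans hV) F.1 = M.res l f := by
      rw [← M.res_res (h₁.trans hV) inf_le_left, hF, M.res_res]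
    have hG' : M.res (l.trans hV) G.1 = M.res l g := by
      rw [← M.res_res (h₂.trans hV) inf_le_right, hG, M.res_res]
    refine ⟨V₁ ⊓ V₂, ⟨hx₁, hx₂⟩, l, ?_⟩
    rw [map_add, map_smul, map_mul (M.res l) (Z f) g, map_mul (M.res l) f (Z g), hres l hf F.2 hF', hres l hg G.2 hG',
      hres l (SetLike.mul_mem_graded hf hg) (SetLike.mul_mem_graded F.2 G.2)
        (by rw [map_mul, map_mul, hF', hG']), ← hF', ← hG', Y.2.2 i F.1 F.2 G.1]
    simp only [map_add, map_smul, map_mul]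
  · have : Z ∘ₗ (M.res hV).toLinearMap = (M.res hV).toLinearMap ∘ₗ Y.1 :=
      linearMap_ext_homog fun j f hf => by
        have := hres (f := M.res hV f) le_rfl (M.res_mem hV _ _ hf) hf
          ((M.res_self _ _).symm)
        rw [M.res_self] at this
        exact this
    exact congrArg (fun T => T f) this

/-- Restriction is defined by choice; existence of a restricted derivation ensures that the choice
has the intended property. -/
lemma tangent_res_apply (hV : V ≤ U) (Y : (tangent M).gr U k) (f : M.C U) :
    ((tangent M).res hV Y).1 (M.res hV f) = M.res hV (Y.1 f) :=
  Classical.epsilon_spec (exists_gDer_restriction hV Y) f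

lemma tangent_res_eq (hV : V ≤ U) {Y : (tangent M).gr U k} {Z : gDer M V k}
    (h : ∀ f : M.C U, Z.1 (M.res hV f) = M.res hV (Y.1 f)) : (tangent M).res hV Y = Z :=
  gDer_ext_of_res_eq hV fun f => by rw [h]; exact tangent_res_apply hV Y f

end Der

/-- Each identity between restrictions reduces to its values on restricted functions. To glue
derivations, glue their values on each function and check Leibniz on the cover. -/
lemma tangent_isModuleSheaf : (tangent M).IsModuleSheaf where
  act_linear U := by
    refine ⟨fun n a b _ _ => LinearMap.ext fun Y => LinearMap.ext fun g => ?_,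
      fun n c a _ => LinearMap.ext fun Y => LinearMap.ext fun g => ?_⟩
    · exact add_mul a b (Y g)
    · exact smul_mul_assoc c a (Y g)
  one_act U k h Y hY := LinearMap.ext fun g => one_mul _
  mul_act U f g h k Y hY := LinearMap.ext fun e => mul_assoc _ _ _
  res_add h k Y Z := tangent_res_eq h fun f => by
    change ((tangent M).res h Y).1 (M.res h f) + ((tangent M).res h Z).1 (M.res h f) =
      M.res h (Y.1 f + Z.1 f)
    rw [tangent_res_apply, tangent_res_apply, map_add]
  res_smul h k c Y := tangent_res_eq h fun f => by
    change c • ((tangent M).res h Y).1 (M.res h f) = M.res h (c • Y.1 f)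
    rw [tangent_res_apply, map_smul]
  res_act {U V} h f Y := by
    refine Homog.ext' rfl (congrArg Subtype.val (tangent_res_eq h
      (Z := ⟨_, ((tangent M).smul (resFun M h f) ((tangent M).resSec h Y)).mem⟩) fun g => ?_))
    change M.res h f.val * ((tangent M).res h ⟨Y.val, Y.mem⟩).1 (M.res h g) = M.res h (f.val * Y.val g)
    rw [tangent_res_apply, map_mul]
  res_self U k Y := tangent_res_eq _ fun f => by rw [M.res_self, M.res_self]
  res_res h h' k Y := by
    refine (tangent_res_eq (h'.trans h) fun f => ?_).symm
    rw [← M.res_res h h', tangent_res_apply, tangent_res_apply, M.res_res]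
  glue {ι} U k Y hY := by
    obtain ⟨Q, hQ, hm, hQY⟩ := exists_glue_operators (functions_isModuleSheaf (M := M)) U (d := k)
      (fun i f => (Y i).1 f.val) (fun i => (isLocalOp_of_gDer (Y i)).linear)
      (fun i => (isLocalOp_of_gDer (Y i)).mem) (fun i j f => by
        have e := congrArg (fun Z => Z.1 (M.res (inf_le_left.trans (le_iSup U i)) f.val)) (hY i j)
        dsimp only at e
        rw [← M.res_res (le_iSup U i) (inf_le_left : U i ⊓ U j ≤ U i), tangent_res_apply, M.res_res,
          ← M.res_res (le_iSup U j) (inf_le_right : U i ⊓ U j ≤ U j), tangent_res_apply] at e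
        exact e)
    obtain ⟨Z, hZ⟩ := exists_linearMap_of_homog hQ
    have hmem : ∀ j, ∀ f ∈ M.gr _ j, Z f ∈ M.gr _ (j + k) := fun j f hf => by
      have := hm ⟨j, f, hf⟩
      rwa [← hZ] at this
    have hres : ∀ i, ∀ f, M.res (le_iSup U i) (Z f) = (Y i).1 (M.res (le_iSup U i) f) := fun i f => by
      have : (M.res (le_iSup U i)).toLinearMap ∘ₗ Z = (Y i).1 ∘ₗ (M.res (le_iSup U i)).toLinearMap :=
        linearMap_ext_homog fun j f hf => by
          have := hQY i ⟨j, f, hf⟩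
          rw [← hZ] at this
          exact this
      exact congrArg (fun T => T f) this
    refine ⟨⟨Z, mem_gDer_of_homog hmem fun i j f hf g hg => ?_⟩, fun i => ?_, fun Z' hZ' => ?_⟩
    · have m1 := hmem _ _ (SetLike.mul_mem_graded hf hg)
      have m2 : Z f * g ∈ M.gr _ (i + j + k) := by
        rw [show i + j + k = i + k + j by ring]
        exact SetLike.mul_mem_graded (hmem _ _ hf) hg
      have m3 : f * Z g ∈ M.gr _ (i + j + k) := by
        rw [show i + j + k = i + (j + k) by ring]
        exact SetLike.mul_mem_graded hf (hmem _ _ hg)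
      refine function_eq_of_locally_eq m1 (Submodule.add_mem _ m2 (Submodule.smul_mem _ _ m3))
        fun x hx => ?_
      obtain ⟨a, ha⟩ := Opens.mem_iSup.1 hx
      refine ⟨U a, ha, le_iSup U a, ?_⟩
      rw [map_add, map_smul, map_mul (M.res _) (Z f) g, map_mul (M.res _) f (Z g), hres, hres, hres,
        map_mul,
        (Y a).2.2 i _ (M.res_mem _ _ _ hf)]
    · exact tangent_res_eq _ fun f => (hres i f).symm
    · refine Subtype.ext (linearMap_ext_homog fun j f hf => ?_)
      refine function_eq_of_locally_eq (Z'.2.1 j f hf) (hmem j f hf) fun x hx => ?_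
      obtain ⟨a, ha⟩ := Opens.mem_iSup.1 hx
      refine ⟨U a, ha, le_iSup U a, ?_⟩
      rw [← tangent_res_apply (le_iSup U a) Z' f, hZ']
      exact (hres a f).symm

end GradedGeometry

namespace GradedGeometry

variable {X : Type u} [TopologicalSpace X] [T2Space X] [SecondCountableTopology X]
  {M : GradedManifold.{u, v} X}

open PreBundle

/-! ### The dual sheaf -/

section Dual

variable {E : PreBundle M} {U V W : Opens X} {k : ℤ}

lemma dualGr_ext_of_res_eq (hE : E.IsModuleSheaf) (hV : V ≤ U) {α β : E.dualGr V k}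
    (h : ∀ ψ : Homog (E.gr U), α.1 (E.resSec hV ψ) = β.1 (E.resSec hV ψ)) : α = β :=
  Subtype.ext ((isLocalOp_of_dualGr hE α).eq_of_res_eq hE (isLocalOp_of_dualGr hE β) hV h)

/-- Linearity over functions of the restricted operator is checked near points where both the
function and the section extend to `U`. -/
lemma exists_dualGr_restriction (hE : E.IsModuleSheaf) (hV : V ≤ U) (α : E.dualGr U k) :
    ∃ β : E.dualGr V k, ∀ ψ : Homog (E.gr U), β.1 (E.resSec hV ψ) = M.res hV (α.1 ψ) := by
  obtain ⟨Q, hQ, hQP⟩ := (isLocalOp_of_dualGr hE α).exists_restriction hE hV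
  refine ⟨⟨Q, hQ.linear, hQ.mem, fun f ψ => ?_⟩, hQP⟩
  have m : f.val * Q ψ ∈ M.gr V (f.deg + ψ.deg + k) := by
    rw [add_assoc]
    exact SetLike.mul_mem_graded f.mem (hQ.mem ψ)
  refine function_eq_of_locally_eq (hQ.mem _) (Submodule.smul_mem _ _ m) fun x hx => ?_
  obtain ⟨V₁, hx₁, h₁, F, hF⟩ :=
    functions_isModuleSheaf.exists_extension hV hx (⟨f.val, f.mem⟩ : M.gr V f.deg)
  obtain ⟨V₂, hx₂, h₂, Ψ, hΨ⟩ := hE.exists_extension hV hx (⟨ψ.val, ψ.mem⟩ : E.gr V ψ.deg)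
  have l : V₁ ⊓ V₂ ≤ V := inf_le_left.trans h₁
  have hF' : (functions M).res (l.trans hV) F = (functions M).res l ⟨f.val, f.mem⟩ := by
    rw [← functions_isModuleSheaf.res_res (h₁.trans hV) inf_le_left, hF,
      functions_isModuleSheaf.res_res]
  have hΨ' : E.res (l.trans hV) Ψ = E.res l ⟨ψ.val, ψ.mem⟩ := by
    rw [← hE.res_res (h₂.trans hV) inf_le_right, hΨ, hE.res_res]
  refine ⟨V₁ ⊓ V₂, ⟨hx₁, hx₂⟩, l, ?_⟩
  have e1 : M.res l (Q ψ) = M.res (l.trans hV) (α.1 (Homog.of Ψ)) :=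
    hQ.res_eq hE hV hQP l (ψ := (⟨ψ.val, ψ.mem⟩ : E.gr V ψ.deg)) hΨ'
  have e2 : M.res l (Q (E.smul f ψ)) =
      M.res (l.trans hV) (α.1 (E.smul (Homog.of F) (Homog.of Ψ))) :=
    hQ.res_eq hE hV hQP l (ψ := E.gmul rfl (⟨f.val, f.mem⟩ : M.gr V f.deg) ⟨ψ.val, ψ.mem⟩)
      (Ψ := E.gmul rfl F Ψ) (by rw [hE.res_gmul, hE.res_gmul, hF', hΨ'])
  have e3 : M.res (l.trans hV) (Homog.of F : Homog (M.gr U)).val = M.res l f.val :=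
    congrArg Subtype.val hF'
  rw [e2, α.2.2.2, map_smul, map_smul, map_mul, map_mul, e3, e1]
  rfl

lemma dual_res_apply (hE : E.IsModuleSheaf) (hV : V ≤ U) (α : E.dual.gr U k)
    (ψ : Homog (E.gr U)) : (E.dual.res hV α).1 (E.resSec hV ψ) = M.res hV (α.1 ψ) :=
  Classical.epsilon_spec (exists_dualGr_restriction hE hV α) ψ

lemma dual_res_eq (hE : E.IsModuleSheaf) (hV : V ≤ U) {α : E.dual.gr U k} {β : E.dualGr V k}
    (h : ∀ ψ : Homog (E.gr U), β.1 (E.resSec hV ψ) = M.res hV (α.1 ψ)) :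
    E.dual.res hV α = β :=
  dualGr_ext_of_res_eq hE hV fun ψ => by rw [h]; exact dual_res_apply hE hV α ψ

lemma resSec_resSec (hE : E.IsModuleSheaf) (h : V ≤ U) (h' : W ≤ V) (ψ : Homog (E.gr U)) :
    E.resSec h' (E.resSec h ψ) = E.resSec (h'.trans h) ψ :=
  Homog.ext' rfl (congrArg Subtype.val (hE.res_res h h' _ _))

lemma resSec_self (hE : E.IsModuleSheaf) (h : U ≤ U) (ψ : Homog (E.gr U)) : E.resSec h ψ = ψ :=
  Homog.ext' rfl (congrArg Subtype.val (hE.res_self U _ _))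

lemma PreBundle.IsModuleSheaf.dual (hE : E.IsModuleSheaf) : E.dual.IsModuleSheaf where
  act_linear U := by
    refine ⟨fun n a b _ _ => LinearMap.ext fun α => funext fun g => ?_,
      fun n c a _ => LinearMap.ext fun α => funext fun g => ?_⟩
    · exact add_mul a b (α g)
    · exact smul_mul_assoc c a (α g)
  one_act U k h α hα := funext fun g => one_mul _
  mul_act U f g h k α hα := funext fun e => mul_assoc _ _ _
  res_add h k α β := dual_res_eq hE h fun ψ => by
    change (E.dual.res h α).1 (E.resSec h ψ) + (E.dual.res h β).1 (E.resSec h ψ) =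
      M.res h (α.1 ψ + β.1 ψ)
    rw [dual_res_apply hE, dual_res_apply hE, map_add]
  res_smul h k c α := dual_res_eq hE h fun ψ => by
    change c • (E.dual.res h α).1 (E.resSec h ψ) = M.res h (c • α.1 ψ)
    rw [dual_res_apply hE, map_smul]
  res_act {U V} h f α := by
    refine Homog.ext' rfl (congrArg Subtype.val (dual_res_eq hE h
      (β := ⟨_, (E.dual.smul (resFun M h f) (E.dual.resSec h α)).mem⟩) fun ψ => ?_))
    change M.res h f.val * (E.dual.res h ⟨α.val, α.mem⟩).1 (E.resSec h ψ) = M.res h (f.val * α.val ψ)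
    rw [dual_res_apply hE, map_mul]
  res_self U k α := dual_res_eq hE _ fun ψ => by rw [M.res_self, resSec_self hE]
  res_res h h' k α := by
    refine (dual_res_eq hE (h'.trans h) fun ψ => ?_).symm
    rw [← resSec_resSec hE h h', dual_res_apply hE, dual_res_apply hE, M.res_res]
  glue {ι} U k α hα := by
    obtain ⟨Q, hQ, hm, hQα⟩ := exists_glue_operators hE U (d := k)
      (fun i => (α i).1) (fun i => (α i).2.1) (fun i => (α i).2.2.1) (fun i j ψ => by
        have e := congrArg
          (fun β => β.1 (E.resSec (inf_le_left.trans (le_iSup U i)) ψ)) (hα i j)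
        dsimp only at e
        rw [← resSec_resSec hE (le_iSup U i) (inf_le_left : U i ⊓ U j ≤ U i), dual_res_apply hE,
          resSec_resSec hE, ← resSec_resSec hE (le_iSup U j) (inf_le_right : U i ⊓ U j ≤ U j),
          dual_res_apply hE] at e
        exact e)
    refine ⟨⟨Q, hQ, hm, fun f ψ => ?_⟩, fun i => ?_, fun β hβ => ?_⟩
    · have m : f.val * Q ψ ∈ M.gr _ (f.deg + ψ.deg + k) := by
        rw [add_assoc]
        exact SetLike.mul_mem_graded f.mem (hm ψ)
      refine function_eq_of_locally_eq (hm _) (Submodule.smul_mem _ _ m) fun x hx => ?_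
      obtain ⟨a, ha⟩ := Opens.mem_iSup.1 hx
      refine ⟨U a, ha, le_iSup U a, ?_⟩
      rw [hQα, hE.res_act, (α a).2.2.2, ← hQα, map_smul, map_mul]
      rfl
    · exact dual_res_eq hE _ fun ψ => (hQα i ψ).symm
    · refine Subtype.ext (funext fun ψ => ?_)
      refine function_eq_of_locally_eq (β.2.2.1 ψ) (hm ψ) fun x hx => ?_
      obtain ⟨a, ha⟩ := Opens.mem_iSup.1 hx
      refine ⟨U a, ha, le_iSup U a, ?_⟩
      rw [← dual_res_apply hE (le_iSup U a) β ψ, hβ]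
      exact (hQα a ψ).symm

end Dual

end GradedGeometry

namespace GradedGeometry

variable {X : Type u} [TopologicalSpace X] [T2Space X] [SecondCountableTopology X]
  {M : GradedManifold.{u, v} X}

namespace PreBundle

/-! ### Local frames -/

/-- Local frames: sections over `U` that freely generate the sections over all smaller open sets. -/
def IsFrame (E : PreBundle M) {U : Opens X} {ι : Type} [Fintype ι] {δ : ι → ℤ}
    (Φ : ∀ a, E.gr U (δ a)) : Prop :=
  ∀ (V : Opens X) (hV : V ≤ U) (k : ℤ) (ψ : E.gr V k), ∃! f : ∀ a, M.gr V (k - δ a),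
    (ψ : E.Sec V) = ∑ a, E.act V ⟨k - δ a, f a, (f a).2⟩ (E.res hV (Φ a))

/-- Frames may be indexed by any finite type, which suits coordinates and direct sums; reindexing
gives the form required by the definition. -/
lemma IsModuleSheaf.isGradedVectorBundle {E : PreBundle M} (hE : E.IsModuleSheaf) {ι : Type}
    [Fintype ι] (δ : ι → ℤ)
    (h : ∀ x : X, ∃ U : Opens X, x ∈ U ∧ ∃ Φ : ∀ a, E.gr U (δ a), E.IsFrame Φ) :
    E.IsGradedVectorBundle where
  __ := hE
  locally_free := by
    let e := Fintype.equivFin ι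
    refine ⟨Fintype.card ι, δ ∘ e.symm, fun x => ?_⟩
    obtain ⟨U, hx, Φ, hΦ⟩ := h x
    refine ⟨U, hx, fun a => Φ (e.symm a), fun V hV k ψ => ?_⟩
    refine ((Equiv.piCongrLeft' (fun a => M.gr V (k - δ a)) e).existsUnique_congr fun {f} => ?_).1
      (hΦ V hV k ψ)
    rw [← Equiv.sum_comp e.symm]
    rfl

lemma IsGradedVectorBundle.exists_frame {E : PreBundle M} (hE : E.IsGradedVectorBundle) :
    ∃ (r : ℕ) (δ : Fin r → ℤ), ∀ x : X, ∃ U : Opens X, x ∈ U ∧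
      ∃ Φ : ∀ a, E.gr U (δ a), E.IsFrame Φ := hE.locally_free

section Frame

variable {E : PreBundle M} {U V : Opens X} {ι : Type} [Fintype ι] {δ : ι → ℤ}
  {Φ : ∀ a, E.gr U (δ a)}

lemma IsFrame.restrict (hE : E.IsModuleSheaf) (hΦ : E.IsFrame Φ) (hV : V ≤ U) :
    E.IsFrame fun a => E.res hV (Φ a) := by
  intro W hW k ψ
  simp only [hE.res_res]
  exact hΦ W (hW.trans hV) k ψ

lemma coe_sum_gmul {k : ℤ} (f : ∀ a, M.gr V (k - δ a)) (Ψ : ∀ a, E.gr V (δ a)) :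
    ((∑ a, E.gmul (sub_add_cancel k (δ a)) (f a) (Ψ a) : E.gr V k) : E.Sec V) =
      ∑ a, E.act V ⟨k - δ a, f a, (f a).2⟩ (Ψ a) := by
  rw [AddSubmonoidClass.coe_finsetSum]
  rfl

/-- The coefficients of a section with respect to a local frame. -/
noncomputable def IsFrame.coef (hΦ : E.IsFrame Φ) (hV : V ≤ U) {k : ℤ} (ψ : E.gr V k) (a : ι) :
    M.gr V (k - δ a) := (hΦ V hV k ψ).choose a

lemma IsFrame.sum_coef (hΦ : E.IsFrame Φ) (hV : V ≤ U) {k : ℤ} (ψ : E.gr V k) :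
    ψ = ∑ a, E.gmul (sub_add_cancel k (δ a)) (hΦ.coef hV ψ a) (E.res hV (Φ a)) :=
  Subtype.ext ((hΦ V hV k ψ).choose_spec.1.trans (coe_sum_gmul _ _).symm)

lemma IsFrame.coef_eq (hΦ : E.IsFrame Φ) (hV : V ≤ U) {k : ℤ} {ψ : E.gr V k}
    {f : ∀ a, M.gr V (k - δ a)}
    (h : ψ = ∑ a, E.gmul (sub_add_cancel k (δ a)) (f a) (E.res hV (Φ a))) :
    hΦ.coef hV ψ = f := by
  refine ((hΦ V hV k ψ).choose_spec.2 f ?_).symm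
  exact (congrArg Subtype.val h).trans (coe_sum_gmul _ _)

end Frame

namespace IsModuleSheaf

variable {E : PreBundle M} (hE : E.IsModuleSheaf) {U V : Opens X} {j k n : ℤ}

lemma gmul_add (hn : j + k = n) (f : M.gr U j) (ψ φ : E.gr U k) :
    E.gmul hn f (ψ + φ) = E.gmul hn f ψ + E.gmul hn f φ :=
  Subtype.ext (map_add (E.act U ⟨j, f.1, f.2⟩) ψ.1 φ.1)

include hE

lemma add_gmul (hn : j + k = n) (f g : M.gr U j) (ψ : E.gr U k) :
    E.gmul hn (f + g) ψ = E.gmul hn f ψ + E.gmul hn g ψ :=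
  Subtype.ext (congrArg (fun T => T ψ.1) ((hE.act_linear U).1 j f.1 g.1 f.2 g.2))

lemma smul_gmul (hn : j + k = n) (c : ℝ) (f : M.gr U j) (ψ : E.gr U k) :
    E.gmul hn (c • f) ψ = c • E.gmul hn f ψ :=
  Subtype.ext (congrArg (fun T => T ψ.1) ((hE.act_linear U).2 j c f.1 f.2))

lemma gmul_gmul {i m l : ℤ} (h₁ : i + m = n) (h₂ : j + k = m) (h₃ : i + j = l) (h₄ : l + k = n)
    (f : M.gr U i) (g : M.gr U j) (ψ : E.gr U k) :
    E.gmul h₁ f (E.gmul h₂ g ψ) =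
      E.gmul h₄ ⟨f.1 * g.1, h₃ ▸ SetLike.mul_mem_graded f.2 g.2⟩ ψ := by
  subst h₃
  exact Subtype.ext (hE.mul_act U ⟨i, f.1, f.2⟩ ⟨j, g.1, g.2⟩
    (SetLike.mul_mem_graded f.2 g.2) k ψ.1 ψ.2).symm

/-- Restriction of sections of degree `k` as a linear map. -/
def resHom (h : V ≤ U) (k : ℤ) : E.gr U k →ₗ[ℝ] E.gr V k where
  toFun := E.res h
  map_add' := hE.res_add h k
  map_smul' := hE.res_smul h k

lemma res_sum (h : V ≤ U) {ι : Type*} (s : Finset ι) (ψ : ι → E.gr U k) :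
    E.res h (∑ i ∈ s, ψ i) = ∑ i ∈ s, E.res h (ψ i) := map_sum (hE.resHom h k) ψ s

end IsModuleSheaf

/-! ### The dual of a graded vector bundle -/

section DualFrame

variable {E : PreBundle M} (hE : E.IsModuleSheaf) {U V : Opens X} {ι : Type} [Fintype ι]
  {δ : ι → ℤ} {Φ : ∀ a, E.gr U (δ a)} (hΦ : E.IsFrame Φ)

include hE

/-- Restricting the expansion of `ψ` gives an expansion of its restriction, and coefficients are
unique. -/
lemma IsFrame.coef_res (hV : V ≤ U) {k : ℤ} (ψ : E.gr U k) (a : ι) :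
    hΦ.coef hV (E.res hV ψ) a = (functions M).res hV (hΦ.coef le_rfl ψ a) := by
  refine congrFun (hΦ.coef_eq hV (f := fun a => (functions M).res hV (hΦ.coef le_rfl ψ a)) ?_) a
  conv_lhs => rw [hΦ.sum_coef le_rfl ψ]
  rw [hE.res_sum]
  refine Finset.sum_congr rfl fun b _ => ?_
  rw [hE.res_gmul, hE.res_res]

/-- The dual frame. -/
noncomputable def IsFrame.dualFrame (hV : V ≤ U) (a : ι) : E.dualGr V (-δ a) :=
  -- The sign of moving an element of degree -δ a past a coefficient of degree |ψ| - δ a; with it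
  -- the coefficient map obeys the sign rule of the dual.
  ⟨fun ψ => (-1 : ℝ) ^ (δ a * (ψ.deg - δ a)) • (hΦ.coef hV ⟨ψ.val, ψ.mem⟩ a : M.C V), by
    refine ⟨IsGradedLinear.deg_smul (F := fun ψ => (hΦ.coef hV ⟨ψ.val, ψ.mem⟩ a : M.C V))
      ⟨fun n ψ φ hψ hφ => ?_, fun n c ψ hψ => ?_⟩ fun n => (-1 : ℝ) ^ (δ a * (n - δ a)),
      fun ψ => ?_, fun f ψ => ?_⟩
    · have := congrFun (hΦ.coef_eq hV (ψ := (⟨ψ, hψ⟩ + ⟨φ, hφ⟩ : E.gr V n))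
        (f := fun a => hΦ.coef hV ⟨ψ, hψ⟩ a + hΦ.coef hV ⟨φ, hφ⟩ a) (by
          simp only [hE.add_gmul, Finset.sum_add_distrib, ← hΦ.sum_coef])) a
      exact congrArg Subtype.val this
    · have := congrFun (hΦ.coef_eq hV (ψ := (c • ⟨ψ, hψ⟩ : E.gr V n))
        (f := fun a => c • hΦ.coef hV ⟨ψ, hψ⟩ a) (by
          simp only [hE.smul_gmul, ← Finset.smul_sum, ← hΦ.sum_coef])) a
      exact congrArg Subtype.val this
    · exact Submodule.smul_mem _ _ (hΦ.coef hV ⟨ψ.val, ψ.mem⟩ a).2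
    · have := congrFun (hΦ.coef_eq hV
        (ψ := E.gmul rfl (⟨f.val, f.mem⟩ : M.gr V f.deg) (⟨ψ.val, ψ.mem⟩ : E.gr V ψ.deg))
        (f := fun a => ⟨f.val * (hΦ.coef hV ⟨ψ.val, ψ.mem⟩ a).1, by
          rw [add_sub_assoc]
          exact SetLike.mul_mem_graded f.mem (hΦ.coef hV ⟨ψ.val, ψ.mem⟩ a).2⟩) (by
        conv_lhs => rw [hΦ.sum_coef hV (⟨ψ.val, ψ.mem⟩ : E.gr V ψ.deg)]
        have hs : ∀ φ : ι → E.gr V ψ.deg, E.gmul rfl (⟨f.val, f.mem⟩ : M.gr V f.deg) (∑ i, φ i) =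
            ∑ i, E.gmul rfl (⟨f.val, f.mem⟩ : M.gr V f.deg) (φ i) := fun φ =>
          map_sum (⟨⟨E.gmul rfl (⟨f.val, f.mem⟩ : M.gr V f.deg),
            Subtype.ext (map_zero (E.act V ⟨f.deg, f.val, f.mem⟩))⟩,
            IsModuleSheaf.gmul_add rfl _⟩ : E.gr V ψ.deg →+ E.gr V (f.deg + ψ.deg)) φ _
        rw [hs]
        refine Finset.sum_congr rfl fun b _ => ?_
        exact hE.gmul_gmul rfl _ (add_sub_assoc _ _ _).symm _ _ _ _)) a
      have e : ((hΦ.coef hV ⟨(E.smul f ψ).val, (E.smul f ψ).mem⟩ a :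
          M.gr V ((E.smul f ψ).deg - δ a)) : M.C V) =
          f.val * (hΦ.coef hV ⟨ψ.val, ψ.mem⟩ a).1 := congrArg Subtype.val this
      change (-1 : ℝ) ^ (δ a * ((E.smul f ψ).deg - δ a)) •
        (hΦ.coef hV ⟨(E.smul f ψ).val, (E.smul f ψ).mem⟩ a : M.C V) = (-1 : ℝ) ^ (-δ a * f.deg) •
          (f.val * (-1 : ℝ) ^ (δ a * (ψ.deg - δ a)) • (hΦ.coef hV ⟨ψ.val, ψ.mem⟩ a : M.C V))
      rw [e, mul_smul_comm, smul_smul, ← zpow_add₀ (by norm_num)]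
      congr 1
      refine neg_one_zpow_congr ?_
      have hd : (E.smul f ψ).deg = f.deg + ψ.deg := rfl
      rw [hd]
      push_cast
      generalize (f.deg : ZMod 2) = x, (δ a : ZMod 2) = y, (ψ.deg : ZMod 2) = z
      revert x y z; decide⟩

lemma IsFrame.dualFrame_apply (hV : V ≤ U) (a : ι) {k : ℤ} (ψ : E.gr V k) :
    (hΦ.dualFrame hE hV a).1 (Homog.of ψ) =
      (-1 : ℝ) ^ (δ a * (k - δ a)) • (hΦ.coef hV ψ a : M.C V) := rfl

lemma IsFrame.res_dualFrame (hV : V ≤ U) (a : ι) :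
    E.dual.res hV (hΦ.dualFrame hE le_rfl a) = hΦ.dualFrame hE hV a := by
  refine dual_res_eq hE hV fun ψ => ?_
  have := congrArg Subtype.val (hΦ.coef_res hE hV ⟨ψ.val, ψ.mem⟩ a)
  have e1 := hΦ.dualFrame_apply hE hV a (E.res hV ⟨ψ.val, ψ.mem⟩)
  have e2 := hΦ.dualFrame_apply hE le_rfl a ⟨ψ.val, ψ.mem⟩
  rw [this] at e1
  refine e1.trans ?_
  refine Eq.trans ?_ (congrArg (M.res hV) e2).symm
  rw [map_smul]

lemma IsFrame.dualGr_apply_eq_sum (hV : V ≤ U) {k : ℤ} (α : E.dualGr V k) {j : ℤ} (ψ : E.gr V j) :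
    α.1 (Homog.of ψ) = ∑ a, (-1 : ℝ) ^ (k * (j - δ a)) •
      ((hΦ.coef hV ψ a).1 * α.1 (Homog.of (E.res hV (Φ a)))) := by
  have hs : ∀ φ : ι → E.gr V j, α.1 (Homog.of (∑ i, φ i)) = ∑ i, α.1 (Homog.of (φ i)) := fun φ =>
    map_sum (⟨⟨fun φ => α.1 (Homog.of φ), α.2.1.map_zero rfl⟩, α.2.1.of_add⟩ :
      E.gr V j →+ M.C V) φ _
  conv_lhs => rw [hΦ.sum_coef hV ψ]
  rw [hs]
  refine Finset.sum_congr rfl fun a _ => ?_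
  refine Eq.trans ?_ (α.2.2.2 (Homog.of (hΦ.coef hV ψ a)) (Homog.of (E.res hV (Φ a))))
  exact congrArg α.1 (Homog.ext' (by simp [Homog.of, PreBundle.smul]) rfl)

lemma IsFrame.coef_frame [DecidableEq ι] (hV : V ≤ U) (a b : ι) :
    (hΦ.coef hV (E.res hV (Φ a)) b : M.C V) = if b = a then 1 else 0 := by
  have h1 : ∀ c, (if c = a then 1 else 0 : M.C V) ∈ M.gr V (δ a - δ c) := fun c => by
    split_ifs with h
    · rw [h, sub_self]; exact SetLike.GradedOne.one_mem
    · exact Submodule.zero_mem _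
  have := congrFun (hΦ.coef_eq hV (ψ := E.res hV (Φ a)) (f := fun c => ⟨_, h1 c⟩) ?_) b
  · exact congrArg Subtype.val this
  · rw [Finset.sum_eq_single a]
    · refine Subtype.ext ?_
      have hz : δ a - δ a = 0 := sub_self _
      -- The coefficient 1 sits in degree δ a - δ a, which is not syntactically 0, so the unit law
      -- is stated for any degree equal to 0.
      have : ∀ (m : ℤ) (_ : m = 0) (f : M.C V) (hf : f ∈ M.gr V m), f = 1 →
          E.act V ⟨m, f, hf⟩ (E.res hV (Φ a)).1 = (E.res hV (Φ a)).1 := by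
        rintro m rfl f hf rfl
        exact hE.one_act V _ hf _ (E.res hV (Φ a)).2
      exact (this _ hz _ _ (if_pos rfl)).symm
    · intro c _ hc
      have : (⟨_, h1 c⟩ : M.gr V (δ a - δ c)) = 0 := Subtype.ext (if_neg hc)
      rw [this, hE.zero_gmul]
    · exact fun h => absurd (Finset.mem_univ a) h

/-- The coefficients of α are its values on the frame: applying α to an expansion shows that they
work, and evaluating on the frame shows that they are forced. -/
lemma IsFrame.isFrame_dual : E.dual.IsFrame fun a => hΦ.dualFrame hE le_rfl a := by
  classical
  intro V hV k α
  refine ⟨fun a => ⟨α.1 (Homog.of (E.res hV (Φ a))), ?_⟩, ?_, fun h hh => ?_⟩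
  · have := α.2.2.1 (Homog.of (E.res hV (Φ a)))
    rwa [show (Homog.of (E.res hV (Φ a)) : Homog (E.gr V)).deg + k = k - -δ a by
      change δ a + k = k - -δ a; ring] at this
  · refine funext fun ψ => ?_
    rw [Finset.sum_apply]
    refine (hΦ.dualGr_apply_eq_sum hE hV α ⟨ψ.val, ψ.mem⟩).trans ?_
    refine Finset.sum_congr rfl fun a _ => ?_
    rw [hΦ.res_dualFrame hE hV a]
    change _ = α.1 (Homog.of (E.res hV (Φ a))) *
      (-1 : ℝ) ^ (δ a * (ψ.deg - δ a)) • (hΦ.coef hV ⟨ψ.val, ψ.mem⟩ a : M.C V)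
    -- Commuting the value of α past the coefficient of ψ gives a sign which, combined with that of
    -- the dual frame, is the sign of extracting the coefficient from α.
    rw [mul_smul_comm, M.comm V (δ a + k) (ψ.deg - δ a) _ _
      (α.2.2.1 (Homog.of (E.res hV (Φ a)))) (hΦ.coef hV ⟨ψ.val, ψ.mem⟩ a).2, smul_smul,
      ← zpow_add₀ (by norm_num)]
    congr 1
    refine neg_one_zpow_congr ?_
    push_cast
    generalize (k : ZMod 2) = x, (δ a : ZMod 2) = y, (ψ.deg : ZMod 2) = z
    revert x y z; decide
  · refine funext fun a => Subtype.ext ?_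
    have e := congrFun hh (Homog.of (E.res hV (Φ a)))
    rw [Finset.sum_apply] at e
    refine Eq.trans ?_ e.symm
    have e2 : ∀ b, E.dual.act V ⟨k - -δ b, h b, (h b).2⟩
        ((E.dual.res hV (hΦ.dualFrame hE le_rfl b)).1) (Homog.of (E.res hV (Φ a))) =
        if b = a then (h b).1 else 0 := fun b => by
      rw [hΦ.res_dualFrame hE hV b]
      change (h b).1 * (-1 : ℝ) ^ (δ b * (δ a - δ b)) • (hΦ.coef hV (E.res hV (Φ a)) b : M.C V) = _
      rw [hΦ.coef_frame hE hV a b]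
      split_ifs with hb
      · rw [hb, sub_self, mul_zero, zpow_zero, one_smul, mul_one]
      · rw [smul_zero, mul_zero]
    simp only [e2]
    rw [Finset.sum_ite_eq' Finset.univ a, if_pos (Finset.mem_univ a)]

end DualFrame

lemma IsGradedVectorBundle.dual {E : PreBundle M} (hE : E.IsGradedVectorBundle) :
    E.dual.IsGradedVectorBundle := by
  obtain ⟨r, δ, h⟩ := hE.exists_frame
  refine hE.isModuleSheaf.dual.isGradedVectorBundle (fun a => -δ a) fun x => ?_
  obtain ⟨U, hx, Φ, hΦ⟩ := h x
  exact ⟨U, hx, _, hΦ.isFrame_dual hE.isModuleSheaf⟩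

end PreBundle

end GradedGeometry

namespace GradedGeometry

variable {X : Type u} [TopologicalSpace X] [T2Space X] [SecondCountableTopology X]
  {M : GradedManifold.{u, v} X}

namespace PreBundle

/-! ### Shifts and direct sums -/

section Shift

variable {E : PreBundle M} {U V : Opens X}

lemma coe_res_congr (E : PreBundle M) (h : V ≤ U) {j k : ℤ} (hjk : j = k) {ψ φ : E.Sec U}
    (hψ : ψ ∈ E.gr U j) (hφ : φ ∈ E.gr U k) (e : ψ = φ) :
    (E.res h ⟨ψ, hψ⟩ : E.Sec V) = E.res h ⟨φ, hφ⟩ := by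
  subst hjk e; rfl

lemma IsModuleSheaf.shift (hE : E.IsModuleSheaf) (ℓ : ℤ) : (E.shift ℓ).IsModuleSheaf where
  act_linear U := by
    refine ⟨fun n a b ha hb => ?_, fun n c a ha => ?_⟩
    · change (-1 : ℝ) ^ (n * ℓ) • E.act U ⟨n, a + b, _⟩ = (-1 : ℝ) ^ (n * ℓ) • E.act U ⟨n, a, ha⟩ +
        (-1 : ℝ) ^ (n * ℓ) • E.act U ⟨n, b, hb⟩
      rw [(hE.act_linear U).1 n a b ha hb, smul_add]
    · change (-1 : ℝ) ^ (n * ℓ) • E.act U ⟨n, c • a, _⟩ =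
        c • (-1 : ℝ) ^ (n * ℓ) • E.act U ⟨n, a, ha⟩
      rw [(hE.act_linear U).2 n c a ha, smul_comm]
  one_act U k h ψ hψ := by
    change (-1 : ℝ) ^ (0 * ℓ) • E.act U ⟨0, 1, h⟩ ψ = ψ
    rw [zero_mul, zpow_zero, one_smul]
    exact hE.one_act U (k + ℓ) h ψ hψ
  mul_act U f g h k ψ hψ := by
    change (-1 : ℝ) ^ ((f.deg + g.deg) * ℓ) • E.act U ⟨f.deg + g.deg, f.val * g.val, h⟩ ψ =
      (-1 : ℝ) ^ (f.deg * ℓ) • E.act U f ((-1 : ℝ) ^ (g.deg * ℓ) • E.act U g ψ)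
    rw [hE.mul_act U f g h (k + ℓ) ψ hψ, map_smul, smul_smul, add_mul, zpow_add₀ (by norm_num)]
  res_add h k ψ φ := hE.res_add h (k + ℓ) ψ φ
  res_smul h k c ψ := hE.res_smul h (k + ℓ) c ψ
  res_act {U V} h f ψ := by
    refine Homog.ext' rfl ?_
    have e := hE.res_smul h _ ((-1 : ℝ) ^ (f.deg * ℓ))
      ⟨_, (E.smul f ⟨ψ.deg + ℓ, ψ.val, ψ.mem⟩).mem⟩
    refine (E.coe_res_congr h (add_assoc _ _ _) _ (Submodule.smul_mem _ _
      (E.smul f ⟨ψ.deg + ℓ, ψ.val, ψ.mem⟩).mem) rfl).trans ((congrArg Subtype.val e).trans ?_)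
    have e2 := (Homog.mk.inj (hE.res_act h f ⟨ψ.deg + ℓ, ψ.val, ψ.mem⟩)).2
    exact congrArg (fun z => (-1 : ℝ) ^ (f.deg * ℓ) • z) e2
  res_self U k ψ := hE.res_self U (k + ℓ) ψ
  res_res h h' k ψ := hE.res_res h h' (k + ℓ) ψ
  glue U k ψ h := hE.glue U (k + ℓ) ψ h

lemma act_congr (E : PreBundle M) {j k : ℤ} (h : j = k) {f : M.C U} (hj : f ∈ M.gr U j)
    (hk : f ∈ M.gr U k) : E.act U ⟨j, f, hj⟩ = E.act U ⟨k, f, hk⟩ := by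
  subst h; rfl

/-- The rescaling of a family of functions of degrees `j a` by signs, viewed in equal degrees. -/
noncomputable def signEquiv {ι : Type} {j k : ι → ℤ} (h : ∀ a, j a = k a) (ε : ι → ℝ)
    (hε : ∀ a, ε a * ε a = 1) : (∀ a, M.gr U (j a)) ≃ ∀ a, M.gr U (k a) where
  toFun f a := ⟨ε a • (f a).1, h a ▸ Submodule.smul_mem _ _ (f a).2⟩
  invFun f a := ⟨ε a • (f a).1, (h a).symm ▸ Submodule.smul_mem _ _ (f a).2⟩
  left_inv f := funext fun a => Subtype.ext (by simp [smul_smul, hε])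
  right_inv f := funext fun a => Subtype.ext (by simp [smul_smul, hε])

/-- A section viewed as a section of the shifted bundle. -/
def toShift (ℓ : ℤ) {k : ℤ} (ψ : E.gr U k) : (E.shift ℓ).gr U (k - ℓ) :=
  ⟨ψ.1, show ψ.1 ∈ E.gr U (k - ℓ + ℓ) by rw [sub_add_cancel]; exact ψ.2⟩

/-- Expansions in the shifted bundle correspond to those in `E` after multiplying each coefficient
by the sign of the shifted action. -/
lemma IsFrame.shift (hE : E.IsModuleSheaf) {ι : Type} [Fintype ι] {δ : ι → ℤ}
    {Φ : ∀ a, E.gr U (δ a)} (hΦ : E.IsFrame Φ) (ℓ : ℤ) :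
    (E.shift ℓ).IsFrame (δ := fun a => δ a - ℓ) (fun a => toShift ℓ (Φ a)) := by
  intro V hV k ψ
  refine ((signEquiv (M := M) (U := V) (j := fun a => k + ℓ - δ a) (k := fun a => k - (δ a - ℓ))
    (fun a => by ring) (fun a => (-1 : ℝ) ^ ((k + ℓ - δ a) * ℓ))
    (fun a => by rw [← zpow_add₀ (by norm_num)]; exact Even.neg_one_zpow (Even.add_self _))
    ).existsUnique_congr fun {f} => ?_).1
    (hΦ V hV (k + ℓ) ⟨ψ.1, ψ.2⟩)
  refine Eq.congr rfl (Finset.sum_congr rfl fun a _ => ?_)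
  have e1 := (hE.act_linear V).2 _ ((-1 : ℝ) ^ ((k + ℓ - δ a) * ℓ)) (f a).1 (f a).2
  have e2 := E.act_congr (show k + ℓ - δ a = k - (δ a - ℓ) by ring)
    (Submodule.smul_mem _ ((-1 : ℝ) ^ ((k + ℓ - δ a) * ℓ)) (f a).2)
    ((show k + ℓ - δ a = k - (δ a - ℓ) by ring) ▸
      Submodule.smul_mem _ ((-1 : ℝ) ^ ((k + ℓ - δ a) * ℓ)) (f a).2)
  have e3 := E.coe_res_congr hV (sub_add_cancel (δ a) ℓ).symm (Φ a).2
    (toShift ℓ (Φ a)).2 rfl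
  change _ = (-1 : ℝ) ^ ((k - (δ a - ℓ)) * ℓ) •
    E.act V ⟨_, (-1 : ℝ) ^ ((k + ℓ - δ a) * ℓ) • (f a).1, _⟩ (E.res hV ⟨(toShift ℓ (Φ a)).1, _⟩)
  rw [← e2, e1, ← e3, LinearMap.smul_apply, smul_smul, ← zpow_add₀ (by norm_num),
    Even.neg_one_zpow (by
      rw [show (k - (δ a - ℓ)) * ℓ = (k + ℓ - δ a) * ℓ by ring]; exact Even.add_self _), one_smul]

lemma IsGradedVectorBundle.shift (hE : E.IsGradedVectorBundle) (ℓ : ℤ) :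
    (E.shift ℓ).IsGradedVectorBundle := by
  obtain ⟨r, δ, h⟩ := hE.exists_frame
  refine (hE.isModuleSheaf.shift ℓ).isGradedVectorBundle (fun a => δ a - ℓ) fun x => ?_
  obtain ⟨U, hx, Φ, hΦ⟩ := h x
  exact ⟨U, hx, _, IsFrame.shift hE.isModuleSheaf hΦ ℓ⟩

end Shift

section DirectSum

variable {E F : PreBundle M} {U V : Opens X}

/-- A homogeneous section of a direct sum from its components. -/
def pair {k : ℤ} (ψ : E.gr U k) (φ : F.gr U k) : (E.dsum F).gr U k := ⟨(ψ.1, φ.1), ψ.2, φ.2⟩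

lemma existsUnique_pair {k : ℤ} {P : E.gr U k → Prop} {Q : F.gr U k → Prop} (hP : ∃! ψ, P ψ)
    (hQ : ∃! φ, Q φ) : ∃! Ψ : (E.dsum F).gr U k, P ⟨Ψ.1.1, Ψ.2.1⟩ ∧ Q ⟨Ψ.1.2, Ψ.2.2⟩ := by
  obtain ⟨ψ, h1, h2⟩ := hP
  obtain ⟨φ, h3, h4⟩ := hQ
  refine ⟨pair ψ φ, ⟨h1, h3⟩, fun Ψ hΨ => Subtype.ext (Prod.ext ?_ ?_)⟩
  · exact congrArg Subtype.val (h2 _ hΨ.1)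
  · exact congrArg Subtype.val (h4 _ hΨ.2)

lemma pair_eq_iff {k : ℤ} {Ψ Ψ' : (E.dsum F).gr U k} : Ψ = Ψ' ↔
    (⟨Ψ.1.1, Ψ.2.1⟩ : E.gr U k) = ⟨Ψ'.1.1, Ψ'.2.1⟩ ∧
      (⟨Ψ.1.2, Ψ.2.2⟩ : F.gr U k) = ⟨Ψ'.1.2, Ψ'.2.2⟩ := by
  rw [Subtype.ext_iff, Subtype.ext_iff, Subtype.ext_iff, Prod.ext_iff]

lemma IsModuleSheaf.dsum (hE : E.IsModuleSheaf) (hF : F.IsModuleSheaf) :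
    (E.dsum F).IsModuleSheaf where
  act_linear U := by
    refine ⟨fun n a b ha hb => ?_, fun n c a ha => ?_⟩
    · refine LinearMap.ext fun ψ => Prod.ext ?_ ?_
      · exact congrArg (fun T => T ψ.1) ((hE.act_linear U).1 n a b ha hb)
      · exact congrArg (fun T => T ψ.2) ((hF.act_linear U).1 n a b ha hb)
    · refine LinearMap.ext fun ψ => Prod.ext ?_ ?_
      · exact congrArg (fun T => T ψ.1) ((hE.act_linear U).2 n c a ha)
      · exact congrArg (fun T => T ψ.2) ((hF.act_linear U).2 n c a ha)
  one_act U k h ψ hψ := Prod.ext (hE.one_act U k h _ hψ.1) (hF.one_act U k h _ hψ.2)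
  mul_act U f g h k ψ hψ :=
    Prod.ext (hE.mul_act U f g h k _ hψ.1) (hF.mul_act U f g h k _ hψ.2)
  res_add h k ψ φ := pair_eq_iff.2
    ⟨hE.res_add h k ⟨ψ.1.1, ψ.2.1⟩ ⟨φ.1.1, φ.2.1⟩, hF.res_add h k ⟨ψ.1.2, ψ.2.2⟩ ⟨φ.1.2, φ.2.2⟩⟩
  res_smul h k c ψ := pair_eq_iff.2
    ⟨hE.res_smul h k c ⟨ψ.1.1, ψ.2.1⟩, hF.res_smul h k c ⟨ψ.1.2, ψ.2.2⟩⟩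
  res_act h f ψ := Homog.ext' rfl (Prod.ext
    (Homog.mk.inj (hE.res_act h f ⟨ψ.deg, ψ.val.1, ψ.mem.1⟩)).2
    (Homog.mk.inj (hF.res_act h f ⟨ψ.deg, ψ.val.2, ψ.mem.2⟩)).2)
  res_self U k ψ := pair_eq_iff.2
    ⟨hE.res_self U k ⟨ψ.1.1, ψ.2.1⟩, hF.res_self U k ⟨ψ.1.2, ψ.2.2⟩⟩
  res_res h h' k ψ := pair_eq_iff.2
    ⟨hE.res_res h h' k ⟨ψ.1.1, ψ.2.1⟩, hF.res_res h h' k ⟨ψ.1.2, ψ.2.2⟩⟩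
  glue U k ψ h := by
    have := existsUnique_pair
      (hE.glue U k (fun i => ⟨(ψ i).1.1, (ψ i).2.1⟩) fun i j => (pair_eq_iff.1 (h i j)).1)
      (hF.glue U k (fun i => ⟨(ψ i).1.2, (ψ i).2.2⟩) fun i j => (pair_eq_iff.1 (h i j)).2)
    refine (existsUnique_congr fun Ψ => ?_).1 this
    rw [← forall_and]
    exact forall_congr' fun i => (pair_eq_iff (Ψ := (E.dsum F).res (le_iSup U i) Ψ) (Ψ' := ψ i)).symm

/-- Expanding a pair amounts to expanding each component separately; the padding zeros restrict to
zero and contribute nothing across components. -/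
lemma IsFrame.dsum (hE : E.IsModuleSheaf) (hF : F.IsModuleSheaf) {ι κ : Type} [Fintype ι]
    [Fintype κ] {δ : ι → ℤ} {ε : κ → ℤ} {Φ : ∀ a, E.gr U (δ a)} {Ψ : ∀ b, F.gr U (ε b)}
    (hΦ : E.IsFrame Φ) (hΨ : F.IsFrame Ψ) :
    (E.dsum F).IsFrame (ι := ι ⊕ κ) (δ := Sum.elim δ ε)
      (Sum.rec (fun a => pair (Φ a) 0) (fun b => pair 0 (Ψ b))) := by
  intro V hV k ψ
  have h1 := hΦ V hV k ⟨ψ.1.1, ψ.2.1⟩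
  have h2 := hΨ V hV k ⟨ψ.1.2, ψ.2.2⟩
  have h12 : ∃! f : (∀ a, M.gr V (k - δ a)) × (∀ b, M.gr V (k - ε b)),
      (ψ.1.1 = ∑ a, E.act V ⟨k - δ a, f.1 a, (f.1 a).2⟩ (E.res hV (Φ a))) ∧
      (ψ.1.2 = ∑ b, F.act V ⟨k - ε b, f.2 b, (f.2 b).2⟩ (F.res hV (Ψ b))) := by
    obtain ⟨f, hf, hf'⟩ := h1
    obtain ⟨g, hg, hg'⟩ := h2
    exact ⟨(f, g), ⟨hf, hg⟩, fun p hp => Prod.ext (hf' _ hp.1) (hg' _ hp.2)⟩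
  refine ((Equiv.sumPiEquivProdPi (fun a => M.gr V (k - Sum.elim δ ε a))).symm.existsUnique_congr
    fun {f} => ?_).1 h12
  rw [Fintype.sum_sum_type, Prod.ext_iff]
  have z1 : ∀ b, (((E.dsum F).res hV (pair (0 : E.gr U (ε b)) (Ψ b))).1).1 = 0 := fun b =>
    congrArg Subtype.val (hE.res_zero (k := ε b) hV)
  have z2 : ∀ a, (((E.dsum F).res hV (pair (Φ a) (0 : F.gr U (δ a)))).1).2 = 0 := fun a =>
    congrArg Subtype.val (hF.res_zero (k := δ a) hV)
  rw [Prod.fst_add, Prod.snd_add, Prod.fst_sum, Prod.snd_sum, Prod.fst_sum, Prod.snd_sum]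
  refine and_congr (Eq.congr rfl ?_) (Eq.congr rfl ?_)
  · refine Eq.trans ?_ (congrArg₂ (· + ·) rfl (Finset.sum_eq_zero fun b _ => ?_).symm)
    · exact (add_zero _).symm
    · exact (congrArg (E.act V _) (z1 b)).trans (map_zero _)
  · refine Eq.trans ?_ (congrArg₂ (· + ·) (Finset.sum_eq_zero fun a _ => ?_).symm rfl)
    · exact (zero_add _).symm
    · exact (congrArg (F.act V _) (z2 a)).trans (map_zero _)

lemma IsGradedVectorBundle.dsum (hE : E.IsGradedVectorBundle) (hF : F.IsGradedVectorBundle) :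
    (E.dsum F).IsGradedVectorBundle := by
  obtain ⟨r, δ, h⟩ := hE.exists_frame
  obtain ⟨s, ε, h'⟩ := hF.exists_frame
  refine (hE.isModuleSheaf.dsum hF.isModuleSheaf).isGradedVectorBundle (Sum.elim δ ε) fun x => ?_
  obtain ⟨U, hx, Φ, hΦ⟩ := h x
  obtain ⟨U', hx', Ψ, hΨ⟩ := h' x
  exact ⟨U ⊓ U', ⟨hx, hx'⟩, _, IsFrame.dsum hE.isModuleSheaf hF.isModuleSheaf
    (hΦ.restrict hE.isModuleSheaf inf_le_left) (hΨ.restrict hF.isModuleSheaf inf_le_right)⟩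

end DirectSum

end PreBundle

end GradedGeometry

namespace GradedGeometry

/-! ### Smooth functions -/

section Hadamard

variable {H : Type} [NormedAddCommGroup H] [NormedSpace ℝ H] [FiniteDimensional ℝ H]

/-- Differentiation under the integral, dominated by the maximum of the derivative on a closed unit
ball times [0, 1], which is compact since `H` is finite-dimensional. -/
lemma hasFDerivAt_intervalIntegral {E : Type} [NormedAddCommGroup E] [NormedSpace ℝ E]
    {F : H × ℝ → E} (hF : ContDiff ℝ 1 F) (x : H) :
    HasFDerivAt (fun x => ∫ t in (0 : ℝ)..1, F (x, t))
      (∫ t in (0 : ℝ)..1, (fderiv ℝ F (x, t)).comp (ContinuousLinearMap.inl ℝ H ℝ)) x := by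
  have : ProperSpace H := FiniteDimensional.proper ℝ H
  have hc : Continuous fun z : H × ℝ =>
      (fderiv ℝ F z).comp (ContinuousLinearMap.inl ℝ H ℝ) :=
    (hF.continuous_fderiv one_ne_zero).clm_comp continuous_const
  obtain ⟨C, hC⟩ := ((isCompact_closedBall x 1).prod (isCompact_Icc (a := (0 : ℝ)) (b := 1))
    ).exists_bound_of_continuousOn hc.continuousOn
  have hcx : ∀ y : H, Continuous fun t : ℝ => F (y, t) := fun y =>
    hF.continuous.comp (Continuous.prodMk_right y)
  refine intervalIntegral.hasFDerivAt_integral_of_dominated_of_fderiv_le (bound := fun _ => C)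
    (F' := fun y t => (fderiv ℝ F (y, t)).comp (ContinuousLinearMap.inl ℝ H ℝ))
    (Metric.closedBall_mem_nhds x one_pos)
    (Filter.Eventually.of_forall fun y => (hcx y).aestronglyMeasurable)
    ((hcx x).intervalIntegrable 0 1)
    ((hc.comp (Continuous.prodMk_right x)).aestronglyMeasurable)
    (Filter.Eventually.of_forall fun t ht y hy => hC (y, t) ⟨hy, ?_⟩)
    intervalIntegrable_const (Filter.Eventually.of_forall fun t _ y _ => ?_)
  · rw [Set.uIoc_of_le zero_le_one] at ht
    exact ⟨ht.1.le, ht.2⟩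
  · have h1 := ((hF.differentiable one_ne_zero) (y, t)).hasFDerivAt
    exact h1.comp y (hasFDerivAt_prodMk_left y t)

/-- Induction on the order for all target spaces at once, because the derivative takes values in
another space. -/
lemma contDiff_intervalIntegral {E : Type} [NormedAddCommGroup E] [NormedSpace ℝ E] (n : ℕ)
    {F : H × ℝ → E} (hF : ContDiff ℝ n F) :
    ContDiff ℝ n fun x => ∫ t in (0 : ℝ)..1, F (x, t) := by
  induction n generalizing E with
  | zero =>
    refine contDiff_zero.2 ?_
    exact intervalIntegral.continuous_parametric_intervalIntegral_of_continuous'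
      (f := fun x t => F (x, t)) hF.continuous 0 1
  | succ n ih =>
    have h1 : ContDiff ℝ 1 F := hF.of_le (by norm_cast; omega)
    refine contDiff_succ_iff_hasFDerivAt.2 ⟨_, ih (F := fun z => (fderiv ℝ F z).comp
      (ContinuousLinearMap.inl ℝ H ℝ)) ?_, hasFDerivAt_intervalIntegral h1⟩
    exact (hF.fderiv_right (m := n) le_rfl).clm_comp contDiff_const

/-- Hadamard's lemma. -/
lemma exists_hadamard {F : H → ℝ} (hF : ContDiff ℝ ((⊤ : ℕ∞) : WithTop ℕ∞) F) (y : H) :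
    ∃ G : H → (H →L[ℝ] ℝ), ContDiff ℝ ((⊤ : ℕ∞) : WithTop ℕ∞) G ∧
      ∀ x, F x = F y + G x (x - y) := by
  have hF' : ContDiff ℝ ((⊤ : ℕ∞) : WithTop ℕ∞) (fderiv ℝ F) :=
    hF.fderiv_right (m := ((⊤ : ℕ∞) : WithTop ℕ∞)) (by norm_cast)
  have hg : ContDiff ℝ ((⊤ : ℕ∞) : WithTop ℕ∞)
      fun z : H × ℝ => fderiv ℝ F (y + z.2 • (z.1 - y)) :=
    hF'.comp (contDiff_const.add (contDiff_snd.smul (contDiff_fst.sub contDiff_const)))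
  -- The average of the derivative along the segment from `y` to `x`; the identity is the
  -- fundamental theorem of calculus on that segment.
  refine ⟨fun x => ∫ t in (0 : ℝ)..1, fderiv ℝ F (y + t • (x - y)),
    contDiff_infty.2 fun n => contDiff_intervalIntegral n (contDiff_infty.1 hg n), fun x => ?_⟩
  have hc : Continuous fun t : ℝ => fderiv ℝ F (y + t • (x - y)) :=
    hF'.continuous.comp (by fun_prop)
  have hd : ∀ t ∈ Set.uIcc (0 : ℝ) 1, HasDerivAt (fun t : ℝ => F (y + t • (x - y)))
      (fderiv ℝ F (y + t • (x - y)) (x - y)) t := fun t _ => by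
    refine (hF.differentiable (by norm_num) _).hasFDerivAt.comp_hasDerivAt t ?_
    simpa using ((hasDerivAt_id t).smul_const (x - y)).const_add y
  have := intervalIntegral.integral_eq_sub_of_hasDerivAt hd
    ((hc.clm_apply continuous_const).intervalIntegrable 0 1)
  rw [ContinuousLinearMap.intervalIntegral_apply (hc.intervalIntegrable 0 1), this]
  simp

end Hadamard

namespace GDim

variable {n : GDim} {W : Opens n.Base}

open Classical in
/-- The extension by zero of a function on an open set. -/
noncomputable def extend (f : n.Smooth W) (x : n.Base) : ℝ := if h : x ∈ W then f ⟨x, h⟩ else 0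

lemma extend_of_mem (f : n.Smooth W) {x : n.Base} (h : x ∈ W) : extend f x = f ⟨x, h⟩ :=
  dif_pos h

lemma contDiffOn_extend (f : n.Smooth W) :
    ContDiffOn ℝ ((⊤ : ℕ∞) : WithTop ℕ∞) (extend f) W := by
  intro x hx
  refine ContDiffAt.contDiffWithinAt ?_
  have h := f.contMDiff ⟨x, hx⟩
  have e : (f : W → ℝ) = fun y : W => extend f y := funext fun y => (extend_of_mem f y.2).symm
  rw [e] at h
  exact contMDiffAt_iff_contDiffAt.1 (contMDiffAt_subtype_iff.1 h)

lemma differentiableAt_extend (f : n.Smooth W) (x : W) : DifferentiableAt ℝ (extend f) x :=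
  ((contDiffOn_extend f).contDiffAt (W.isOpen.mem_nhds x.2)).differentiableAt (by norm_num)

/-- The partial derivatives of smooth functions. -/
noncomputable def pderiv (i : Fin n.n₀) : n.Smooth W →ₗ[ℝ] n.Smooth W where
  toFun f := smoothOfContDiffOn (fun x => fderiv ℝ (extend f) x (EuclideanSpace.single i 1))
    (((contDiffOn_extend f).fderiv_of_isOpen W.isOpen (by norm_cast)).clm_apply contDiffOn_const)
  map_add' f g := by
    ext x
    have e : (extend (f + g)) =ᶠ[nhds (x : n.Base)] extend f + extend g := by
      filter_upwards [W.isOpen.mem_nhds x.2] with y hy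
      rw [Pi.add_apply, extend_of_mem _ hy, extend_of_mem _ hy, extend_of_mem _ hy]; rfl
    change fderiv ℝ (extend (f + g)) x _ = fderiv ℝ (extend f) x _ + fderiv ℝ (extend g) x _
    rw [e.fderiv_eq, fderiv_add (differentiableAt_extend f x) (differentiableAt_extend g x)]
    rfl
  map_smul' c f := by
    ext x
    have e : (extend (c • f)) =ᶠ[nhds (x : n.Base)] c • extend f := by
      filter_upwards [W.isOpen.mem_nhds x.2] with y hy
      rw [Pi.smul_apply, extend_of_mem _ hy, extend_of_mem _ hy]; rfl
    change fderiv ℝ (extend (c • f)) x _ = c • fderiv ℝ (extend f) x _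
    rw [e.fderiv_eq, fderiv_const_smul (differentiableAt_extend f x)]
    rfl

lemma pderiv_apply (i : Fin n.n₀) (f : n.Smooth W) (x : W) :
    pderiv i f x = fderiv ℝ (extend f) x (EuclideanSpace.single i 1) := rfl

lemma pderiv_mul (i : Fin n.n₀) (f g : n.Smooth W) :
    pderiv i (f * g) = pderiv i f * g + f * pderiv i g := by
  ext x
  have e : (extend (f * g)) =ᶠ[nhds (x : n.Base)] extend f * extend g := by
    filter_upwards [W.isOpen.mem_nhds x.2] with y hy
    rw [Pi.mul_apply, extend_of_mem _ hy, extend_of_mem _ hy, extend_of_mem _ hy]; rfl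
  change fderiv ℝ (extend (f * g)) x _ = fderiv ℝ (extend f) x _ * g x +
    f x * fderiv ℝ (extend g) x _
  rw [e.fderiv_eq, fderiv_mul (differentiableAt_extend f x) (differentiableAt_extend g x),
    extend_of_mem _ x.2, extend_of_mem _ x.2]
  change f x * fderiv ℝ (extend g) x (EuclideanSpace.single i 1) +
    g x * fderiv ℝ (extend f) x (EuclideanSpace.single i 1) = _
  ring

/-- The coordinate functions. -/
noncomputable def proj (W : Opens n.Base) (i : Fin n.n₀) : n.Smooth W :=
  smoothOfContDiffOn (fun x => x i) (by fun_prop)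

lemma pderiv_proj (i j : Fin n.n₀) : pderiv i (proj W j) = if i = j then 1 else 0 := by
  ext x
  have e : (extend (proj W j)) =ᶠ[nhds (x : n.Base)]
      (EuclideanSpace.proj j : n.Base →L[ℝ] ℝ) := by
    filter_upwards [W.isOpen.mem_nhds x.2] with y hy
    rw [extend_of_mem _ hy]; rfl
  rw [pderiv_apply, e.fderiv_eq, ContinuousLinearMap.fderiv]
  split_ifs with h
  · subst h
    simp
  · change (EuclideanSpace.single i (1 : ℝ)).ofLp j = 0
    rw [PiLp.single_apply, if_neg (Ne.symm h)]

lemma pderiv_const (i : Fin n.n₀) : pderiv i (1 : n.Smooth W) = 0 := by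
  have := pderiv_mul i (1 : n.Smooth W) 1
  rwa [mul_one, mul_one, one_mul, left_eq_add] at this

/-- Hadamard's lemma on an open set, for functions with compact support. -/
lemma exists_smooth_hadamard (y : W) : ∃ b : n.Smooth W, b y = 1 ∧ ∀ f : n.Smooth W,
    ∃ g : Fin n.n₀ → n.Smooth W, ∀ x : W,
      b x * f x = f y + ∑ i, ((x : n.Base) i - (y : n.Base) i) * g i x := by
  obtain ⟨r, hr, hrW⟩ := Metric.nhds_basis_closedBall.mem_iff.1 (W.isOpen.mem_nhds y.2)
  -- Segments from `y` may leave `W` and `f` need not extend; the product with a bump function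
  -- supported in `W` is smooth on the whole space.
  let b : ContDiffBump (y : n.Base) := ⟨r / 2, r, by positivity, by linarith⟩
  have hb1 : b (y : n.Base) = 1 := b.one_of_mem_closedBall (Metric.mem_closedBall_self (by positivity))
  refine ⟨smoothOfContDiffOn b b.contDiff.contDiffOn, hb1, fun f => ?_⟩
  have hF : ContDiff ℝ ((⊤ : ℕ∞) : WithTop ℕ∞) fun x => b x * extend f x := by
    refine contDiff_iff_contDiffAt.2 fun x => ?_
    by_cases hx : x ∈ Metric.closedBall (y : n.Base) r
    · exact b.contDiff.contDiffAt.mul ((contDiffOn_extend f).contDiffAt (W.isOpen.mem_nhds (hrW hx)))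
    · refine (contDiffAt_const (c := (0 : ℝ))).congr_of_eventuallyEq ?_
      filter_upwards [Metric.isClosed_closedBall.isOpen_compl.mem_nhds hx] with z hz
      rw [b.zero_of_le_dist (not_le.1 fun h => hz (Metric.mem_closedBall.2 h)).le, zero_mul]
  obtain ⟨G, hG, hGF⟩ := exists_hadamard hF (y : n.Base)
  refine ⟨fun i => smoothOfContDiffOn (fun x => G x (EuclideanSpace.single i 1))
    (hG.clm_apply contDiff_const).contDiffOn, fun x => ?_⟩
  have h := hGF x
  rw [extend_of_mem _ x.2, extend_of_mem _ y.2, hb1, one_mul] at h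
  refine h.trans (congrArg _ ?_)
  have hz : ∀ z : n.Base, z = ∑ i, z i • EuclideanSpace.single i (1 : ℝ) := fun z => by
    ext j
    simp [Pi.single_apply]
  conv_lhs => rw [hz ((x : n.Base) - y)]
  rw [map_sum]
  refine Finset.sum_congr rfl fun i _ => ?_
  rw [map_smul]
  rfl

end GDim

end GradedGeometry

namespace GradedGeometry

/-! ### Derivations of formal power series -/

namespace GDim

variable {n : GDim} {W : Opens n.Base}

lemma reorderSign_add_left (q q' r : Fin n.s → ℕ) :
    n.reorderSign (q + q') r = n.reorderSign q r * n.reorderSign q' r := by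
  rw [reorderSign, reorderSign, reorderSign, ← zpow_add₀ (by norm_num)]
  congr 1
  rw [← Finset.sum_add_distrib]
  refine Finset.sum_congr rfl fun μ _ => ?_
  rw [← Finset.sum_add_distrib]
  refine Finset.sum_congr rfl fun ν _ => ?_
  split_ifs
  · rw [Pi.add_apply]; push_cast; ring
  · simp

lemma reorderSign_add_right (q r r' : Fin n.s → ℕ) :
    n.reorderSign q (r + r') = n.reorderSign q r * n.reorderSign q r' := by
  rw [reorderSign, reorderSign, reorderSign, ← zpow_add₀ (by norm_num)]
  congr 1
  rw [← Finset.sum_add_distrib]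
  refine Finset.sum_congr rfl fun μ _ => ?_
  rw [← Finset.sum_add_distrib]
  refine Finset.sum_congr rfl fun ν _ => ?_
  split_ifs
  · rw [Pi.add_apply]; push_cast; ring
  · simp

lemma reorderSign_mul_self (q r : Fin n.s → ℕ) : n.reorderSign q r * n.reorderSign q r = 1 := by
  rw [reorderSign, ← zpow_add₀ (by norm_num)]
  exact Even.neg_one_zpow (Even.add_self _)

lemma reorderSign_single_left (μ : Fin n.s) (r : Fin n.s → ℕ) :
    n.reorderSign (Pi.single μ 1) r =
      (-1 : ℝ) ^ (∑ ν, if ν < μ then n.deg μ * ((r ν : ℤ) * n.deg ν) else 0) := by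
  rw [reorderSign]
  congr 1
  refine Finset.sum_congr rfl fun ν _ => ?_
  rw [Finset.sum_eq_single μ]
  · simp
  · intro κ _ hκ
    simp [hκ]
  · simp

lemma reorderSign_single_right (μ : Fin n.s) (q : Fin n.s → ℕ) :
    n.reorderSign q (Pi.single μ 1) =
      (-1 : ℝ) ^ (∑ ν, if μ < ν then n.deg μ * ((q ν : ℤ) * n.deg ν) else 0) := by
  rw [reorderSign]
  congr 1
  rw [Finset.sum_eq_single μ]
  · refine Finset.sum_congr rfl fun ν _ => ?_
    simp [mul_comm]
  · intro κ _ hκ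
    simp [hκ]
  · simp

lemma reorderSign_zero_right (q : Fin n.s → ℕ) : n.reorderSign q 0 = 1 := by
  simp [reorderSign]

/-- Moving ξ_μ across ξ^q passes every factor ξ_ν with ν ≠ μ. Relative to the full Koszul sign the
factors ξ_μ themselves are missing, which accounts for the correction q_μ |ξ_μ|. -/
lemma reorderSign_swap (μ : Fin n.s) (q : Fin n.s → ℕ) :
    n.reorderSign (Pi.single μ 1) q * n.reorderSign q (Pi.single μ 1) =
      (-1 : ℝ) ^ (n.deg μ * n.weight q + q μ * n.deg μ) := by
  rw [reorderSign_single_left, reorderSign_single_right, ← zpow_add₀ (by norm_num),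
    ← Finset.sum_add_distrib]
  have h : (∑ ν, ((if ν < μ then n.deg μ * ((q ν : ℤ) * n.deg ν) else 0) +
      if μ < ν then n.deg μ * ((q ν : ℤ) * n.deg ν) else 0)) =
      n.deg μ * n.weight q - n.deg μ * (q μ * n.deg μ) := by
    rw [eq_sub_iff_add_eq, weight, Finset.mul_sum,
      ← Finset.add_sum_erase _ _ (Finset.mem_univ μ), ← Finset.add_sum_erase _ _ (Finset.mem_univ μ)]
    simp only [lt_self_iff_false, if_false, zero_add]
    rw [add_comm]
    congr 1
    refine Finset.sum_congr rfl fun ν hν => ?_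
    rcases lt_or_gt_of_ne (Finset.ne_of_mem_erase hν) with h | h
    · rw [if_pos h, if_neg h.asymm, add_zero]
    · rw [if_neg h.asymm, if_pos h, zero_add]
  rw [h]
  refine neg_one_zpow_congr ?_
  push_cast
  generalize (n.deg μ : ZMod 2) = x, ((n.weight q : ℤ) : ZMod 2) = y, ((q μ : ℕ) : ZMod 2) = z
  revert x y z; decide

lemma weight_add (p q : Fin n.s → ℕ) : n.weight (p + q) = n.weight p + n.weight q := by
  simp [weight, add_mul, Finset.sum_add_distrib]

lemma weight_single (μ : Fin n.s) : n.weight (Pi.single μ 1) = n.deg μ := by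
  rw [weight, Finset.sum_eq_single μ]
  · simp
  · intro ν _ h; simp [h]
  · simp

lemma Admissible.mono {p q : Fin n.s → ℕ} (hp : n.Admissible p) (h : q ≤ p) : n.Admissible q :=
  fun μ hμ => (h μ).trans (hp μ hμ)

lemma admissible_single (μ : Fin n.s) : n.Admissible (Pi.single μ 1) := fun ν _ => by
  by_cases h : ν = μ
  · subst h; simp
  · simp [h]

lemma IsHomogeneous.weight_eq {k : ℤ} {f : n.Series W} (hf : n.IsHomogeneous k f)
    {p : Fin n.s → ℕ} (h : f p ≠ 0) : n.weight p = k := (hf p h).2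

lemma mul_apply_of_admissible (f g : n.Series W) {p : Fin n.s → ℕ} (hp : n.Admissible p) :
    n.mul f g p = ∑ q ∈ Finset.Iic p, n.reorderSign q (p - q) • (f q * g (p - q)) := if_pos hp

lemma mul_apply_of_not_admissible (f g : n.Series W) {p : Fin n.s → ℕ} (hp : ¬n.Admissible p) :
    n.mul f g p = 0 := if_neg hp

/-- The coefficientwise partial derivatives `∂/∂x^i`. -/
noncomputable def evenDeriv (i : Fin n.n₀) : n.Series W →ₗ[ℝ] n.Series W :=
  LinearMap.pi fun p => pderiv i ∘ₗ LinearMap.proj p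

lemma evenDeriv_apply (i : Fin n.n₀) (f : n.Series W) (p : Fin n.s → ℕ) :
    evenDeriv i f p = pderiv i (f p) := rfl

/-- The partial derivatives `∂/∂ξ_μ`. -/
noncomputable def xiDeriv (μ : Fin n.s) : n.Series W →ₗ[ℝ] n.Series W :=
  -- Left derivative: the monomial with exponent p + e_μ is first written as a sign times ξ_μ ξ^p,
  -- and the power rule gives p_μ + 1.
  LinearMap.pi fun p => ((p μ + 1) * n.reorderSign (Pi.single μ 1) p) •
    LinearMap.proj (p + Pi.single μ 1)

lemma xiDeriv_apply (μ : Fin n.s) (f : n.Series W) (p : Fin n.s → ℕ) :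
    xiDeriv μ f p = ((p μ + 1) * n.reorderSign (Pi.single μ 1) p) • f (p + Pi.single μ 1) := rfl

lemma evenDeriv_mul (i : Fin n.n₀) (f g : n.Series W) :
    evenDeriv i (n.mul f g) = n.mul (evenDeriv i f) g + n.mul f (evenDeriv i g) := by
  funext p
  rw [Pi.add_apply, evenDeriv_apply]
  by_cases hp : n.Admissible p
  · rw [mul_apply_of_admissible _ _ hp, mul_apply_of_admissible _ _ hp,
      mul_apply_of_admissible _ _ hp, map_sum, ← Finset.sum_add_distrib]
    refine Finset.sum_congr rfl fun q _ => ?_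
    rw [map_smul, pderiv_mul, smul_add]
    rfl
  · rw [mul_apply_of_not_admissible _ _ hp, mul_apply_of_not_admissible _ _ hp,
      mul_apply_of_not_admissible _ _ hp, map_zero, add_zero]

/-- Substituting q + e_μ for q matches the sums; the indices of the larger range that are missed
have q_μ = 0 and so a zero coefficient. -/
lemma sum_xiDeriv_mul (μ : Fin n.s) (f g : n.Series W) (p : Fin n.s → ℕ) :
    ∑ q ∈ Finset.Iic p, n.reorderSign q (p - q) • (xiDeriv μ f q * g (p - q)) =
      ∑ q ∈ Finset.Iic (p + Pi.single μ 1), (n.reorderSign (Pi.single μ 1) p * q μ *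
        n.reorderSign q (p + Pi.single μ 1 - q)) • (f q * g (p + Pi.single μ 1 - q)) := by
  refine Finset.sum_of_injOn (· + Pi.single μ 1) (fun a _ b _ h => add_right_cancel h)
    (fun q hq => ?_) (fun q hq hq' => ?_) fun q hq => ?_
  · simp only [Finset.coe_Iic, Set.mem_Iic] at hq ⊢
    gcongr
  · have : q μ = 0 := by
      by_contra h0
      refine hq' ⟨q - Pi.single μ 1, ?_, ?_⟩
      · simp only [Finset.coe_Iic, Set.mem_Iic]
        exact tsub_le_iff_right.2 (Finset.mem_Iic.1 hq)
      · refine tsub_add_cancel_of_le fun ν => ?_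
        by_cases h : ν = μ
        · subst h; simpa using Nat.one_le_iff_ne_zero.2 h0
        · simp [h]
    rw [this]; simp
  · obtain ⟨r, rfl⟩ : ∃ r, p = q + r := ⟨p - q, (add_tsub_cancel_of_le (Finset.mem_Iic.1 hq)).symm⟩
    rw [add_tsub_cancel_left, add_right_comm, add_tsub_cancel_left, xiDeriv_apply, smul_mul_assoc,
      smul_smul, reorderSign_add_left, reorderSign_add_right, Pi.add_apply, Pi.single_eq_same]
    congr 1
    push_cast
    linear_combination (-(n.reorderSign q r * (q μ + 1) * n.reorderSign (Pi.single μ 1) q)) *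
      reorderSign_mul_self (n := n) (Pi.single μ 1) r

/-- Here q stays fixed, and the extra indices have q_μ = p_μ + 1, where the factor vanishes. The
sign of moving the derivative past `f` becomes a power of -1 in q_μ |ξ_μ| by `reorderSign_swap`. -/
lemma sum_mul_xiDeriv (μ : Fin n.s) {k : ℤ} {f : n.Series W} (hf : n.IsHomogeneous k f)
    (g : n.Series W) (p : Fin n.s → ℕ) :
    (-1 : ℝ) ^ (-n.deg μ * k) •
      ∑ q ∈ Finset.Iic p, n.reorderSign q (p - q) • (f q * xiDeriv μ g (p - q)) =
      ∑ q ∈ Finset.Iic (p + Pi.single μ 1), (n.reorderSign (Pi.single μ 1) p *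
        ((-1 : ℝ) ^ (q μ * n.deg μ) * ((p μ + 1 : ℝ) - q μ)) *
        n.reorderSign q (p + Pi.single μ 1 - q)) • (f q * g (p + Pi.single μ 1 - q)) := by
  rw [Finset.smul_sum]
  refine Finset.sum_of_injOn id (fun a _ b _ h => h)
    (fun q hq => ?_) (fun q hq hq' => ?_) fun q hq => ?_
  · simp only [Finset.coe_Iic, Set.mem_Iic, id] at hq ⊢
    exact hq.trans le_self_add
  · have : q μ = p μ + 1 := by
      have h1 := Finset.mem_Iic.1 hq
      by_contra h0
      refine hq' ⟨q, ?_, rfl⟩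
      simp only [Finset.coe_Iic, Set.mem_Iic]
      intro ν
      have h2 := h1 ν
      by_cases h : ν = μ
      · subst h
        rw [Pi.add_apply, Pi.single_eq_same] at h2
        exact Nat.le_of_lt_succ (lt_of_le_of_ne h2 h0)
      · simpa [h] using h2
    rw [this]; simp
  · by_cases h0 : f q = 0
    · simp [h0]
    obtain ⟨r, rfl⟩ : ∃ r, p = q + r := ⟨p - q, (add_tsub_cancel_of_le (Finset.mem_Iic.1 hq)).symm⟩
    rw [id, add_tsub_cancel_left, add_assoc, add_tsub_cancel_left, xiDeriv_apply, mul_smul_comm,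
      smul_smul, smul_smul, reorderSign_add_right, reorderSign_add_right, Pi.add_apply]
    congr 1
    have h1 := reorderSign_swap μ q
    rw [hf.weight_eq h0, zpow_add₀ (by norm_num)] at h1
    have h2 : (-1 : ℝ) ^ (q μ * n.deg μ) * (-1 : ℝ) ^ (q μ * n.deg μ) = 1 := by
      rw [← zpow_add₀ (by norm_num)]
      exact Even.neg_one_zpow (Even.add_self _)
    have h3 : (-1 : ℝ) ^ (-n.deg μ * k) = (-1 : ℝ) ^ (n.deg μ * k) := by
      rw [neg_mul, zpow_neg, ← inv_zpow]; norm_num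
    rw [h3]
    push_cast
    linear_combination (-(n.reorderSign q r * (r μ + 1) * n.reorderSign (Pi.single μ 1) r *
      (-1 : ℝ) ^ (n.deg μ * k))) * h2 - (n.reorderSign q r * (r μ + 1) *
        n.reorderSign (Pi.single μ 1) r * (-1 : ℝ) ^ (q μ * n.deg μ)) * h1

lemma xiDeriv_mul (μ : Fin n.s) {i j : ℤ} {f g : n.Series W} (hf : n.IsHomogeneous i f)
    (hg : n.IsHomogeneous j g) :
    xiDeriv μ (n.mul f g) =
      n.mul (xiDeriv μ f) g + (-1 : ℝ) ^ (-n.deg μ * i) • n.mul f (xiDeriv μ g) := by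
  funext p
  rw [Pi.add_apply, Pi.smul_apply, xiDeriv_apply]
  by_cases hp : n.Admissible p
  · rw [mul_apply_of_admissible _ _ hp, mul_apply_of_admissible _ _ hp, sum_xiDeriv_mul,
      sum_mul_xiDeriv μ hf, ← Finset.sum_add_distrib]
    -- The sum of the two coefficients does not depend on q. For even ξ_μ it is p_μ + 1; for odd ξ_μ
    -- it is 1 if p_μ = 0, and if p_μ = 1 then q_μ = 1 and it is 0, as ξ_μ² = 0 demands.
    have key : ∀ q ∈ Finset.Iic (p + Pi.single μ 1), f q * g (p + Pi.single μ 1 - q) ≠ 0 →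
        (q μ : ℝ) + (-1 : ℝ) ^ (q μ * n.deg μ) * ((p μ + 1 : ℝ) - q μ) =
          open Classical in if n.Admissible (p + Pi.single μ 1) then (p μ + 1 : ℝ) else 0 := by
      intro q hq h0
      have a1 := (hf q (left_ne_zero_of_mul h0)).1 μ
      have a2 := (hg _ (right_ne_zero_of_mul h0)).1 μ
      have a3 := Finset.mem_Iic.1 hq μ
      rw [Pi.sub_apply, Pi.add_apply, Pi.single_eq_same] at a2
      rw [Pi.add_apply, Pi.single_eq_same] at a3
      have hadm : n.Admissible (p + Pi.single μ 1) ↔ (Odd (n.deg μ) → p μ = 0) := by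
        refine ⟨fun h ho => ?_, fun h ν hν => ?_⟩
        · have := h μ ho
          rw [Pi.add_apply, Pi.single_eq_same] at this
          omega
        · by_cases e : ν = μ
          · subst e; simp [h hν]
          · simpa [e] using hp ν hν
      rcases Int.even_or_odd (n.deg μ) with he | ho
      · rw [if_pos (hadm.2 fun ho => absurd he (Int.not_even_iff_odd.2 ho)),
          Even.neg_one_zpow (he.mul_left _)]
        ring
      · replace a1 := a1 ho
        replace a2 := a2 ho
        have hp1 := hp μ ho
        by_cases hpμ : p μ = 0
        · rw [if_pos (hadm.2 fun _ => hpμ)]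
          interval_cases h : q μ
          · simp
          · simp [hpμ]
        · have e1 : p μ = 1 := by omega
          have e2 : q μ = 1 := by omega
          rw [if_neg fun h => hpμ (hadm.1 h ho), e1, e2, Nat.cast_one, Nat.cast_one, one_mul, ho.neg_one_zpow]
          norm_num
    have key' : ∀ q ∈ Finset.Iic (p + Pi.single μ 1),
        ((n.reorderSign (Pi.single μ 1) p * q μ *
          n.reorderSign q (p + Pi.single μ 1 - q)) • (f q * g (p + Pi.single μ 1 - q)) +
        (n.reorderSign (Pi.single μ 1) p *
          ((-1 : ℝ) ^ (q μ * n.deg μ) * ((p μ + 1 : ℝ) - q μ)) *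
          n.reorderSign q (p + Pi.single μ 1 - q)) • (f q * g (p + Pi.single μ 1 - q))) =
        (n.reorderSign (Pi.single μ 1) p * open Classical in
          if n.Admissible (p + Pi.single μ 1) then (p μ + 1 : ℝ) else 0) •
          n.reorderSign q (p + Pi.single μ 1 - q) • (f q * g (p + Pi.single μ 1 - q)) := by
      intro q hq
      by_cases h0 : f q * g (p + Pi.single μ 1 - q) = 0
      · simp [h0]
      · rw [← key q hq h0, ← add_smul, smul_smul]
        congr 1
        ring
    rw [Finset.sum_congr rfl key', ← Finset.smul_sum]
    by_cases hs : n.Admissible (p + Pi.single μ 1)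
    · rw [if_pos hs, mul_apply_of_admissible _ _ hs, mul_comm]
    · rw [if_neg hs, mul_apply_of_not_admissible _ _ hs, mul_zero, zero_smul, smul_zero]
  · rw [mul_apply_of_not_admissible _ _ hp, mul_apply_of_not_admissible _ _ hp,
      mul_apply_of_not_admissible _ _ fun h => hp (h.mono le_self_add), smul_zero, smul_zero,
      add_zero]

/-! ### Coordinates and partial derivatives -/

/-- The degrees of the coordinates. -/
def coordDeg (n : GDim) : Fin n.n₀ ⊕ Fin n.s → ℤ := Sum.elim (fun _ => 0) n.deg

/-- The coordinates as power series. -/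
noncomputable def coordSeries (W : Opens n.Base) : Fin n.n₀ ⊕ Fin n.s → n.Series W :=
  Sum.elim (fun i => monomial 0 (proj W i)) fun μ => monomial (Pi.single μ 1) 1

/-- The partial derivatives on power series. -/
noncomputable def coordDeriv (W : Opens n.Base) :
    Fin n.n₀ ⊕ Fin n.s → (n.Series W →ₗ[ℝ] n.Series W) :=
  Sum.elim (fun i => evenDeriv i) fun μ => xiDeriv μ

lemma coordSeries_isHomogeneous (a : Fin n.n₀ ⊕ Fin n.s) :
    n.IsHomogeneous (n.coordDeg a) (coordSeries W a) := by
  rcases a with i | μ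
  · exact monomial_isHomogeneous admissible_zero _ weight_zero
  · exact monomial_isHomogeneous (admissible_single μ) _ (weight_single μ)

lemma coordDeriv_isHomogeneous (a : Fin n.n₀ ⊕ Fin n.s) {k : ℤ} {f : n.Series W}
    (hf : n.IsHomogeneous k f) : n.IsHomogeneous (k + -n.coordDeg a) (coordDeriv W a f) := by
  intro p hp
  rcases a with i | μ
  · have h : f p ≠ 0 := fun h => hp (by
      change pderiv i (f p) = 0
      rw [h, map_zero])
    exact ⟨(hf p h).1, (hf p h).2.trans (by simp [coordDeg])⟩
  · have h : f (p + Pi.single μ 1) ≠ 0 := fun h => hp (by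
      change xiDeriv μ f p = 0
      rw [xiDeriv_apply, h, smul_zero])
    refine ⟨(hf _ h).1.mono le_self_add, ?_⟩
    have := (hf _ h).2
    rw [weight_add, weight_single] at this
    change _ = k + -n.deg μ
    omega

lemma coordDeriv_mul (a : Fin n.n₀ ⊕ Fin n.s) {i j : ℤ} {f g : n.Series W}
    (hf : n.IsHomogeneous i f) (hg : n.IsHomogeneous j g) :
    coordDeriv W a (n.mul f g) =
      n.mul (coordDeriv W a f) g + (-1 : ℝ) ^ (-n.coordDeg a * i) • n.mul f (coordDeriv W a g) := by
  rcases a with l | μ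
  · refine (evenDeriv_mul l f g).trans ?_
    simp [coordDeg, coordDeriv]
  · exact xiDeriv_mul μ hf hg

lemma coordDeriv_coordSeries (a b : Fin n.n₀ ⊕ Fin n.s) :
    coordDeriv W a (coordSeries W b) = if a = b then n.one W else 0 := by
  funext p
  rcases a with i | μ <;> rcases b with j | ν
  · change pderiv i (monomial 0 (proj W j) p) = _
    by_cases hp : p = 0
    · subst hp
      by_cases h : i = j <;> simp [monomial, one, h, pderiv_proj]
    · by_cases h : i = j <;> simp [monomial, one, h, hp]
  · change pderiv i (monomial (Pi.single ν 1) 1 p) = _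
    by_cases hp : p = Pi.single ν 1 <;> simp [monomial, hp, pderiv_const]
  · change xiDeriv μ (monomial 0 (proj W j)) p = _
    rw [xiDeriv_apply, monomial, if_neg fun h => by simpa using congrFun h μ]
    simp
  · change xiDeriv μ (monomial (Pi.single ν 1) 1) p = _
    rw [xiDeriv_apply, monomial]
    by_cases h : μ = ν
    · subst h
      by_cases hp : p = 0
      · subst hp
        simp [one, reorderSign_zero_right]
      · simp [one, hp]
    · rw [if_neg fun e => by simpa [h] using congrFun e μ]
      simp [h]

end GDim

end GradedGeometry

namespace GradedGeometry

/-! ### Coordinate expansions of power series -/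

namespace GDim

variable {n : GDim} {W : Opens n.Base}

lemma smooth_sum_apply {ι : Type*} (t : Finset ι) (f : ι → n.Smooth W) (x : W) :
    (∑ i ∈ t, f i) x = ∑ i ∈ t, f i x :=
  map_sum (⟨⟨fun f => f x, rfl⟩, fun _ _ => rfl⟩ : n.Smooth W →+ ℝ) f t

lemma monomial_zero_mul (a : n.Smooth W) (g : n.Series W) (p : Fin n.s → ℕ)
    (hp : n.Admissible p) : n.mul (monomial 0 a) g p = a * g p := by
  rw [mul_apply_of_admissible _ _ hp, Finset.sum_eq_single 0]
  · simp [monomial, reorderSign]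
  · intro q _ hq
    simp [monomial, hq]
  · simp

lemma single_mul_of_le (μ : Fin n.s) (g : n.Series W) {p : Fin n.s → ℕ}
    (hp : n.Admissible p) (h : (Pi.single μ 1 : Fin _ → ℕ) ≤ p) :
    n.mul (monomial (Pi.single μ 1) 1) g p =
      n.reorderSign (Pi.single μ 1) (p - Pi.single μ 1) • g (p - Pi.single μ 1) := by
  rw [mul_apply_of_admissible _ _ hp, Finset.sum_eq_single (Pi.single μ 1)]
  · simp [monomial]
  · intro q _ hq
    simp [monomial, hq]
  · intro h'
    exact absurd (Finset.mem_Iic.2 h) h'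

lemma single_mul_of_not_le (μ : Fin n.s) (g : n.Series W) {p : Fin n.s → ℕ}
    (h : ¬(Pi.single μ 1 : Fin _ → ℕ) ≤ p) : n.mul (monomial (Pi.single μ 1) 1) g p = 0 := by
  by_cases hp : n.Admissible p
  · rw [mul_apply_of_admissible _ _ hp]
    refine Finset.sum_eq_zero fun q hq => ?_
    rw [monomial, if_neg fun e => h (by rw [← e]; exact Finset.mem_Iic.1 hq), zero_mul, smul_zero]
  · exact mul_apply_of_not_admissible _ _ hp

lemma single_le_iff (μ : Fin n.s) (p : Fin n.s → ℕ) : (Pi.single μ 1 : Fin _ → ℕ) ≤ p ↔ p μ ≠ 0 := by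
  refine ⟨fun h => ?_, fun h ν => ?_⟩
  · have := h μ
    rw [Pi.single_eq_same] at this
    exact Nat.one_le_iff_ne_zero.1 this
  · by_cases e : ν = μ
    · subst e; simpa using Nat.one_le_iff_ne_zero.2 h
    · simp [e]

open Classical in
/-- The part of a power series without `ξ_ν` for `ν < μ`, divided by `ξ_μ`. -/
noncomputable def tail (μ : Fin n.s) (f : n.Series W) : n.Series W := fun p =>
  if ∀ ν < μ, p ν = 0 then f (p + Pi.single μ 1) else 0

lemma tail_isHomogeneous (μ : Fin n.s) {k : ℤ} {f : n.Series W} (hf : n.IsHomogeneous k f) :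
    n.IsHomogeneous (k - n.deg μ) (tail μ f) := by
  intro p hp
  have h : f (p + Pi.single μ 1) ≠ 0 := fun h => hp (by rw [tail, h, ite_self])
  refine ⟨(hf _ h).1.mono le_self_add, ?_⟩
  have := (hf _ h).2
  rw [weight_add, weight_single] at this
  omega

/-- Every nonconstant monomial is assigned to the smallest variable occurring in it. Splitting off
that variable on the left passes no smaller one, so no sign arises. -/
lemma eq_monomial_add_sum_tail {k : ℤ} {f : n.Series W} (hf : n.IsHomogeneous k f) :
    f = monomial 0 (f 0) + ∑ μ, n.mul (monomial (Pi.single μ 1) 1) (tail μ f) := by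
  funext p
  rw [Pi.add_apply, Finset.sum_apply]
  by_cases hp0 : p = 0
  · subst hp0
    rw [Finset.sum_eq_zero fun μ _ => single_mul_of_not_le μ _ (by simp)]
    simp [monomial]
  rw [monomial, if_neg hp0, zero_add]
  by_cases hp : n.Admissible p
  · obtain ⟨μ, hμ, hmin⟩ : ∃ μ, p μ ≠ 0 ∧ ∀ ν < μ, p ν = 0 := by
      have hne : {μ | p μ ≠ 0}.Nonempty := Function.ne_iff.1 hp0
      refine ⟨WellFounded.min wellFounded_lt _ hne, WellFounded.min_mem wellFounded_lt _ hne,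
        fun ν hν => ?_⟩
      by_contra h
      exact WellFounded.not_lt_min wellFounded_lt _ h hν
    have hle := (single_le_iff μ p).2 hμ
    rw [Finset.sum_eq_single μ]
    · have hr : ∀ ν < μ, (p - (Pi.single μ 1 : Fin _ → ℕ)) ν = 0 := fun ν hν => by
        rw [Pi.sub_apply, hmin ν hν, Nat.zero_sub]
      rw [single_mul_of_le μ _ hp hle, tail, if_pos hr, tsub_add_cancel_of_le hle,
        reorderSign_single_left, Finset.sum_eq_zero fun ν _ => ?_, zpow_zero, one_smul]
      split_ifs with h
      · rw [hr ν h]; simp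
      · rfl
    · intro ν _ hν
      by_cases h0 : p ν = 0
      · exact single_mul_of_not_le ν _ fun h => (single_le_iff ν p).1 h h0
      · have hlt : μ < ν := lt_of_le_of_ne (not_lt.1 fun h => h0 (hmin ν h)) (Ne.symm hν)
        rw [single_mul_of_le ν _ hp ((single_le_iff ν p).2 h0), tail, if_neg, smul_zero]
        intro h
        have := h μ hlt
        rw [Pi.sub_apply, Pi.single_eq_of_ne hlt.ne] at this
        exact hμ this
    · simp
  · rw [Finset.sum_eq_zero fun μ _ => mul_apply_of_not_admissible _ _ hp]
    by_contra h
    exact hp (hf p h).1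

end GDim

/-! ### Coordinates on a graded manifold -/

variable {X : Type u} [TopologicalSpace X] [T2Space X] [SecondCountableTopology X]
  {M : GradedManifold.{u, v} X} (c : GradedChart M.toGradedAlgebraSheaf M.dim)
  {W W' : Opens M.dim.Base}

open PreBundle

/-- Systems of coordinates on the domain of a chart. -/
def IsCoordinates (hW : (W : Set M.dim.Base) ⊆ c.homeo.target)
    (x : Fin M.dim.n₀ ⊕ Fin M.dim.s → M.C (chartPreimage c.homeo W)) : Prop :=
  ∀ a, x a ∈ M.gr _ (M.dim.coordDeg a) ∧ c.coord W hW (x a) = GDim.coordSeries W a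

lemma exists_isCoordinates (hW : (W : Set M.dim.Base) ⊆ c.homeo.target) :
    ∃ x, IsCoordinates c hW x := by
  choose x hx using fun a => c.exists_coord_eq hW (GDim.coordSeries_isHomogeneous (W := W) a)
  exact ⟨x, hx⟩

variable {c}

lemma IsCoordinates.res {hW : (W : Set M.dim.Base) ⊆ c.homeo.target}
    {x : Fin M.dim.n₀ ⊕ Fin M.dim.s → M.C (chartPreimage c.homeo W)} (hx : IsCoordinates c hW x)
    (hW' : (W' : Set M.dim.Base) ⊆ c.homeo.target) (h : W' ≤ W) :
    IsCoordinates c hW' fun a => M.res (chartPreimage_mono c.homeo h) (x a) := by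
  refine fun a => ⟨M.res_mem _ _ _ (hx a).1, ?_⟩
  funext p
  ext y
  rw [c.map_res W hW W' hW' h, (hx a).2]
  rcases a with i | μ
  · change GDim.monomial 0 (GDim.proj W i) p _ = GDim.monomial 0 (GDim.proj W' i) p y
    by_cases hp : p = 0
    · simp only [GDim.monomial, if_pos hp]; rfl
    · simp only [GDim.monomial, if_neg hp]; rfl
  · change GDim.monomial (Pi.single μ 1) 1 p _ = GDim.monomial (Pi.single μ 1) 1 p y
    by_cases hp : p = Pi.single μ 1
    · simp only [GDim.monomial, if_pos hp]; rfl
    · simp only [GDim.monomial, if_neg hp]; rfl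

variable (c)

/-- The partial derivative is transported through the chart in each degree, where the chart is
bijective, and then extended to the direct sum. -/
lemma exists_coordinate_derivation (hW : (W : Set M.dim.Base) ⊆ c.homeo.target)
    (a : Fin M.dim.n₀ ⊕ Fin M.dim.s) :
    ∃ Y : gDer M (chartPreimage c.homeo W) (-M.dim.coordDeg a), ∀ k, ∀ f ∈ M.gr _ k,
      c.coord W hW (Y.1 f) = GDim.coordDeriv W a (c.coord W hW f) := by
  choose P hP hPc using fun f : Homog (M.gr (chartPreimage c.homeo W)) =>
    c.exists_coord_eq hW (GDim.coordDeriv_isHomogeneous a ((c.bijOn W hW f.deg).mapsTo f.mem))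
  have hlin : IsGradedLinear P := by
    refine ⟨fun k f g hf hg => ?_, fun k r f hf => ?_⟩
    · refine c.coord_injOn hW (hP ⟨k, f + g, _⟩)
        (Submodule.add_mem _ (hP ⟨k, f, hf⟩) (hP ⟨k, g, hg⟩)) ?_
      rw [map_add, hPc, hPc, hPc, map_add, map_add]
    · refine c.coord_injOn hW (hP ⟨k, r • f, _⟩) (Submodule.smul_mem _ r (hP ⟨k, f, hf⟩)) ?_
      rw [map_smul, hPc, hPc, map_smul, map_smul]
  obtain ⟨Y, hY⟩ := exists_linearMap_of_homog hlin
  have hmem : ∀ j, ∀ f ∈ M.gr _ j, Y f ∈ M.gr _ (j + -M.dim.coordDeg a) := fun j f hf => by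
    have := hP ⟨j, f, hf⟩
    rwa [← hY] at this
  have hco : ∀ j, ∀ f ∈ M.gr _ j,
      c.coord W hW (Y f) = GDim.coordDeriv W a (c.coord W hW f) := fun j f hf => by
    have := hPc ⟨j, f, hf⟩
    rwa [← hY] at this
  refine ⟨⟨Y, mem_gDer_of_homog hmem fun i j f hf g hg => ?_⟩, hco⟩
  have m1 := hmem _ _ (SetLike.mul_mem_graded hf hg)
  have m2 : Y f * g ∈ M.gr _ (i + j + -M.dim.coordDeg a) := by
    rw [add_right_comm]
    exact SetLike.mul_mem_graded (hmem _ _ hf) hg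
  have m3 : f * Y g ∈ M.gr _ (i + j + -M.dim.coordDeg a) := by
    rw [add_assoc]
    exact SetLike.mul_mem_graded hf (hmem _ _ hg)
  refine c.coord_injOn hW m1 (Submodule.add_mem _ m2 (Submodule.smul_mem _ _ m3)) ?_
  rw [hco _ _ (SetLike.mul_mem_graded hf hg), c.map_mul,
    GDim.coordDeriv_mul a ((c.bijOn W hW i).mapsTo hf) ((c.bijOn W hW j).mapsTo hg), map_add,
    map_smul, c.map_mul, c.map_mul, hco _ _ hf, hco _ _ hg]

/-- Functions all of whose coefficients vanish at a point are stable under multiplication by any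
function. -/
lemma coord_mul_apply_eq_zero (hW : (W : Set M.dim.Base) ⊆ c.homeo.target) {y : W}
    {f : M.C (chartPreimage c.homeo W)} (hf : ∀ p, c.coord W hW f p y = 0)
    (g : M.C (chartPreimage c.homeo W)) (p : Fin M.dim.s → ℕ) : c.coord W hW (f * g) p y = 0 := by
  rw [c.map_mul]
  by_cases hp : M.dim.Admissible p
  · rw [GDim.mul_apply_of_admissible _ _ hp, GDim.smooth_sum_apply]
    refine Finset.sum_eq_zero fun q _ => ?_
    change (_ : ℝ) • (c.coord W hW f q y * c.coord W hW g (p - q) y) = 0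
    rw [hf, zero_mul, smul_zero]
  · rw [GDim.mul_apply_of_not_admissible _ _ hp]; rfl

lemma gDer_one {U : Opens X} {k : ℤ} (D : gDer M U k) : D.1 1 = 0 := by
  have := D.2.2 0 1 SetLike.GradedOne.one_mem 1
  rwa [mul_one, mul_one, one_mul, mul_zero, zpow_zero, one_smul, left_eq_add] at this

/-! ### Derivations that annihilate the coordinates. -/

section Vanishing

variable {c} {hW : (W : Set M.dim.Base) ⊆ c.homeo.target}
  {x : Fin M.dim.n₀ ⊕ Fin M.dim.s → M.C (chartPreimage c.homeo W)} (hx : IsCoordinates c hW x)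
  {k : ℤ} {D : gDer M (chartPreimage c.homeo W) k} (hD : ∀ a, D.1 (x a) = 0) (y : W)

include hx hD

/-- Hadamard gives b h = h(y) + ∑ (x_i - y_i) g_i with b(y) = 1. Since D kills constants and
coordinates, D(b h) = ∑ (x_i - y_i) D(g_i) vanishes at y; with h = 1 so does D(b), and Leibniz
leaves b(y) D(h) = 0 at y. -/
lemma coord_gDer_of_smooth (h : M.dim.Smooth W) {f : M.C (chartPreimage c.homeo W)}
    (hf : f ∈ M.gr _ 0) (hfh : c.coord W hW f = GDim.monomial 0 h) (p : Fin M.dim.s → ℕ) :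
    c.coord W hW (D.1 f) p y = 0 := by
  obtain ⟨b, hb, hg⟩ := GDim.exists_smooth_hadamard y
  have lift : ∀ h : M.dim.Smooth W, ∃ f ∈ M.gr (chartPreimage c.homeo W) 0,
      c.coord W hW f = GDim.monomial 0 h := fun h =>
    c.exists_coord_eq hW (GDim.monomial_isHomogeneous GDim.admissible_zero h GDim.weight_zero)
  obtain ⟨B, hB, hBb⟩ := lift b
  have mul_coord : ∀ {A F : M.C (chartPreimage c.homeo W)} {a h : M.dim.Smooth W},
      c.coord W hW A = GDim.monomial 0 a → c.coord W hW F = GDim.monomial 0 h →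
      c.coord W hW (A * F) = GDim.monomial 0 (a * h) := fun {A F a h} hA hF => by
    rw [c.map_mul, hA, hF]
    funext p
    by_cases hp : M.dim.Admissible p
    · rw [GDim.monomial_zero_mul _ _ _ hp]
      by_cases hp0 : p = 0
      · simp [GDim.monomial, hp0]
      · simp [GDim.monomial, hp0]
    · rw [GDim.mul_apply_of_not_admissible _ _ hp, GDim.monomial,
        if_neg fun e => hp (by rw [e]; exact GDim.admissible_zero)]
  have step : ∀ (h : M.dim.Smooth W) {F : M.C (chartPreimage c.homeo W)}, F ∈ M.gr _ 0 →
      c.coord W hW F = GDim.monomial 0 h → ∀ p, c.coord W hW (D.1 (B * F)) p y = 0 := by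
    intro h F hF hFh p
    obtain ⟨g, hg⟩ := hg h
    choose G hG hGg using fun i => lift (g i)
    let Z : Fin M.dim.n₀ → M.C (chartPreimage c.homeo W) := fun i =>
      x (Sum.inl i) - (y : M.dim.Base) i • 1
    have hx0 : ∀ i, x (Sum.inl i) ∈ M.gr _ 0 := fun i => (hx (Sum.inl i)).1
    have hZ : ∀ i, Z i ∈ M.gr _ 0 := fun i =>
      Submodule.sub_mem _ (hx0 i) (Submodule.smul_mem _ _ SetLike.GradedOne.one_mem)
    have hZc : ∀ i, c.coord W hW (Z i) =
        GDim.monomial 0 (GDim.proj W i - (y : M.dim.Base) i • 1) := fun i => by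
      change c.coord W hW (x (Sum.inl i) - (y : M.dim.Base) i • 1) = _
      rw [map_sub, map_smul, (hx _).2, c.map_one]
      funext p
      change GDim.monomial 0 (GDim.proj W i) p - (y : M.dim.Base) i • M.dim.one W p = _
      by_cases hp : p = 0 <;> simp [GDim.monomial, GDim.one, hp]
    have hZy : ∀ i p, c.coord W hW (Z i) p y = 0 := fun i p => by
      rw [hZc]
      by_cases hp : p = 0
      · rw [GDim.monomial, if_pos hp]
        change (y : M.dim.Base) i - (y : M.dim.Base) i * 1 = 0
        ring
      · rw [GDim.monomial, if_neg hp]; rfl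
    have m : ∀ {A F : M.C (chartPreimage c.homeo W)}, A ∈ M.gr _ 0 → F ∈ M.gr _ 0 →
        A * F ∈ M.gr _ 0 := fun hA hF => by
      have := SetLike.mul_mem_graded hA hF
      rwa [add_zero] at this
    have e : B * F = h y • 1 + ∑ i, Z i * G i := by
      refine c.coord_injOn hW (m hB hF) (Submodule.add_mem _
        (Submodule.smul_mem _ _ SetLike.GradedOne.one_mem)
        (Submodule.sum_mem _ fun i _ => m (hZ i) (hG i))) ?_
      rw [mul_coord hBb hFh, map_add, map_smul, map_sum, c.map_one,
        Finset.sum_congr rfl fun i _ => mul_coord (hZc i) (hGg i)]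
      funext p
      rw [Pi.add_apply, Finset.sum_apply]
      ext z
      rw [ContMDiffMap.coe_add, Pi.add_apply, GDim.smooth_sum_apply]
      change GDim.monomial 0 (b * h) p z = h y * M.dim.one W p z + _
      by_cases hp : p = 0
      · simp only [GDim.monomial, GDim.one, if_pos hp]
        refine (hg z).trans ?_
        refine congrArg₂ _ (mul_one _).symm (Finset.sum_congr rfl fun i _ => ?_)
        change _ = ((z : M.dim.Base) i - (y : M.dim.Base) i * 1) * g i z
        rw [mul_one]
      · simp only [GDim.monomial, GDim.one, if_neg hp]
        simp
    rw [e, map_add, map_smul, gDer_one, smul_zero, zero_add, map_sum, map_sum, Finset.sum_apply,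
      GDim.smooth_sum_apply]
    refine Finset.sum_eq_zero fun i _ => ?_
    have hDZ : D.1 (Z i) = 0 := by
      change D.1 (x (Sum.inl i) - (y : M.dim.Base) i • 1) = 0
      rw [map_sub, map_smul, gDer_one, hD, smul_zero, sub_zero]
    rw [D.2.2 0 _ (hZ i), hDZ, zero_mul, zero_add, map_smul]
    change _ * c.coord W hW (Z i * D.1 (G i)) p y = 0
    rw [coord_mul_apply_eq_zero c hW (hZy i), mul_zero]
  have hB0 : ∀ p, c.coord W hW (D.1 B) p y = 0 := fun p => by
    have h1 : c.coord W hW 1 = GDim.monomial 0 1 := by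
      rw [c.map_one]; rfl
    have := step 1 SetLike.GradedOne.one_mem h1 p
    rwa [mul_one] at this
  have h1 := step h hf hfh p
  rw [D.2.2 0 B hB, mul_zero, zpow_zero, one_smul, map_add] at h1
  have h2 : c.coord W hW (D.1 B * f) p y + c.coord W hW (B * D.1 f) p y = 0 := h1
  rw [coord_mul_apply_eq_zero c hW hB0, zero_add, c.map_mul, hBb] at h2
  by_cases hp : M.dim.Admissible p
  · rw [GDim.monomial_zero_mul _ _ _ hp] at h2
    have h3 : b y * c.coord W hW (D.1 f) p y = 0 := h2
    rwa [hb, one_mul] at h3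
  · have : c.coord W hW (D.1 f) p = 0 := by
      by_contra h0
      exact hp ((c.bijOn W hW _).mapsTo (D.2.1 _ _ hf) p h0).1
    rw [this]; rfl

/-- Induction on the order of the coefficient in the ξ_μ. Write f as its constant term plus ∑ ξ_μ
G_μ; as D ξ_μ = 0, the coefficient of D(ξ_μ G_μ) at p is up to sign that of D(G_μ) at p - e_μ, or
zero. -/
lemma coord_gDer_eq_zero (N : ℕ) {j : ℤ} {f : M.C (chartPreimage c.homeo W)}
    (hf : f ∈ M.gr _ j) (p : Fin M.dim.s → ℕ) (hp : ∑ μ, p μ < N) :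
    c.coord W hW (D.1 f) p y = 0 := by
  induction N generalizing j f p with
  | zero => exact absurd hp (Nat.not_lt_zero _)
  | succ N ih =>
    have hfs := (c.bijOn W hW j).mapsTo hf
    obtain ⟨F, hF, hF0, hFD⟩ : ∃ F ∈ M.gr (chartPreimage c.homeo W) j,
        c.coord W hW F = GDim.monomial 0 (c.coord W hW f 0) ∧
        c.coord W hW (D.1 F) p y = 0 := by
      by_cases h0 : c.coord W hW f 0 = 0
      · refine ⟨0, Submodule.zero_mem _, ?_, ?_⟩
        · rw [map_zero, h0]
          funext p
          simp [GDim.monomial]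
        · rw [map_zero, map_zero]; rfl
      · have hj : j = 0 := (hfs 0 h0).2.symm.trans GDim.weight_zero
        subst hj
        obtain ⟨F, hF, hFc⟩ := c.exists_coord_eq hW (GDim.monomial_isHomogeneous
          GDim.admissible_zero (c.coord W hW f 0) GDim.weight_zero)
        exact ⟨F, hF, hFc, coord_gDer_of_smooth hx hD y _ hF hFc p⟩
    choose G hG hGc using fun μ =>
      c.exists_coord_eq hW (GDim.tail_isHomogeneous μ hfs)
    have hξ : ∀ μ, x (Sum.inr μ) ∈ M.gr _ (M.dim.deg μ) := fun μ => (hx (Sum.inr μ)).1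
    have e : f = F + ∑ μ, x (Sum.inr μ) * G μ := by
      refine c.coord_injOn hW hf (Submodule.add_mem _ hF (Submodule.sum_mem _ fun μ _ => ?_)) ?_
      · have := SetLike.mul_mem_graded (hξ μ) (hG μ)
        rwa [add_sub_cancel] at this
      · rw [map_add, map_sum, hF0]
        refine (GDim.eq_monomial_add_sum_tail hfs).trans (congrArg _ ?_)
        refine Finset.sum_congr rfl fun μ _ => ?_
        rw [c.map_mul, hGc, (hx _).2]
        rfl
    rw [e, map_add, map_add, map_sum, map_sum]
    refine (congrArg₂ (· + ·) hFD ?_).trans (add_zero (0 : ℝ))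
    rw [Finset.sum_apply, GDim.smooth_sum_apply]
    refine Finset.sum_eq_zero fun μ _ => ?_
    rw [D.2.2 _ _ (hξ μ), hD, zero_mul, zero_add, map_smul]
    change _ * c.coord W hW (x (Sum.inr μ) * D.1 (G μ)) p y = 0
    refine (congrArg _ ?_).trans (mul_zero _)
    rw [c.map_mul, (hx _).2]
    change M.dim.mul (GDim.monomial (Pi.single μ 1) 1) (c.coord W hW (D.1 (G μ))) p y = 0
    by_cases hle : (Pi.single μ 1 : Fin _ → ℕ) ≤ p
    · by_cases hadm : M.dim.Admissible p
      · rw [GDim.single_mul_of_le μ _ hadm hle]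
        refine (congrArg _ (ih (hG μ) _ ?_)).trans (mul_zero _)
        obtain ⟨r, rfl⟩ : ∃ r : Fin M.dim.s → ℕ, p = (Pi.single μ 1 : Fin M.dim.s → ℕ) + r :=
          ⟨_, (add_tsub_cancel_of_le hle).symm⟩
        rw [add_tsub_cancel_left]
        simp only [Pi.add_apply, Finset.sum_add_distrib, Finset.sum_pi_single', Finset.mem_univ,
          if_true] at hp
        omega
      · rw [GDim.mul_apply_of_not_admissible _ _ hadm]; rfl
    · rw [GDim.single_mul_of_not_le μ _ hle]; rfl

omit y

/-- A derivation that annihilates the coordinates vanishes. -/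
lemma gDer_eq_zero_of_coordinates : D = 0 := by
  refine Subtype.ext (linearMap_ext_homog fun j f hf => ?_)
  refine c.coord_injOn hW (D.2.1 j f hf) (Submodule.zero_mem _) ?_
  refine Eq.trans ?_ (map_zero _).symm
  funext p
  ext y
  exact coord_gDer_eq_zero hx hD y _ hf p (Nat.lt_succ_self _)

end Vanishing

end GradedGeometry

namespace GradedGeometry

variable {X : Type u} [TopologicalSpace X] [T2Space X] [SecondCountableTopology X]
  {M : GradedManifold.{u, v} X}

open PreBundle

/-! ### The tangent bundle -/

/-- Functions with dual vector fields, which form a frame of the tangent bundle. -/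
structure IsCoordinateFrame {U : Opens X} (x : Fin M.dim.n₀ ⊕ Fin M.dim.s → M.C U)
    (Y : ∀ a, (tangent M).gr U (-M.dim.coordDeg a)) : Prop where
  mem : ∀ a, x a ∈ M.gr U (M.dim.coordDeg a)
  dual : ∀ a b, (Y a).1 (x b) = if a = b then 1 else 0
  ext : ∀ {V : Opens X} (hV : V ≤ U) {k : ℤ} (D : (tangent M).gr V k),
    (∀ a, D.1 (M.res hV (x a)) = 0) → D = 0

lemma exists_isCoordinateFrame (M : GradedManifold.{u, v} X) (y : X) :
    ∃ U : Opens X, y ∈ U ∧ ∃ (x : Fin M.dim.n₀ ⊕ Fin M.dim.s → M.C U)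
      (Y : ∀ a, (tangent M).gr U (-M.dim.coordDeg a)), IsCoordinateFrame x Y := by
  obtain ⟨c, hc⟩ := M.exists_chart y
  obtain ⟨W, hWt⟩ : ∃ W : Opens M.dim.Base, (W : Set M.dim.Base) = c.homeo.target :=
    ⟨⟨c.homeo.target, c.homeo.open_target⟩, rfl⟩
  have hW : (W : Set M.dim.Base) ⊆ c.homeo.target := hWt.subset
  obtain ⟨x, hx⟩ := exists_isCoordinates c hW
  choose Y hY using exists_coordinate_derivation c hW
  refine ⟨chartPreimage c.homeo W, ⟨hc, ?_⟩, x, Y, fun a => (hx a).1, fun a b => ?_, ?_⟩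
  · rw [Set.mem_preimage, hWt]
    exact c.homeo.map_source hc
  · have m1 := (Y a).2.1 _ _ (hx b).1
    have m2 : (if a = b then 1 else 0 : M.C _) ∈ M.gr (chartPreimage c.homeo W)
        (M.dim.coordDeg b + -M.dim.coordDeg a) := by
      split_ifs with h
      · rw [h, add_neg_cancel]
        exact SetLike.GradedOne.one_mem
      · exact Submodule.zero_mem _
    refine c.coord_injOn hW m1 m2 ?_
    rw [hY a _ _ (hx b).1, (hx b).2, GDim.coordDeriv_coordSeries]
    split_ifs
    · exact c.map_one W hW ▸ rfl
    · exact (map_zero _).symm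
  · intro V hV k D hD
    -- Every open subset of the chart domain is itself a chart preimage, so the vanishing result
    -- applies to it with the restricted coordinates.
    obtain ⟨W', hW', rfl⟩ : ∃ W' : Opens M.dim.Base, W' ≤ W ∧ V = chartPreimage c.homeo W' := by
      refine ⟨⟨c.homeo.target ∩ c.homeo.symm ⁻¹' V, c.homeo.symm.isOpen_inter_preimage V.isOpen⟩,
        fun z hz => ?_, ?_⟩
      · change z ∈ (W : Set _)
        rw [hWt]
        exact hz.1
      · ext z
        refine ⟨fun hz => ⟨(hV hz).1, c.homeo.map_source (hV hz).1, ?_⟩, fun hz => ?_⟩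
        · change c.homeo.symm (c.homeo z) ∈ V
          rwa [c.homeo.left_inv (hV hz).1]
        · have : c.homeo.symm (c.homeo z) ∈ V := hz.2.2
          rwa [c.homeo.left_inv hz.1] at this
    have hW'' : (W' : Set M.dim.Base) ⊆ c.homeo.target := fun z hz => hW (hW' hz)
    exact gDer_eq_zero_of_coordinates (hx.res hW'' hW') hD

section CoordinateFrame

variable {U V : Opens X} {x : Fin M.dim.n₀ ⊕ Fin M.dim.s → M.C U}
  {Y : ∀ a, (tangent M).gr U (-M.dim.coordDeg a)}

lemma IsCoordinateFrame.res_apply (h : IsCoordinateFrame x Y) (hV : V ≤ U)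
    (a b : Fin M.dim.n₀ ⊕ Fin M.dim.s) :
    ((tangent M).res hV (Y a)).1 (M.res hV (x b)) = if a = b then 1 else 0 := by
  rw [tangent_res_apply, h.dual]
  split_ifs
  · exact map_one _
  · exact map_zero _

lemma IsCoordinateFrame.sum_apply (h : IsCoordinateFrame x Y) (hV : V ≤ U)
    (f : Fin M.dim.n₀ ⊕ Fin M.dim.s → M.C V) (b : Fin M.dim.n₀ ⊕ Fin M.dim.s) :
    ∑ a, f a * ((tangent M).res hV (Y a)).1 (M.res hV (x b)) = f b := by
  simp only [h.res_apply hV, mul_ite, mul_one, mul_zero, Finset.sum_ite_eq', Finset.mem_univ,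
    if_true]

/-- The coefficients of D are its values on the coordinates: subtracting the resulting combination
leaves a derivation that annihilates all coordinates. -/
lemma IsCoordinateFrame.isFrame (h : IsCoordinateFrame x Y) : (tangent M).IsFrame Y := by
  intro V hV k D
  have hmem : ∀ a, D.1 (M.res hV (x a)) ∈ M.gr V (k - -M.dim.coordDeg a) := fun a => by
    rw [sub_neg_eq_add, add_comm]
    exact D.2.1 _ _ (M.res_mem hV _ _ (h.mem a))
  refine ⟨fun a => ⟨D.1 (M.res hV (x a)), hmem a⟩, ?_, fun f hf => ?_⟩
  · have hs := coe_sum_gmul (E := tangent M) (k := k)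
      (fun a => (⟨D.1 (M.res hV (x a)), hmem a⟩ : M.gr V (k - -M.dim.coordDeg a)))
      (fun a => (tangent M).res hV (Y a))
    refine Eq.trans (congrArg Subtype.val (sub_eq_zero.1 (h.ext hV (_ - _) fun b => ?_))) hs
    change D.1 (M.res hV (x b)) - _ = 0
    rw [sub_eq_zero]
    refine Eq.trans ?_ (congrArg (fun T => T (M.res hV (x b))) hs).symm
    rw [LinearMap.sum_apply]
    exact (h.sum_apply hV (fun a => D.1 (M.res hV (x a))) b).symm
  · funext b
    refine Subtype.ext ?_
    have := congrArg (fun T => T (M.res hV (x b))) hf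
    rw [LinearMap.sum_apply] at this
    exact (h.sum_apply hV (fun a => (f a).1) b).symm.trans this.symm

end CoordinateFrame

lemma tangent_isGradedVectorBundle : (tangent M).IsGradedVectorBundle := by
  refine tangent_isModuleSheaf.isGradedVectorBundle (fun a => -M.dim.coordDeg a) fun y => ?_
  obtain ⟨U, hy, x, Y, h⟩ := exists_isCoordinateFrame M y
  exact ⟨U, hy, Y, h.isFrame⟩

lemma genTangent_isGradedVectorBundle (M : GradedManifold.{u, v} X) (ℓ : ℤ) :
    (genTangent M ℓ).IsGradedVectorBundle :=
  (tangent_isGradedVectorBundle.shift ℓ).dsum tangent_isGradedVectorBundle.dual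

end GradedGeometry

namespace GradedGeometry

variable {X : Type u} [TopologicalSpace X] [T2Space X] [SecondCountableTopology X]
  {M : GradedManifold.{u, v} X}

open PreBundle

/-! ### Exact one-forms -/

lemma PreBundle.IsFrame.dualGr_ext {E : PreBundle M} (hE : E.IsModuleSheaf) {U V : Opens X}
    {ι : Type} [Fintype ι] {δ : ι → ℤ} {Φ : ∀ a, E.gr U (δ a)} (hΦ : E.IsFrame Φ) (hV : V ≤ U)
    {k k' : ℤ} (hk : k = k') (α : E.dualGr V k) (β : E.dualGr V k')
    (h : ∀ a, α.1 (Homog.of (E.res hV (Φ a))) = β.1 (Homog.of (E.res hV (Φ a)))) :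
    α.1 = β.1 := by
  subst hk
  funext ψ
  refine (hΦ.dualGr_apply_eq_sum hE hV α ⟨ψ.val, ψ.mem⟩).trans ?_
  refine Eq.trans ?_ (hΦ.dualGr_apply_eq_sum hE hV β ⟨ψ.val, ψ.mem⟩).symm
  simp only [h]

/-- The differential of a global function as a homogeneous one-form. -/
noncomputable def dHom (f : Homog (M.gr ⊤)) : Homog ((tangent M).dual.gr ⊤) :=
  ⟨f.deg, dFun f.deg f.val, dFun_mem f.mem⟩

/-- The metric condition concerns global sections only, so coordinates and their dual fields are
replaced by global ones with the same germs. -/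
lemma exists_global_coordinateFrame (M : GradedManifold.{u, v} X) (y : X) :
    ∃ U : Opens X, y ∈ U ∧ ∃ (x : Fin M.dim.n₀ ⊕ Fin M.dim.s → M.C U)
      (Y : ∀ a, (tangent M).gr U (-M.dim.coordDeg a)), IsCoordinateFrame x Y ∧
      ∃ (f : ∀ a, M.gr ⊤ (M.dim.coordDeg a)) (Z : ∀ a, (tangent M).gr ⊤ (-M.dim.coordDeg a))
        (V : Opens X) (hV : V ≤ U), y ∈ V ∧
        (∀ a, M.res (le_top : V ≤ ⊤) (f a).1 = M.res hV (x a)) ∧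
        ∀ a, (tangent M).res (le_top : V ≤ ⊤) (Z a) = (tangent M).res hV (Y a) := by
  obtain ⟨U, hy, x, Y, h⟩ := exists_isCoordinateFrame M y
  choose V₁ hy₁ h₁ f hf using fun a => functions_isModuleSheaf.exists_extension
    (le_top : U ≤ ⊤) hy (⟨x a, h.mem a⟩ : M.gr U (M.dim.coordDeg a))
  choose V₂ hy₂ h₂ Z hZ using fun a => tangent_isModuleSheaf.exists_extension
    (le_top : U ≤ ⊤) hy (Y a)
  let V : Opens X := ⟨U ∩ ⋂ a, V₁ a ∩ V₂ a, U.isOpen.inter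
    (isOpen_iInter_of_finite fun a => (V₁ a).isOpen.inter (V₂ a).isOpen)⟩
  have l₁ : ∀ a, V ≤ V₁ a := fun a z hz => (Set.mem_iInter.1 hz.2 a).1
  have l₂ : ∀ a, V ≤ V₂ a := fun a z hz => (Set.mem_iInter.1 hz.2 a).2
  refine ⟨U, hy, x, Y, h, f, Z, V, fun z hz => hz.1,
    ⟨hy, Set.mem_iInter.2 fun a => ⟨hy₁ a, hy₂ a⟩⟩, fun a => ?_, fun a => ?_⟩
  · have : M.res _ (f a).1 = M.res (h₁ a) (x a) := congrArg Subtype.val (hf a)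
    rw [← M.res_res ((h₁ a).trans le_top) (l₁ a), this, M.res_res]
  · rw [← tangent_isModuleSheaf.res_res ((h₂ a).trans le_top) (l₂ a), hZ,
      tangent_isModuleSheaf.res_res]

/-- Maps on one-forms that are linear over the functions are determined by their values on exact
one-forms. -/
lemma dual_dualGr_ext {d : ℤ} {A B : (tangent M).dual.dualGr ⊤ d}
    (h : ∀ f, A.1 (dHom f) = B.1 (dHom f)) : A = B := by
  have hT := tangent_isModuleSheaf (M := M)
  refine Subtype.ext (funext fun η => function_eq_of_locally_eq (A.2.2.1 η) (B.2.2.1 η)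
    fun y _ => ?_)
  obtain ⟨U, hy, x, Y, hY, f, Z, V, hV, hyV, hf, hZ⟩ := exists_global_coordinateFrame M y
  have hΦ := hY.isFrame
  -- On `V` the differentials of the globalized coordinates form the dual frame, so agreement on
  -- exact forms is agreement on a frame of the cotangent bundle.
  have key : ∀ a, ((tangent M).dual.res (le_top : V ≤ ⊤)
      ⟨(dHom (Homog.of (f a))).val, (dHom (Homog.of (f a))).mem⟩).1 =
      ((tangent M).dual.res hV (hΦ.dualFrame hT le_rfl a)).1 := fun a => by
    refine hΦ.dualGr_ext hT hV (neg_neg _).symm _ _ fun b => ?_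
    have e : (Homog.of ((tangent M).res hV (Y b)) : Homog ((tangent M).gr V)) =
        (tangent M).resSec le_top (Homog.of (Z b)) :=
      Homog.ext' rfl (congrArg Subtype.val (hZ b)).symm
    rw [hΦ.res_dualFrame hT hV, hΦ.dualFrame_apply hT, hΦ.coef_frame hT hV b a, e,
      dual_res_apply hT]
    change M.res le_top (dFun _ (f a).1 (Homog.of (Z b))) = _
    rw [dFun_apply, map_smul]
    have e2 : M.res (le_top : V ≤ ⊤) ((Z b).1 (f a).1) = if a = b then 1 else 0 := by
      rw [← tangent_res_apply, hZ, hf, hY.res_apply]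
      simp only [eq_comm]
    refine (congrArg _ e2).trans ?_
    split_ifs with hab
    · subst hab
      congr 1
      refine neg_one_zpow_congr ?_
      change ((((-M.dim.coordDeg a - 1) * M.dim.coordDeg a : ℤ)) : ZMod 2) =
        ((-M.dim.coordDeg a * (-M.dim.coordDeg a - -M.dim.coordDeg a) : ℤ) : ZMod 2)
      push_cast
      generalize (M.dim.coordDeg a : ZMod 2) = c
      revert c; decide
    · rw [smul_zero, smul_zero]
  have hAB : (tangent M).dual.dual.res (le_top : V ≤ ⊤) A =
      (tangent M).dual.dual.res (le_top : V ≤ ⊤) B := by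
    refine Subtype.ext ((hΦ.isFrame_dual hT).dualGr_ext hT.dual hV rfl _ _ fun a => ?_)
    have e : (Homog.of ((tangent M).dual.res hV (hΦ.dualFrame hT le_rfl a)) :
        Homog ((tangent M).dual.gr V)) = (tangent M).dual.resSec le_top (dHom (Homog.of (f a))) :=
      Homog.ext' (neg_neg _) (key a).symm
    rw [e, dual_res_apply hT.dual, dual_res_apply hT.dual, h]
  refine ⟨V, hyV, le_top, ?_⟩
  rw [← dual_res_apply hT.dual, ← dual_res_apply hT.dual, hAB]

lemma isGradedLinear_dHom {A : Type*} [AddCommGroup A] [Module ℝ A]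
    {F : Homog ((tangent M).dual.gr ⊤) → A} (hF : IsGradedLinear F) :
    IsGradedLinear fun f : Homog (M.gr ⊤) => F (dHom f) := by
  refine ⟨fun n a b ha hb => ?_, fun n c a ha => ?_⟩
  · refine hF.map_add (z := dHom ⟨n, a + b, _⟩) (z₁ := dHom ⟨n, a, ha⟩) (z₂ := dHom ⟨n, b, hb⟩)
      rfl rfl (funext fun Z => ?_)
    change dFun n (a + b) Z = dFun n a Z + dFun n b Z
    rw [dFun_apply, dFun_apply, dFun_apply, map_add, smul_add]
  · refine hF.map_smul (z := dHom ⟨n, c • a, Submodule.smul_mem _ c ha⟩) (z₁ := dHom ⟨n, a, ha⟩)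
      rfl c (funext fun Z => ?_)
    change dFun n (c • a) Z = c • dFun n a Z
    rw [dFun_apply, dFun_apply, map_smul, smul_comm]

lemma dFun_mul (f g : Homog (M.gr ⊤)) (Z : VField M) :
    dFun (f.deg + g.deg) (f.val * g.val) Z =
      (-1 : ℝ) ^ (g.deg + f.deg * g.deg) • (g.val * dFun f.deg f.val Z) +
        (-1 : ℝ) ^ f.deg • (f.val * dFun g.deg g.val Z) := by
  rw [dFun_apply, dFun_apply, dFun_apply, Z.map_mul f g.val,
    M.comm ⊤ _ _ _ _ (Z.mem.1 _ _ f.mem) g.mem]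
  simp only [mul_smul_comm, neg_one_zpow_smul]
  push_cast
  generalize (Z.deg : ZMod 2) = z, (f.deg : ZMod 2) = a, (g.deg : ZMod 2) = b
  match_scalars <;> (revert z a b; decide)

lemma IsGradedLinear.map_smul_add_smul {V W : Type*} [AddCommGroup V] [Module ℝ V] [AddCommGroup W]
    [Module ℝ W] {gr : ℤ → Submodule ℝ V} {F : Homog gr → W} (hF : IsGradedLinear F)
    {z z₁ z₂ : Homog gr} (h₁ : z₁.deg = z.deg) (h₂ : z₂.deg = z.deg) (c₁ c₂ : ℝ)
    (h : z.val = c₁ • z₁.val + c₂ • z₂.val) : F z = c₁ • F z₁ + c₂ • F z₂ := by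
  obtain ⟨n, v, hv⟩ := z
  obtain ⟨n₁, v₁, hv₁⟩ := z₁
  obtain ⟨n₂, v₂, hv₂⟩ := z₂
  dsimp only at h₁ h₂ h
  subst h₁ h₂ h
  rw [hF.1 _ _ _ (Submodule.smul_mem _ _ hv₁) (Submodule.smul_mem _ _ hv₂), hF.2, hF.2]

/-- Evaluation on exact one-forms turns a map that is linear over the functions into a vector
field. -/
lemma exists_gDer_of_dual_dualGr {d : ℤ} (β : (tangent M).dual.dualGr ⊤ d) :
    ∃ Y : gDer M ⊤ d, ∀ f : Homog (M.gr ⊤), Y.1 f.val = (-1 : ℝ) ^ f.deg • β.1 (dHom f) := by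
  -- The sign (-1)^|f| is the quotient of the evaluation sign (-1)^(|Y||f|) and the sign
  -- (-1)^((|Y|-1)|f|) in the differential.
  obtain ⟨Y, hY⟩ := exists_linearMap_of_homog
    ((isGradedLinear_dHom β.2.1).deg_smul fun n => (-1 : ℝ) ^ n)
  have hmem : ∀ j, ∀ f ∈ M.gr ⊤ j, Y f ∈ M.gr ⊤ (j + d) := fun j f hf => by
    rw [hY ⟨j, f, hf⟩]
    exact Submodule.smul_mem _ _ (β.2.2.1 (dHom ⟨j, f, hf⟩))
  refine ⟨⟨Y, mem_gDer_of_homog hmem fun i j f hf g hg => ?_⟩, hY⟩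
  rw [M.comm ⊤ _ _ _ _ (hmem _ _ hf) hg]
  rw [hY ⟨i, f, hf⟩, hY ⟨j, g, hg⟩]
  refine (hY ⟨i + j, f * g, SetLike.mul_mem_graded hf hg⟩).trans ?_
  have e := β.2.1.map_smul_add_smul
    (z := dHom ⟨i + j, f * g, SetLike.mul_mem_graded hf hg⟩)
    (z₁ := (tangent M).dual.smul ⟨j, g, hg⟩ (dHom ⟨i, f, hf⟩))
    (z₂ := (tangent M).dual.smul ⟨i, f, hf⟩ (dHom ⟨j, g, hg⟩)) (add_comm j i) rfl _ _
    (funext fun Z => dFun_mul ⟨i, f, hf⟩ ⟨j, g, hg⟩ Z)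
  rw [e, β.2.2.2, β.2.2.2]
  simp only [mul_smul_comm, neg_one_zpow_smul]
  push_cast
  generalize (d : ZMod 2) = z, (i : ZMod 2) = a, (j : ZMod 2) = b
  match_scalars <;> (revert z a b; decide)

/-! ### The metric is an isomorphism -/

section Metric

variable {ℓ : ℤ}

/-- The section `(Y, 0)`. -/
noncomputable def horizontal (ℓ : ℤ) (Y : VField M) : Homog ((genTangent M ℓ).gr ⊤) :=
  ⟨Y.deg - ℓ, (Y.val, 0), by
    change Y.val ∈ gDer M ⊤ (Y.deg - ℓ + ℓ)
    rw [sub_add_cancel]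
    exact Y.mem, Submodule.zero_mem _⟩

/-- The section `(0, η)`. -/
noncomputable def vertical (ℓ : ℤ) (η : Homog ((tangent M).dual.gr ⊤)) :
    Homog ((genTangent M ℓ).gr ⊤) :=
  ⟨η.deg, (0, η.val), Submodule.zero_mem _, η.mem⟩

lemma vec_horizontal (Y : VField M) : vec (horizontal ℓ Y) = Y :=
  Homog.ext' (sub_add_cancel Y.deg ℓ) rfl

lemma cov_horizontal (Y Z : VField M) : cov (horizontal ℓ Y) Z = 0 := rfl

lemma IsGradedLinear.comp_horizontal {A : Type*} [AddCommGroup A] [Module ℝ A]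
    {F : Homog ((genTangent M ℓ).gr ⊤) → A} (hF : IsGradedLinear F) :
    IsGradedLinear fun Y : VField M => F (horizontal ℓ Y) := by
  refine ⟨fun n a b ha hb => ?_, fun n c a ha => ?_⟩
  · exact hF.map_add (z := horizontal ℓ ⟨n, a + b, _⟩) (z₁ := horizontal ℓ ⟨n, a, ha⟩)
      (z₂ := horizontal ℓ ⟨n, b, hb⟩) rfl rfl (Prod.ext rfl (add_zero _).symm)
  · exact hF.map_smul (z := horizontal ℓ ⟨n, c • a, Submodule.smul_mem _ c ha⟩)
      (z₁ := horizontal ℓ ⟨n, a, ha⟩) rfl c (Prod.ext rfl (smul_zero _).symm)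

lemma IsGradedLinear.comp_vertical {A : Type*} [AddCommGroup A] [Module ℝ A]
    {F : Homog ((genTangent M ℓ).gr ⊤) → A} (hF : IsGradedLinear F) :
    IsGradedLinear fun η : Homog ((tangent M).dual.gr ⊤) => F (vertical ℓ η) := by
  refine ⟨fun n a b ha hb => ?_, fun n c a ha => ?_⟩
  · exact hF.map_add (z := vertical ℓ ⟨n, a + b, Submodule.add_mem _ ha hb⟩)
      (z₁ := vertical ℓ ⟨n, a, ha⟩)
      (z₂ := vertical ℓ ⟨n, b, hb⟩) rfl rfl (Prod.ext (add_zero _).symm rfl)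
  · exact hF.map_smul (z := vertical ℓ ⟨n, c • a, Submodule.smul_mem _ c ha⟩)
      (z₁ := vertical ℓ ⟨n, a, ha⟩) rfl c (Prod.ext (smul_zero _).symm rfl)

lemma apply_eq_horizontal_add_vertical {A : Type*} [AddCommGroup A] [Module ℝ A]
    {F : Homog ((genTangent M ℓ).gr ⊤) → A} (hF : IsGradedLinear F)
    (φ : Homog ((genTangent M ℓ).gr ⊤)) :
    F φ = F (horizontal ℓ (vec φ)) + F (vertical ℓ ⟨φ.deg, cov φ, cov_mem φ⟩) :=
  hF.map_add (add_sub_cancel_right φ.deg ℓ) rfl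
    (Prod.ext (add_zero _).symm (zero_add _).symm)

lemma horizontal_mem_dualGr {d k : ℤ} (hd : d = k + ℓ) (α : (genTangent M ℓ).dualGr ⊤ d) :
    (fun Y : VField M => α.1 (horizontal ℓ Y)) ∈ (tangent M).dualGr ⊤ k := by
  refine ⟨α.2.1.comp_horizontal, fun Y => ?_, fun f Y => ?_⟩
  · have := α.2.2.1 (horizontal ℓ Y)
    rwa [show (horizontal ℓ Y).deg + d = Y.deg + k by
      change Y.deg - ℓ + d = Y.deg + k
      rw [hd]; ring] at this
  -- Lifting `f ▷ Y` to the shifted bundle differs from acting on the lift of `Y` by the shift sign.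
  · have e := α.2.1.map_smul (z := horizontal ℓ ((tangent M).smul f Y))
      (z₁ := (genTangent M ℓ).smul f (horizontal ℓ Y)) (add_sub_assoc _ _ _).symm
      ((-1 : ℝ) ^ (f.deg * ℓ)) (Prod.ext ?_ ?_)
    · refine e.trans ?_
      rw [α.2.2.2, smul_smul, ← zpow_add₀ (by norm_num)]
      congr 1
      refine neg_one_zpow_congr ?_
      rw [hd]
      push_cast
      generalize (k : ZMod 2) = z, (f.deg : ZMod 2) = a, (ℓ : ZMod 2) = b
      revert z a b; decide
    · change (tangent M).act ⊤ f Y.val =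
        (-1 : ℝ) ^ (f.deg * ℓ) • (-1 : ℝ) ^ (f.deg * ℓ) • (tangent M).act ⊤ f Y.val
      rw [smul_smul, ← zpow_add₀ (by norm_num), Even.neg_one_zpow (Even.add_self _), one_smul]
    · change (0 : VField M → M.C ⊤) = (-1 : ℝ) ^ (f.deg * ℓ) • fun Z => f.val * 0
      funext Z
      simp

lemma vertical_mem_dualGr {d : ℤ} (α : (genTangent M ℓ).dualGr ⊤ d) :
    (fun η => α.1 (vertical ℓ η)) ∈ (tangent M).dual.dualGr ⊤ d := by
  refine ⟨α.2.1.comp_vertical, fun η => α.2.2.1 (vertical ℓ η), fun f η => ?_⟩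
  have e : vertical ℓ ((tangent M).dual.smul f η) = (genTangent M ℓ).smul f (vertical ℓ η) :=
    Homog.ext' rfl (Prod.ext ?_ rfl)
  · exact (congrArg α.1 e).trans (α.2.2.2 f (vertical ℓ η))
  change (0 : M.C ⊤ →ₗ[ℝ] M.C ⊤) = (-1 : ℝ) ^ (f.deg * ℓ) • (tangent M).act ⊤ f 0
  rw [map_zero, smul_zero]

/-- The canonical map to the double dual; the Koszul sign makes evaluation at `Y` linear over
functions with the degree of `Y`. -/
lemma eval_mem_dualGr (Y : VField M) :
    (fun η : Homog ((tangent M).dual.gr ⊤) => (-1 : ℝ) ^ (Y.deg * η.deg) • η.val Y) ∈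
      (tangent M).dual.dualGr ⊤ Y.deg := by
  refine ⟨IsGradedLinear.deg_smul (F := fun η : Homog ((tangent M).dual.gr ⊤) => η.val Y)
    ⟨fun _ _ _ _ _ => rfl, fun _ _ _ _ => rfl⟩ fun n => (-1 : ℝ) ^ (Y.deg * n), fun η => ?_,
    fun f η => ?_⟩
  · refine Submodule.smul_mem _ _ ?_
    have := η.mem.2.1 Y
    rwa [add_comm] at this
  · change (-1 : ℝ) ^ (Y.deg * (f.deg + η.deg)) • (f.val * η.val Y) =
      (-1 : ℝ) ^ (Y.deg * f.deg) • (f.val * (-1 : ℝ) ^ (Y.deg * η.deg) • η.val Y)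
    rw [mul_smul_comm, smul_smul, ← zpow_add₀ (by norm_num), mul_add]

lemma neg_one_zpow_smul_smul_self {A : Type*} [AddCommGroup A] [Module ℝ A] (n : ℤ) (a : A) :
    (-1 : ℝ) ^ n • (-1 : ℝ) ^ n • a = a := by
  rw [smul_smul, ← zpow_add₀ (by norm_num), Even.neg_one_zpow (Even.add_self _), one_smul]

lemma genMetric_horizontal (ψ : Homog ((genTangent M ℓ).gr ⊤)) (Y : VField M) :
    genMetric M ℓ ψ (horizontal ℓ Y) = (-1 : ℝ) ^ ((ψ.deg + ℓ) * ℓ) • cov ψ Y := by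
  rw [genMetric_apply, vec_horizontal, cov_horizontal, smul_zero, add_zero]

lemma genMetric_vertical (ψ : Homog ((genTangent M ℓ).gr ⊤))
    (η : Homog ((tangent M).dual.gr ⊤)) :
    genMetric M ℓ ψ (vertical ℓ η) = (-1 : ℝ) ^ ((ψ.deg + ℓ) * η.deg) • η.val (vec ψ) := by
  have : cov ψ (vec (vertical ℓ η)) = 0 := (cov_linear ψ).map_zero rfl
  rw [genMetric_apply, this, smul_zero, zero_add]
  rfl

/-- Testing against vertical sections with exact forms recovers the vector part on every homogeneous
function; testing against horizontal sections recovers the form part. -/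
lemma genMetric_injective {k : ℤ} {ψ φ : (genTangent M ℓ).gr ⊤ k}
    (h : genMetric M ℓ (Homog.of ψ) = genMetric M ℓ (Homog.of φ)) : ψ = φ := by
  refine Subtype.ext (Prod.ext (linearMap_ext_homog fun j f hf => ?_) (funext fun Y => ?_))
  · have := congrFun h (vertical ℓ (dHom ⟨j, f, hf⟩))
    rw [genMetric_vertical, genMetric_vertical] at this
    change (-1 : ℝ) ^ ((k + ℓ) * j) • dFun j f (vec (Homog.of ψ)) =
      (-1 : ℝ) ^ ((k + ℓ) * j) • dFun j f (vec (Homog.of φ)) at this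
    rw [dFun_apply, dFun_apply] at this
    have h2 := smul_right_injective _ (zpow_ne_zero _ (by norm_num)) this
    exact smul_right_injective _ (zpow_ne_zero _ (by norm_num : (-1 : ℝ) ≠ 0)) h2
  · have := congrFun h (horizontal ℓ Y)
    rw [genMetric_horizontal, genMetric_horizontal] at this
    exact smul_right_injective _ (zpow_ne_zero _ (by norm_num : (-1 : ℝ) ≠ 0)) this

/-- The restriction of α to vertical sections lies in the double dual and is evaluation at some
vector field `Y`; its restriction to horizontal sections is, up to sign, the 1-form of the preimage.
-/
lemma genMetric_bijective (k : ℤ) (α : (genTangent M ℓ).dual.gr ⊤ (k + ℓ)) :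
    ∃! ψ : (genTangent M ℓ).gr ⊤ k, genMetric M ℓ ⟨k, ψ, ψ.2⟩ = α := by
  obtain ⟨Y, hY⟩ := exists_gDer_of_dual_dualGr ⟨_, vertical_mem_dualGr α⟩
  have hβ : (⟨_, vertical_mem_dualGr α⟩ : (tangent M).dual.dualGr ⊤ (k + ℓ)) =
      ⟨_, eval_mem_dualGr ⟨k + ℓ, Y.1, Y.2⟩⟩ := by
    refine dual_dualGr_ext fun f => ?_
    change α.1 (vertical ℓ (dHom f)) =
      (-1 : ℝ) ^ ((k + ℓ) * f.deg) • dFun f.deg f.val ⟨k + ℓ, Y.1, Y.2⟩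
    rw [dFun_apply, hY]
    change _ = (-1 : ℝ) ^ ((k + ℓ) * f.deg) • (-1 : ℝ) ^ ((k + ℓ - 1) * f.deg) •
      (-1 : ℝ) ^ f.deg • α.1 (vertical ℓ (dHom f))
    rw [smul_smul, smul_smul, ← zpow_add₀ (by norm_num), ← zpow_add₀ (by norm_num),
      Even.neg_one_zpow ⟨(k + ℓ) * f.deg, by ring⟩, one_smul]
  refine ⟨⟨(Y.1, (-1 : ℝ) ^ ((k + ℓ) * ℓ) • fun Z => α.1 (horizontal ℓ Z)), Y.2,
    Submodule.smul_mem _ _ (horizontal_mem_dualGr rfl α)⟩, funext fun φ => ?_,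
    fun φ hφ => genMetric_injective (hφ.trans (Eq.symm ?_))⟩
  all_goals
    have key : ∀ φ, (-1 : ℝ) ^ ((k + ℓ) * ℓ) • (-1 : ℝ) ^ ((k + ℓ) * ℓ) •
        α.1 (horizontal ℓ (vec φ)) +
        (-1 : ℝ) ^ ((k + ℓ) * φ.deg) • cov φ ⟨k + ℓ, Y.1, Y.2⟩ = α.1 φ := fun φ => by
      rw [neg_one_zpow_smul_smul_self, apply_eq_horizontal_add_vertical α.2.1 φ]
      exact congrArg _ (congrFun (congrArg Subtype.val hβ) ⟨φ.deg, cov φ, cov_mem φ⟩).symm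
  · exact key φ
  · exact funext key

lemma genMetric_isFiberwiseMetric (M : GradedManifold.{u, v} X) (ℓ : ℤ) :
    IsFiberwiseMetric (genTangent M ℓ) ℓ (genMetric M ℓ) where
  isBundleMap := genMetric_isBundleMap
  symm := genMetric_symm
  bijective := genMetric_bijective

end Metric

end GradedGeometry

namespace GradedGeometry

variable {X : Type u} [TopologicalSpace X] [T2Space X] [SecondCountableTopology X]
  {M : GradedManifold.{u, v} X} {ℓ : ℤ}

/-! ### The graded Courant algebroid -/

section Courant

variable {H : FormFun M 3} (hH : IsForm (tangent M) 3 (-ℓ) H)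
  (ψ φ χ : Homog ((genTangent M ℓ).gr ⊤))

lemma pairing_genMetric_mem :
    pairing ℓ (genMetric M ℓ) ψ φ ∈ M.gr ⊤ (ψ.deg + φ.deg + ℓ) := by
  have := (genMetric_mem ψ).2.1 φ
  rw [show φ.deg + (ψ.deg + ℓ) = ψ.deg + φ.deg + ℓ by ring] at this
  exact Submodule.smul_mem _ _ this

include hH

/-- The witness for D⟨ψ, φ⟩ is the vertical section (0, (-1)^ℓ d⟨ψ, φ⟩); its zero vector part
matches antisymmetry of the commutator. -/
lemma exists_dorfman_skew : ∃ χ : Homog ((genTangent M ℓ).gr ⊤),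
    χ.deg = ψ.deg + φ.deg + ℓ ∧
    (∀ θ : Homog ((genTangent M ℓ).gr ⊤), genMetric M ℓ χ θ =
      (-1 : ℝ) ^ ((ψ.deg + φ.deg + ℓ) * ℓ) •
        dFun (ψ.deg + φ.deg + ℓ) (pairing ℓ (genMetric M ℓ) ψ φ) (vec θ)) ∧
    dorfman ℓ H ψ φ + (-1 : ℝ) ^ ((ψ.deg + ℓ) * (φ.deg + ℓ)) • dorfman ℓ H φ ψ =
      (-1 : ℝ) ^ (ψ.deg + φ.deg) • χ.val := by
  have hd := dFun_mem (pairing_genMetric_mem ψ φ)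
  refine ⟨vertical ℓ ⟨_, (-1 : ℝ) ^ ℓ • dFun (ψ.deg + φ.deg + ℓ)
    (pairing ℓ (genMetric M ℓ) ψ φ), Submodule.smul_mem _ _ hd⟩, rfl, fun θ => ?_,
    Prod.ext ?_ (funext fun Z => ?_)⟩
  · rw [genMetric_apply]
    have h0 : cov θ (vec (vertical ℓ ⟨_, (-1 : ℝ) ^ ℓ • dFun (ψ.deg + φ.deg + ℓ)
      (pairing ℓ (genMetric M ℓ) ψ φ), Submodule.smul_mem _ _ hd⟩)) = 0 :=
      (cov_linear θ).map_zero rfl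
    rw [h0, smul_zero, add_zero]
    change (-1 : ℝ) ^ ((ψ.deg + φ.deg + ℓ + ℓ) * ℓ) • (-1 : ℝ) ^ ℓ •
      dFun (ψ.deg + φ.deg + ℓ) (pairing ℓ (genMetric M ℓ) ψ φ) (vec θ) = _
    rw [smul_smul, ← zpow_add₀ (by norm_num)]
    congr 1
    refine neg_one_zpow_congr ?_
    push_cast
    generalize (ψ.deg : ZMod 2) = x, (φ.deg : ZMod 2) = y, (ℓ : ZMod 2) = z
    revert x y z; decide
  · have h := isGradedLinear_val.map_lie_swap (vec ψ) (vec φ)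
    change (lie (vec ψ) (vec φ)).val + (-1 : ℝ) ^ ((ψ.deg + ℓ) * (φ.deg + ℓ)) •
      (lie (vec φ) (vec ψ)).val = (-1 : ℝ) ^ (ψ.deg + φ.deg) • (0 : M.C ⊤ →ₗ[ℝ] M.C ⊤)
    rw [h, smul_neg, vec_deg, vec_deg, neg_one_zpow_smul_smul_self, smul_zero, add_neg_cancel]
  · refine (dorfman_skew hH ψ φ Z).trans ?_
    change _ = (-1 : ℝ) ^ (ψ.deg + φ.deg) • (-1 : ℝ) ^ ℓ •
      dFun (ψ.deg + φ.deg + ℓ) (pairing ℓ (genMetric M ℓ) ψ φ) Z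
    rw [smul_smul, ← zpow_add₀ (by norm_num)]

/-- The Jacobi identity for the twisted Dorfman bracket is the vanishing of `dH` on the vector
fields of the sections. -/
lemma dorfman_jacobi_iff :
    dorfman ℓ H ψ (dorfmanHom hH φ χ) = dorfman ℓ H (dorfmanHom hH ψ φ) χ +
      (-1 : ℝ) ^ ((ψ.deg + ℓ) * (φ.deg + ℓ)) • dorfman ℓ H φ (dorfmanHom hH ψ χ) ↔
    ∀ W, dForm (-ℓ) H ![vec ψ, vec φ, vec χ, W] = 0 := by
  rw [Prod.ext_iff]
  have h1 : (dorfman ℓ H ψ (dorfmanHom hH φ χ)).1 = (dorfman ℓ H (dorfmanHom hH ψ φ) χ +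
      (-1 : ℝ) ^ ((ψ.deg + ℓ) * (φ.deg + ℓ)) • dorfman ℓ H φ (dorfmanHom hH ψ χ)).1 := by
    change (lie (vec ψ) (vec (dorfmanHom hH φ χ))).val =
      (lie (vec (dorfmanHom hH ψ φ)) (vec χ)).val + (-1 : ℝ) ^ ((ψ.deg + ℓ) * (φ.deg + ℓ)) •
        (lie (vec φ) (vec (dorfmanHom hH ψ χ))).val
    rw [vec_dorfmanHom, vec_dorfmanHom, vec_dorfmanHom]
    exact isGradedLinear_val.map_lie_lie (vec ψ) (vec φ) (vec χ)
  rw [and_iff_right h1, funext_iff]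
  refine forall_congr' fun W => ?_
  rw [← dorfman_jacobiator hH ψ φ χ W, sub_sub, sub_eq_zero]
  rfl

lemma dorfman_isGradedCourantAlgebroid (hd : dForm (-ℓ) H = 0) :
    IsGradedCourantAlgebroid (genTangent M ℓ) ℓ (genAnchor M ℓ) (genMetric M ℓ)
      (dorfman ℓ H) where
  isGradedVectorBundle := genTangent_isGradedVectorBundle M ℓ
  anchor := genAnchor_isBundleMap
  metric := genMetric_isFiberwiseMetric M ℓ
  bracket_linear_left := dorfman_linear_left hH
  bracket_linear_right := dorfman_linear_right hH
  bracket_mem := dorfman_mem hH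
  compatible := dorfman_compatible hH
  skew := exists_dorfman_skew hH
  jacobi ψ φ χ := (dorfman_jacobi_iff hH ψ φ χ).2 fun W => by rw [hd]; rfl

/-- Horizontal sections realize arbitrary vector fields in the first three slots, and the fourth is
the argument of the form part of the Jacobiator. -/
lemma dForm_eq_zero_of_isGradedCourantAlgebroid
    (h : IsGradedCourantAlgebroid (genTangent M ℓ) ℓ (genAnchor M ℓ) (genMetric M ℓ)
      (dorfman ℓ H)) : dForm (-ℓ) H = 0 := by
  funext x
  have := (dorfman_jacobi_iff hH (horizontal ℓ (x 0)) (horizontal ℓ (x 1))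
    (horizontal ℓ (x 2))).1 (h.jacobi _ _ _) (x 3)
  rw [vec_horizontal, vec_horizontal, vec_horizontal, ← fun_fin_four_eq x] at this
  exact this

end Courant

end GradedGeometry

/-! ### The main theorem. -/

theorem mainTheorem1 {X : Type u} [TopologicalSpace X] [T2Space X] [SecondCountableTopology X]
    (M : GradedManifold.{u, v} X) (ℓ : ℤ) (H : FormFun M 3)
    (hH : IsForm (tangent M) 3 (-ℓ) H) :
    (IsGradedCourantAlgebroid (genTangent M ℓ) ℓ (genAnchor M ℓ) (genMetric M ℓ) (dorfman ℓ H) ↔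
      dForm (-ℓ) H = 0) ∧
    ∀ ω : FormFun M 2, IsForm (tangent M) 2 (-ℓ) ω →
      IsForm (tangent M) 3 (-ℓ) (H + dForm (-ℓ) ω) ∧
      IsBundleAutomorphism (genTangent M ℓ) (expForm ℓ ω) (expForm ℓ (-ω)) ∧
      Intertwines (genTangent M ℓ) ℓ (expForm ℓ ω)
        (dorfman ℓ (H + dForm (-ℓ) ω)) (dorfman ℓ H) ∧
      ∀ (ψ φ : Homog ((genTangent M ℓ).gr ⊤))
        (hψ : expForm ℓ ω ψ ∈ (genTangent M ℓ).gr ⊤ ψ.deg)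
        (hφ : expForm ℓ ω φ ∈ (genTangent M ℓ).gr ⊤ φ.deg),
        genAnchor M ℓ ⟨_, expForm ℓ ω ψ, hψ⟩ = genAnchor M ℓ ψ ∧
        pairing ℓ (genMetric M ℓ) ⟨_, expForm ℓ ω ψ, hψ⟩ ⟨_, expForm ℓ ω φ, hφ⟩ =
          pairing ℓ (genMetric M ℓ) ψ φ :=
  ⟨⟨dForm_eq_zero_of_isGradedCourantAlgebroid hH, dorfman_isGradedCourantAlgebroid hH⟩,
    fun _ hω => ⟨hH.add hω.dForm_two, expForm_isBundleAutomorphism hω,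
      expForm_intertwines hω hH, fun ψ φ hψ hφ => ⟨rfl, pairing_expForm hω ψ φ hψ hφ⟩⟩⟩
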